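/- There is a universal numerical constant $c>0$ such that the following holds for all dimensions $d$, numbers of workers $M\ge 1$ and numbers of iterations $K\ge M$. **Objective.** Let $F=\frac1M\sum_{i=1}^M F_i$ on $\mathbb R^d$ with $F_i(x)=\mathbb E_{\xi\sim\mathcal D_i}[f_i(x;\xi)]$, where $\mathcal D_i$ is the data distribution of worker $i$, the $F_i$ are differentiable, and for every $x$ the function $f_i(\cdot;\xi)$ is differentiable at $x$ for $\mathcal D_i$-almost every $\xi$. Assume that $F$ is bounded below with $F^*=\inf F$, that $F$ is $L$-smooth ($L>0$), i.e. $\|\nabla F(x)-\nabla F(y)\|\le L\|x-y\|$ for all $x,y$, and that for some $\zeta\ge0$ one has $\|\nabla F_i(x)-\nabla F(x)\|^2\le\zeta^2$ for all $i$ and $x$. **Algorithm.** Let $x_0$ be a (possibly random) initial point with $\mathbb E|F(x_0)|<\infty$, and let $\Delta>0$ satisfy $\Delta\ge\mathbb E F(x_0)-F^*$. Let $m_1,m_2,\ldots\in\{1,\dots,M\}$ be a (possibly random) sequence; $m_k$ is the worker whose stochastic gradient is used in iteration $k$. For $k\ge1$ put $\mathrm{prev}(k,i)=\max\{1\le j<k: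 m_j=i\}$ ($=0$ if there is no such $j$), $\mathrm{next}(k,i)=\min\{j\ge k:m_j=i\}$, and let $\tau(k)=k-\mathrm{prev}(k,m_k)$ be the delay. Let $\xi_k^i\sim\mathcal D_i$ ($k\ge0$, $1\le i\le M$) be independent samples, and assume that the family of all samples is independent of $(x_0,m_1,m_2,\dots)$. Asynchronous SGD performs, for $k\ge1$, $$x_k=x_{k-1}-\gamma_k\nabla f_{m_k}\big(x_{\mathrm{prev}(k,m_k)};\,\xi^{m_k}_{\mathrm{prev}(k,m_k)}\big),\qquad \gamma_k=\min\Big\{\frac1{8L\tau(k)},\ \frac1{4ML},\ \sqrt{\frac{\Delta}{KL\sigma^2}}\Big\},$$ where $\sigma\ge0$ and the last term is read as $+\infty$ if $\sigma=0$. **Noise.** Assume that the stochastic gradients $g_k=\nabla f_{m_k}(x_k;\xi_k^{m_k})$, $k\ge1$, satisfy $$\mathbb E[g_k\mid x_k,m_k]=\nabla F_{m_k}(x_k),\qquad \mathbb E\big[\|g_k-\nabla F_{m_k}(x_k)\|^2\mid x_k,m_k\big]\le\sigma^2,$$ and that likewise the gradients $\nabla f_i(x_0;\xi_0^i)$, which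 all workers $i=1,\dots,M$ compute at the start, have conditional mean $\nabla F_i(x_0)$ and conditional variance at most $\sigma^2$ given $x_0$. **Conclusion.** Let $\hat\gamma_k=\gamma_{\mathrm{next}(k+1,m_k)}$ be the stepsize with which the gradient computed at $x_k$ is eventually used ($\hat\gamma_k=0$ if it is never returned), and let $\tilde x_K$ be chosen at random from $x_1,\dots,x_K$ so that, conditionally on $x_0$, $(m_j)_j$ and all samples, $\mathbb P(\tilde x_K=x_k)=\hat\gamma_k/\sum_{l=1}^K\hat\gamma_l$ (as a choice of the index $k$). Then $$\mathbb E\big[\|\nabla F(\tilde x_K)\|^2\big]\le c\left(\frac{ML\Delta}{K}+\sqrt{\frac{L\Delta\sigma^2}{K}}+\zeta^2\right),$$ and in particular this expectation is finite. -/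

import Mathlib

open MeasureTheory ProbabilityTheory

noncomputable section

namespace AsyncSGD

/-! ### The objective -/

/-- `F` is `L`-smooth: differentiable, with an `L`-Lipschitz gradient (Euclidean norm). -/
def LSmooth {d : ℕ} (L : ℝ) (F : EuclideanSpace ℝ (Fin d) → ℝ) : Prop :=
  Differentiable ℝ F ∧ ∀ x y, ‖gradient F x - gradient F y‖ ≤ L * ‖x - y‖

/-- The local objective `F_i(x) = E_{ξ ∼ D_i} f_i(x; ξ)` of worker `i`. -/
def localObj {d M : ℕ} {Ξ : Type*} [MeasurableSpace Ξ]
    (f : Fin M → EuclideanSpace ℝ (Fin d) → Ξ → ℝ) (D : Fin M → Measure Ξ)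
    (i : Fin M) (x : EuclideanSpace ℝ (Fin d)) : ℝ :=
  ∫ s, f i x s ∂(D i)

/-- The global objective `F = (1/M) ∑ F_i`. -/
def globalObj {d M : ℕ} {Ξ : Type*} [MeasurableSpace Ξ]
    (f : Fin M → EuclideanSpace ℝ (Fin d) → Ξ → ℝ) (D : Fin M → Measure Ξ)
    (x : EuclideanSpace ℝ (Fin d)) : ℝ :=
  (1 / (M : ℝ)) * ∑ i, localObj f D i x

/-- The stochastic gradient `∇ f_i(x; s)` (gradient in `x`). -/
def stochGrad {d M : ℕ} {Ξ : Type*}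
    (f : Fin M → EuclideanSpace ℝ (Fin d) → Ξ → ℝ)
    (i : Fin M) (x : EuclideanSpace ℝ (Fin d)) (s : Ξ) : EuclideanSpace ℝ (Fin d) :=
  gradient (fun y => f i y s) x

/-! ### Delays.  `w k` (for `k ≥ 1`) is the worker whose gradient is used in iteration `k`;
the value `w 0` is never used. -/

/-- `prev(k, i) = max {j < k : w j = i}`, the last iteration before `k` in which worker `i`
returned a gradient. It is `0` if there is none: then worker `i` is still working on the gradient
at the initial point. -/
def prev {M : ℕ} (w : ℕ → Fin M) (k : ℕ) (i : Fin M) : ℕ :=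
  ((Finset.range k).filter (fun j => 1 ≤ j ∧ w j = i)).sup id

/-- `next(k, i) = min {j ≥ k : w j = i}`, the first iteration from `k` on in which worker `i`
returns a gradient (only used when there is one). -/
def next {M : ℕ} (w : ℕ → Fin M) (k : ℕ) (i : Fin M) : ℕ :=
  sInf {j : ℕ | k ≤ j ∧ w j = i}

/-- `τ(k) = k - prev(k, w k)`, the delay of the gradient used in iteration `k ≥ 1`. -/
def delay {M : ℕ} (w : ℕ → Fin M) (k : ℕ) : ℕ :=
  k - prev w k (w k)

theorem prev_le {M : ℕ} (w : ℕ → Fin M) (k : ℕ) (i : Fin M) : prev w (k + 1) i ≤ k := by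
  unfold prev
  refine Finset.sup_le fun j hj => ?_
  have := Finset.mem_range.1 (Finset.mem_filter.1 hj).1
  simp only [id]
  omega

/-! ### The algorithm -/

/-- The stepsize `min {1/(8Lτ), 1/(4ML), √(Δ/(KLσ²))}` for a gradient of delay `τ`.
If `σ = 0`, the last entry is `+∞`, i.e. absent. -/
def stepsize (L Δ σ : ℝ) (M K τ : ℕ) : ℝ :=
  if σ = 0 then min (1 / (8 * L * τ)) (1 / (4 * M * L))
  else min (min (1 / (8 * L * τ)) (1 / (4 * M * L))) (Real.sqrt (Δ / (K * L * σ ^ 2)))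

/-- One run of Asynchronous SGD:
`x_k = x_{k-1} - γ_k ∇f_{w k}(x_{prev(k, w k)}; ξ_{prev(k, w k)}^{w k})`, started at `x₀`.
Here `ξ j i` is the sample drawn by worker `i` for a gradient at `x_j`. -/
def iterate {d M : ℕ} {Ξ : Type*} (f : Fin M → EuclideanSpace ℝ (Fin d) → Ξ → ℝ)
    (γ : ℕ → ℝ) (w : ℕ → Fin M) (ξ : ℕ → Fin M → Ξ) (x₀ : EuclideanSpace ℝ (Fin d)) :
    ℕ → EuclideanSpace ℝ (Fin d)
  | 0 => x₀
  | k + 1 =>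
      iterate f γ w ξ x₀ k
        - γ (k + 1) • stochGrad f (w (k + 1))
            (iterate f γ w ξ x₀ (prev w (k + 1) (w (k + 1))))
            (ξ (prev w (k + 1) (w (k + 1))) (w (k + 1)))
  termination_by k => k
  decreasing_by
    · exact Nat.lt_succ_self k
    · exact Nat.lt_succ_of_le (prev_le w k (w (k + 1)))

open Classical in
/-- `γ̂_k = γ_{next(k+1, w k)}`, the stepsize with which the gradient computed at `x_k` is
eventually used. It is `0` if worker `w k` never returns that gradient (infinite delay). -/
def hatStep {M : ℕ} (γ : ℕ → ℝ) (w : ℕ → Fin M) (k : ℕ) : ℝ :=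
  if ∃ j, k + 1 ≤ j ∧ w j = w k then γ (next w (k + 1) (w k)) else 0

/-! ### The noise -/

/-- Conditionally on `𝓖`, the random vector `g` has mean `v` and variance at most `σ²`. -/
def CondUnbiasedBoundedVariance {d : ℕ} {Ω : Type*} [MeasurableSpace Ω] (P : Measure Ω)
    (𝓖 : MeasurableSpace Ω) (g v : Ω → EuclideanSpace ℝ (Fin d)) (σ : ℝ) : Prop :=
  Integrable g P ∧ P[g | 𝓖] =ᵐ[P] v ∧
    Integrable (fun ω => ‖g ω - v ω‖ ^ 2) P ∧
    ∀ᵐ ω ∂P, (P[fun ω' => ‖g ω' - v ω'‖ ^ 2 | 𝓖]) ω ≤ σ ^ 2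

end AsyncSGD

end

/-! The difficulty is that an iteration moves along a gradient taken at an old point. The virtual
iterate `virt` removes it: every gradient still in flight is applied at once, with the stepsize it
will eventually receive. Since each gradient computed is either used or pending, the virtual
iterates move by the fresh gradient at x_k with step γ̂_k. They thus perform SGD with gradients
evaluated at a perturbed point, the perturbation being the sum of the gradients that the other
workers have pending.

Smoothness gives a descent inequality along the virtual iterates (`descent_step`). The deterministic
part of the perturbation costs (L/2) Σ p² ‖v‖² over the pending local gradients v with steps p. A
gradient of delay τ is charged only while it waits, fewer than τ times, and p ≤ 1/(8Lτ), so the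
total charge is at most 1/16 of Σ p ‖v‖² (`sum_sq_pendStep_le`) and is absorbed by the descent.
Hence `gradMass_le`: on each path, the step-weighted sum of squared local gradients is bounded by
the initial gap, a multiple of ζ² and the noise term `totalNoise`.

The steps depend on the future of the schedule, so the natural filtration of the iterates is of no
use for the noise. Instead, each noise vector is conditioned on x_0, the whole schedule and all
samples but its own (`otherAlg`). Independence of the samples shows that it remains centred with
variance at most σ² (`runNoise_condExp`). Distinct noise vectors are then orthogonal even with
schedule-dependent coefficients (`integral_norm_sum_runNoise_sq_le`). Writing s for `stepCap`, K L
σ² s² ≤ Δ, so the noise contributes at most 3Δ/2 in expectation.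

It remains to divide by Σ γ̂_k. If K ≥ 2M, the delays sum to at most MK, so a quarter of the
iterations use a non-initial gradient of delay at most 4M, and Σ γ̂_k ≥ Ks/32 on every path
(`le_sum_hatStep`). If M ≤ K < 2M, this sum may be tiny, but x_1, …, x_K stay close to x_0
(`norm_gradient_sq_le`), so every schedule-dependent average of ‖∇F(x_k)‖² is of order LΔ + ζ² in
expectation, and LΔ ≤ 2MLΔ/K. -/

noncomputable section

namespace AsyncSGD

/-! ### Pending gradients -/

section Pending

variable {M : ℕ}

open Classical in
/-- The stepsize with which the gradient that worker `i` is computing just before iteration `k`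
is eventually used. It is `0` if that gradient is never returned. -/
def pendStep (γ : ℕ → ℝ) (w : ℕ → Fin M) (k : ℕ) (i : Fin M) : ℝ :=
  if ∃ j, k ≤ j ∧ w j = i then γ (next w k i) else 0

theorem hatStep_eq_pendStep (γ : ℕ → ℝ) (w : ℕ → Fin M) (k : ℕ) :
    hatStep γ w k = pendStep γ w (k + 1) (w k) := rfl

theorem prev_one (w : ℕ → Fin M) (i : Fin M) : prev w 1 i = 0 := by
  have := prev_le w 0 i
  simpa using this

theorem prev_succ (w : ℕ → Fin M) {k : ℕ} (hk : 1 ≤ k) (i : Fin M) :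
    prev w (k + 1) i = if w k = i then k else prev w k i := by
  unfold prev
  rw [Finset.range_add_one, Finset.filter_insert]
  by_cases h : w k = i
  · rw [if_pos ⟨hk, h⟩, if_pos h, Finset.sup_insert]
    refine sup_eq_left.2 (Finset.sup_le fun j hj => ?_)
    exact (Finset.mem_range.1 (Finset.mem_filter.1 hj).1).le
  · rw [if_neg (fun h' => h h'.2), if_neg h]

theorem prev_succ_self (w : ℕ → Fin M) {k : ℕ} (hk : 1 ≤ k) : prev w (k + 1) (w k) = k := by
  rw [prev_succ w hk, if_pos rfl]

theorem prev_succ_of_ne {w : ℕ → Fin M} {k : ℕ} (hk : 1 ≤ k) {i : Fin M} (h : w k ≠ i) :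
    prev w (k + 1) i = prev w k i := by
  rw [prev_succ w hk, if_neg h]

theorem prev_eq_zero_or (w : ℕ → Fin M) (k : ℕ) (i : Fin M) :
    prev w (k + 1) i = 0 ∨ w (prev w (k + 1) i) = i := by
  induction k with
  | zero => exact Or.inl (prev_one w i)
  | succ k ih =>
    rw [prev_succ w (by omega)]
    split_ifs with h
    · exact Or.inr h
    · exact ih

theorem next_eq_of_eq {w : ℕ → Fin M} {k : ℕ} {i : Fin M} (h : w k = i) : next w k i = k := by
  refine le_antisymm (Nat.sInf_le ⟨le_rfl, h⟩) ?_
  exact (Nat.sInf_mem (s := {j | k ≤ j ∧ w j = i}) ⟨k, le_rfl, h⟩).1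

theorem next_succ_of_ne {w : ℕ → Fin M} {k : ℕ} {i : Fin M} (h : w k ≠ i) :
    next w (k + 1) i = next w k i := by
  unfold next
  congr 1
  ext j
  constructor
  · rintro ⟨h1, h2⟩
    exact ⟨by omega, h2⟩
  · rintro ⟨h1, h2⟩
    refine ⟨?_, h2⟩
    rcases h1.eq_or_lt with rfl | h1
    · exact absurd h2 h
    · exact h1

theorem pendStep_self (γ : ℕ → ℝ) (w : ℕ → Fin M) (k : ℕ) : pendStep γ w k (w k) = γ k := by
  unfold pendStep
  rw [if_pos ⟨k, le_rfl, rfl⟩, next_eq_of_eq rfl]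

theorem pendStep_succ_of_ne (γ : ℕ → ℝ) {w : ℕ → Fin M} {k : ℕ} {i : Fin M} (h : w k ≠ i) :
    pendStep γ w (k + 1) i = pendStep γ w k i := by
  unfold pendStep
  rw [next_succ_of_ne h]
  congr 1
  refine propext ⟨?_, ?_⟩
  · rintro ⟨j, h1, h2⟩
    exact ⟨j, by omega, h2⟩
  · rintro ⟨j, h1, h2⟩
    rcases h1.eq_or_lt with rfl | h1
    · exact absurd h2 h
    · exact ⟨j, h1, h2⟩

/-- Worker i returns nothing between the start of its pending gradient and iteration k + 1, so the
step attached to that gradient has not changed since it was started. This makes `pendStep γ w (j +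
1) i` a label of the gradient at x_j, to which `sum_used_add_sum_pending` can be applied. -/
theorem pendStep_prev (γ : ℕ → ℝ) (w : ℕ → Fin M) (k : ℕ) (i : Fin M) :
    pendStep γ w (prev w (k + 1) i + 1) i = pendStep γ w (k + 1) i := by
  induction k with
  | zero => rw [prev_one]
  | succ k ih =>
    rw [prev_succ w (by omega)]
    split_ifs with h
    · rfl
    · rw [ih, pendStep_succ_of_ne γ h]

/-- Up to its next return, worker i keeps the same gradient; the delay at that return is therefore
determined by `prev w k i`. -/
theorem prev_next {w : ℕ → Fin M} {k : ℕ} {i : Fin M} (hk : 1 ≤ k) (h : ∃ j, k ≤ j ∧ w j = i) :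
    k ≤ next w k i ∧ w (next w k i) = i ∧ prev w (next w k i) i = prev w k i := by
  obtain ⟨h1, h2⟩ : next w k i ∈ {j | k ≤ j ∧ w j = i} := Nat.sInf_mem h
  refine ⟨h1, h2, ?_⟩
  have key : ∀ n, k ≤ n → n ≤ next w k i → prev w n i = prev w k i := by
    intro n hn
    induction n, hn using Nat.le_induction with
    | base => exact fun _ => rfl
    | succ n hn ih =>
      intro hlt
      rw [prev_succ_of_ne (by omega), ih (by omega)]
      intro hw
      have : next w k i ≤ n := Nat.sInf_le ⟨hn, hw⟩
      omega
  exact key _ h1 le_rfl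

/-- Every gradient computed is either used or still pending. -/
theorem sum_used_add_sum_pending {A : Type*} [AddCommGroup A] (h : ℕ → Fin M → A)
    (w : ℕ → Fin M) (T : ℕ) :
    ∑ k ∈ Finset.range T, h (prev w (k + 1) (w (k + 1))) (w (k + 1))
        + ∑ i, h (prev w (T + 1) i) i
      = ∑ i, h 0 i + ∑ k ∈ Finset.range T, h (k + 1) (w (k + 1)) := by
  induction T with
  | zero => simp [prev_one]
  | succ T ih =>
    -- Iteration T + 1 changes only the entry of worker `w (T + 1)`: its old gradient is used, and
    -- the one at x_{T+1} takes its place.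
    have hstep : ∑ i, h (prev w (T + 2) i) i + h (prev w (T + 1) (w (T + 1))) (w (T + 1))
        = ∑ i, h (prev w (T + 1) i) i + h (T + 1) (w (T + 1)) := by
      rw [← Finset.add_sum_erase _ _ (Finset.mem_univ (w (T + 1))),
        ← Finset.add_sum_erase _ (fun i => h (prev w (T + 1) i) i) (Finset.mem_univ (w (T + 1))),
        prev_succ_self w (by omega : 1 ≤ T + 1)]
      rw [Finset.sum_congr rfl (g := fun i => h (prev w (T + 1) i) i)]
      · abel
      · intro i hi
        rw [prev_succ_of_ne (by omega) (Finset.ne_of_mem_erase hi).symm]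
    rw [Finset.sum_range_succ, Finset.sum_range_succ, ← add_assoc, ← ih]
    rw [add_assoc, add_comm (h _ _), hstep]
    abel

end Pending

/-! ### Stepsizes -/

section Stepsize

/-- The delay-independent bound on the stepsizes. -/
def stepCap (L Δ σ : ℝ) (M K : ℕ) : ℝ :=
  if σ = 0 then 1 / (4 * M * L) else min (1 / (4 * M * L)) (Real.sqrt (Δ / (K * L * σ ^ 2)))

variable {L Δ σ : ℝ} {M K : ℕ}

theorem stepsize_eq_min (τ : ℕ) :
    stepsize L Δ σ M K τ = min (1 / (8 * L * τ)) (stepCap L Δ σ M K) := by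
  unfold stepsize stepCap
  split_ifs
  · rfl
  · rw [min_assoc]

theorem stepCap_le : stepCap L Δ σ M K ≤ 1 / (4 * M * L) := by
  unfold stepCap
  split_ifs
  · exact le_rfl
  · exact min_le_left _ _

theorem stepCap_pos (hL : 0 < L) (hΔ : 0 < Δ) (hM : 0 < M) (hK : 0 < K) :
    0 < stepCap L Δ σ M K := by
  unfold stepCap
  split_ifs with h
  · positivity
  · have : 0 < σ ^ 2 := by positivity
    exact lt_min (by positivity) (Real.sqrt_pos.2 (by positivity))

theorem mul_stepCap_le (hL : 0 < L) (hM : 0 < M) : 4 * M * L * stepCap L Δ σ M K ≤ 1 := by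
  have := stepCap_le (L := L) (Δ := Δ) (σ := σ) (M := M) (K := K)
  rwa [le_div_iff₀' (by positivity)] at this

theorem mul_sq_stepCap_le (hL : 0 < L) (hΔ : 0 < Δ) (hM : 0 < M) (hK : 0 < K) :
    K * L * σ ^ 2 * stepCap L Δ σ M K ^ 2 ≤ Δ := by
  by_cases h : σ = 0
  · simp [h, hΔ.le]
  · have h2 : 0 < σ ^ 2 := by positivity
    have h1 : stepCap L Δ σ M K ≤ Real.sqrt (Δ / (K * L * σ ^ 2)) := by
      unfold stepCap
      rw [if_neg h]
      exact min_le_right _ _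
    have h3 := pow_le_pow_left₀ (stepCap_pos hL hΔ hM hK).le h1 2
    rw [Real.sq_sqrt (by positivity), le_div_iff₀' (by positivity)] at h3
    exact h3

/-- One entry attains the minimum defining the cap: 1/(4ML) yields the first term exactly, and the
square root yields the second. -/
theorem div_stepCap_le (hL : 0 < L) (hΔ : 0 < Δ) (hM : 0 < M) (hK : 0 < K) :
    Δ / (K * stepCap L Δ σ M K)
      ≤ 4 * (M * L * Δ / K) + Real.sqrt (L * Δ * σ ^ 2 / K) := by
  have hs := stepCap_pos (σ := σ) hL hΔ hM hK
  have hcase : stepCap L Δ σ M K = 1 / (4 * M * L) ∨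
      (σ ≠ 0 ∧ stepCap L Δ σ M K = Real.sqrt (Δ / (K * L * σ ^ 2))) := by
    unfold stepCap
    split_ifs with h
    · exact Or.inl rfl
    · rcases min_choice (1 / (4 * M * L)) (Real.sqrt (Δ / (K * L * σ ^ 2))) with h' | h'
      · exact Or.inl h'
      · exact Or.inr ⟨h, h'⟩
  rcases hcase with h | ⟨h0, h⟩
  · have : Δ / (K * stepCap L Δ σ M K) = 4 * (M * L * Δ / K) := by
      rw [h]
      field_simp
    rw [this]
    have := Real.sqrt_nonneg (L * Δ * σ ^ 2 / K)
    linarith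
  · have h2 : 0 < σ ^ 2 := by positivity
    have : Δ / (K * stepCap L Δ σ M K) = Real.sqrt (L * Δ * σ ^ 2 / K) := by
      symm
      rw [Real.sqrt_eq_iff_mul_self_eq (by positivity) (by positivity), ← sq, div_pow, mul_pow, h,
        Real.sq_sqrt (by positivity)]
      field_simp
    rw [this]
    have : 0 ≤ M * L * Δ / K := by positivity
    linarith

theorem stepsize_nonneg (hL : 0 < L) (hΔ : 0 < Δ) (hM : 0 < M) (hK : 0 < K) (τ : ℕ) :
    0 ≤ stepsize L Δ σ M K τ := by
  rw [stepsize_eq_min]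
  exact le_min (by positivity) (stepCap_pos hL hΔ hM hK).le

theorem stepsize_le_cap (τ : ℕ) : stepsize L Δ σ M K τ ≤ stepCap L Δ σ M K := by
  rw [stepsize_eq_min]
  exact min_le_right _ _

theorem stepsize_mul_le (hL : 0 < L) (τ : ℕ) : 8 * L * τ * stepsize L Δ σ M K τ ≤ 1 := by
  rcases Nat.eq_zero_or_pos τ with rfl | hτ
  · simp
  · have : stepsize L Δ σ M K τ ≤ 1 / (8 * L * τ) := by
      rw [stepsize_eq_min]
      exact min_le_left _ _
    rwa [le_div_iff₀' (by positivity)] at this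

/-- For τ ≤ 4M the delay-dependent entry is at least 1/(32ML), an eighth of 1/(4ML). -/
theorem cap_div_le_stepsize (hL : 0 < L) (hΔ : 0 < Δ) (hM : 0 < M) (hK : 0 < K) {τ : ℕ}
    (h0 : 0 < τ) (hτ : τ ≤ 4 * M) : stepCap L Δ σ M K / 8 ≤ stepsize L Δ σ M K τ := by
  have hs := stepCap_pos (σ := σ) hL hΔ hM hK
  rw [stepsize_eq_min]
  refine le_min ?_ (by linarith)
  rw [le_div_iff₀' (by positivity)]
  have h1 := mul_stepCap_le (Δ := Δ) (σ := σ) (K := K) hL hM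
  have h2 : (τ : ℝ) ≤ 4 * M := by exact_mod_cast hτ
  nlinarith [mul_le_mul_of_nonneg_left h2 (mul_pos hL hs).le]

end Stepsize

/-! ### Bounds on the steps of pending gradients -/

section PendStep

variable {L Δ σ : ℝ} {M K : ℕ} {w : ℕ → Fin M} {γ : ℕ → ℝ}

theorem pendStep_nonneg (hL : 0 < L) (hΔ : 0 < Δ) (hM : 0 < M) (hK : 0 < K)
    (hγ : ∀ k, γ k = stepsize L Δ σ M K (delay w k)) (k : ℕ) (i : Fin M) :
    0 ≤ pendStep γ w k i := by
  unfold pendStep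
  split_ifs
  · rw [hγ]
    exact stepsize_nonneg hL hΔ hM hK _
  · exact le_rfl

theorem pendStep_le_cap (hL : 0 < L) (hΔ : 0 < Δ) (hM : 0 < M) (hK : 0 < K)
    (hγ : ∀ k, γ k = stepsize L Δ σ M K (delay w k)) (k : ℕ) (i : Fin M) :
    pendStep γ w k i ≤ stepCap L Δ σ M K := by
  unfold pendStep
  split_ifs
  · rw [hγ]
    exact stepsize_le_cap _
  · exact (stepCap_pos hL hΔ hM hK).le

/-- The age of a pending gradient is at most its delay τ when it is returned, and its step is at
most 1/(8Lτ). A gradient that is never returned has step 0. -/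
theorem pendStep_mul_age_le (hL : 0 < L) (hΔ : 0 < Δ) (hM : 0 < M) (hK : 0 < K)
    (hγ : ∀ k, γ k = stepsize L Δ σ M K (delay w k)) (k : ℕ) (i : Fin M) :
    8 * L * ((k : ℝ) - prev w (k + 1) i) * pendStep γ w (k + 1) i ≤ 1 := by
  unfold pendStep
  split_ifs with h
  · obtain ⟨h1, h2, h3⟩ := prev_next (by omega) h
    have hs := stepsize_nonneg (σ := σ) hL hΔ hM hK (delay w (next w (k + 1) i))
    have hle := stepsize_mul_le (Δ := Δ) (σ := σ) (M := M) (K := K) hL (delay w (next w (k + 1) i))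
    rw [hγ]
    refine le_trans ?_ hle
    have hd : (k : ℝ) - prev w (k + 1) i ≤ (delay w (next w (k + 1) i) : ℕ) := by
      have : k ≤ delay w (next w (k + 1) i) + prev w (k + 1) i := by
        unfold delay
        rw [h2, h3]
        omega
      have : (k : ℝ) ≤ delay w (next w (k + 1) i) + prev w (k + 1) i := by exact_mod_cast this
      linarith
    gcongr
  · simp

/-- A gradient of delay `τ` is pending during `τ - 1` iterations in which others are used. -/
theorem sum_sq_pendStep_le (hL : 0 < L) (hΔ : 0 < Δ) (hM : 0 < M) (hK : 0 < K)
    (hγ : ∀ k, γ k = stepsize L Δ σ M K (delay w k)) (u : ℕ → Fin M → ℝ)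
    (hu : ∀ j i, 0 ≤ u j i) (T : ℕ) :
    8 * L * ∑ k ∈ Finset.range T, ∑ i ∈ Finset.univ.erase (w (k + 1)),
        pendStep γ w (k + 1) i ^ 2 * u (prev w (k + 1) i) i
      ≤ ∑ i, pendStep γ w 1 i * u 0 i
        + ∑ k ∈ Finset.range T, hatStep γ w (k + 1) * u (k + 1) (w (k + 1)) := by
  -- A potential: a gradient with step p starts with credit p u and pays 8L p² u in each iteration
  -- in which it waits. `B T i` is the credit left at age T - prev, nonnegative by
  -- `pendStep_mul_age_le`.
  let B : ℕ → Fin M → ℝ := fun T i => pendStep γ w (T + 1) i * u (prev w (T + 1) i) i *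
    (1 - 8 * L * ((T : ℝ) - prev w (T + 1) i) * pendStep γ w (T + 1) i)
  have hB : ∀ T i, 0 ≤ B T i := fun T i =>
    mul_nonneg (mul_nonneg (pendStep_nonneg hL hΔ hM hK hγ _ _) (hu _ _))
      (sub_nonneg.2 (pendStep_mul_age_le hL hΔ hM hK hγ T i))
  suffices h : 8 * L * ∑ k ∈ Finset.range T, ∑ i ∈ Finset.univ.erase (w (k + 1)),
        pendStep γ w (k + 1) i ^ 2 * u (prev w (k + 1) i) i + ∑ i, B T i
      ≤ ∑ i, pendStep γ w 1 i * u 0 i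
        + ∑ k ∈ Finset.range T, hatStep γ w (k + 1) * u (k + 1) (w (k + 1)) by
    have : 0 ≤ ∑ i, B T i := Finset.sum_nonneg fun i _ => hB T i
    linarith
  induction T with
  | zero => simp [B, prev_one]
  | succ T ih =>
    rw [Finset.sum_range_succ, Finset.sum_range_succ]
    have h1 : ∑ i, B (T + 1) i = hatStep γ w (T + 1) * u (T + 1) (w (T + 1))
        + ∑ i ∈ Finset.univ.erase (w (T + 1)), B (T + 1) i := by
      rw [← Finset.add_sum_erase _ _ (Finset.mem_univ (w (T + 1)))]
      simp only [B]
      rw [prev_succ_self w (by omega : 1 ≤ T + 1), hatStep_eq_pendStep]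
      simp
    have h2 : ∑ i ∈ Finset.univ.erase (w (T + 1)), B (T + 1) i
        = ∑ i ∈ Finset.univ.erase (w (T + 1)), B T i
          - 8 * L * ∑ i ∈ Finset.univ.erase (w (T + 1)),
              pendStep γ w (T + 1) i ^ 2 * u (prev w (T + 1) i) i := by
      rw [Finset.mul_sum, ← Finset.sum_sub_distrib]
      refine Finset.sum_congr rfl fun i hi => ?_
      have hne := (Finset.ne_of_mem_erase hi).symm
      simp only [B]
      rw [prev_succ_of_ne (by omega) hne, pendStep_succ_of_ne γ hne]
      push_cast
      ring
    -- The credit left to the gradient used in iteration T + 1 is discarded.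
    have h3 : ∑ i ∈ Finset.univ.erase (w (T + 1)), B T i ≤ ∑ i, B T i :=
      Finset.sum_le_sum_of_subset_of_nonneg (Finset.erase_subset _ _) fun i _ _ => hB T i
    rw [h1, h2]
    linarith

/-- The sum of the delays of the first `K` iterations is at most `M K`. -/
theorem sum_delay_le (w : ℕ → Fin M) (K : ℕ) :
    ∑ k ∈ Finset.range K, delay w (k + 1) ≤ M * K := by
  -- With h j i = j, the sum of the delays turns out to equal the sum of the starting indices of the
  -- M gradients pending after iteration K, each at most K.
  have h := sum_used_add_sum_pending (fun j _ => (j : ℤ)) w K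
  simp only [Nat.cast_zero, Finset.sum_const_zero, zero_add] at h
  have h1 : ∑ i, (prev w (K + 1) i : ℤ) ≤ M * K := by
    calc ∑ i, (prev w (K + 1) i : ℤ) ≤ ∑ _i : Fin M, (K : ℤ) :=
          Finset.sum_le_sum fun i _ => by exact_mod_cast prev_le w K i
      _ = M * K := by simp
  have h2 : ((∑ k ∈ Finset.range K, delay w (k + 1) : ℕ) : ℤ)
      = ∑ k ∈ Finset.range K, ((k + 1 : ℕ) : ℤ)
        - ∑ k ∈ Finset.range K, (prev w (k + 1) (w (k + 1)) : ℤ) := by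
    rw [Nat.cast_sum, ← Finset.sum_sub_distrib]
    refine Finset.sum_congr rfl fun k _ => ?_
    have := prev_le w k (w (k + 1))
    unfold delay
    omega
  have : ((∑ k ∈ Finset.range K, delay w (k + 1) : ℕ) : ℤ) ≤ M * K := by
    rw [h2]
    linarith
  exact_mod_cast this

/-- Each worker returns its gradient at x_0 at most once; this is `sum_used_add_sum_pending` for the
indicator of j = 0. -/
theorem card_initial_le (w : ℕ → Fin M) (K : ℕ) :
    ((Finset.range K).filter (fun k => prev w (k + 1) (w (k + 1)) = 0)).card ≤ M := by
  have h := sum_used_add_sum_pending (fun j _ => if j = 0 then (1 : ℤ) else 0) w K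
  have h1 : (0 : ℤ) ≤ ∑ i, if prev w (K + 1) i = 0 then (1 : ℤ) else 0 :=
    Finset.sum_nonneg fun i _ => by split_ifs <;> simp
  simp only [if_true, Nat.add_eq_zero_iff, one_ne_zero, and_false, if_false, Finset.sum_const,
    Finset.card_univ, Fintype.card_fin, smul_zero, add_zero, Finset.sum_boole] at h
  simp only [nsmul_eq_mul, mul_one] at h
  have : (((Finset.range K).filter (fun k => prev w (k + 1) (w (k + 1)) = 0)).card : ℤ) ≤ M := by
    simp only [Finset.sum_boole] at h1
    linarith
  exact_mod_cast this

/-- If `K ≥ 2 M`, at least a quarter of the first `K` iterations use a gradient of delay at most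
`4 M` that is not one of the initial ones. -/
theorem le_card_small_delay (hM : 0 < M) (w : ℕ → Fin M) (hK : 2 * M ≤ K) :
    K ≤ 4 * ((Finset.range K).filter (fun k => prev w (k + 1) (w (k + 1)) ≠ 0 ∧
      delay w (k + 1) ≤ 4 * M)).card := by
  set A := (Finset.range K).filter (fun k => prev w (k + 1) (w (k + 1)) = 0)
  set B := (Finset.range K).filter (fun k => 4 * M < delay w (k + 1)) with hB
  set C := (Finset.range K).filter (fun k => prev w (k + 1) (w (k + 1)) ≠ 0 ∧
      delay w (k + 1) ≤ 4 * M)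
  have hcover : Finset.range K ⊆ A ∪ B ∪ C := by
    intro k hk
    simp only [A, B, C, Finset.mem_union, Finset.mem_filter, hk, true_and]
    by_cases h : prev w (k + 1) (w (k + 1)) = 0
    · exact Or.inl (Or.inl h)
    · by_cases h' : 4 * M < delay w (k + 1)
      · exact Or.inl (Or.inr h')
      · exact Or.inr ⟨h, by omega⟩
  have h1 : K ≤ A.card + B.card + C.card := by
    calc K = (Finset.range K).card := by simp
      _ ≤ (A ∪ B ∪ C).card := Finset.card_le_card hcover
      _ ≤ (A ∪ B).card + C.card := Finset.card_union_le _ _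
      _ ≤ _ := by
        have := Finset.card_union_le A B
        omega
  have h2 : A.card ≤ M := card_initial_le w K
  -- Markov's inequality for the delays. It gives |B| ≤ K/4; together with |A| ≤ M ≤ K/2 this leaves
  -- K/4 iterations for C.
  have h3 : B.card * (4 * M + 1) ≤ M * K := by
    calc B.card * (4 * M + 1) = ∑ _k ∈ B, (4 * M + 1) := by simp
      _ ≤ ∑ k ∈ B, delay w (k + 1) :=
        Finset.sum_le_sum fun k hk => (Finset.mem_filter.1 hk).2
      _ ≤ ∑ k ∈ Finset.range K, delay w (k + 1) :=
        Finset.sum_le_sum_of_subset (Finset.filter_subset _ _)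
      _ ≤ M * K := sum_delay_le w K
  have h4 : 4 * B.card ≤ K := by
    by_contra hcon
    have : M * (K + 1) ≤ M * (4 * B.card) := Nat.mul_le_mul_left _ (by omega)
    nlinarith
  omega

/-- The steps of the gradients computed at x_1, …, x_K sum to at least those of the non-initial
gradients used up to iteration K. A quarter of the iterations use such a gradient with step at least
s/8, where s is the cap. Initial gradients get weight 0 in the conservation law because their steps
do not occur among γ̂_1, …, γ̂_K. -/
theorem le_sum_hatStep (hL : 0 < L) (hΔ : 0 < Δ) (hM : 0 < M) (hK : 2 * M ≤ K)
    (hγ : ∀ k, γ k = stepsize L Δ σ M K (delay w k)) :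
    K * stepCap L Δ σ M K / 32 ≤ ∑ k ∈ Finset.range K, hatStep γ w (k + 1) := by
  have hK0 : 0 < K := by omega
  have hs := stepCap_pos (σ := σ) hL hΔ hM hK0
  have h := sum_used_add_sum_pending
    (fun j i => if j = 0 then (0 : ℝ) else pendStep γ w (j + 1) i) w K
  simp only [if_true, Finset.sum_const_zero, zero_add, Nat.add_eq_zero_iff, one_ne_zero, and_false,
    if_false, pendStep_prev, pendStep_self] at h
  have h1 : (0 : ℝ) ≤ ∑ i, if prev w (K + 1) i = 0 then (0 : ℝ) else pendStep γ w (K + 1) i :=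
    Finset.sum_nonneg fun i _ => by
      split_ifs
      · exact le_rfl
      · exact pendStep_nonneg hL hΔ hM hK0 hγ _ _
  simp only [hatStep_eq_pendStep]
  have h2 := le_card_small_delay hM w hK
  set C := (Finset.range K).filter (fun k => prev w (k + 1) (w (k + 1)) ≠ 0 ∧
      delay w (k + 1) ≤ 4 * M)
  have h3 : C.card * (stepCap L Δ σ M K / 8) ≤ ∑ k ∈ Finset.range K,
      if prev w (k + 1) (w (k + 1)) = 0 then (0 : ℝ) else γ (k + 1) := by
    calc C.card * (stepCap L Δ σ M K / 8) = ∑ _k ∈ C, stepCap L Δ σ M K / 8 := by simp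
      _ ≤ ∑ k ∈ C, if prev w (k + 1) (w (k + 1)) = 0 then (0 : ℝ) else γ (k + 1) := by
        refine Finset.sum_le_sum fun k hk => ?_
        obtain ⟨hk1, hk2⟩ := (Finset.mem_filter.1 hk).2
        rw [if_neg hk1, hγ]
        refine cap_div_le_stepsize hL hΔ hM hK0 ?_ hk2
        have := prev_le w k (w (k + 1))
        unfold delay
        omega
      _ ≤ _ := by
        refine Finset.sum_le_sum_of_subset_of_nonneg (Finset.filter_subset _ _) fun k _ _ => ?_
        split_ifs
        · exact le_rfl
        · rw [hγ]
          exact stepsize_nonneg hL hΔ hM hK0 _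
  have h4 : (K : ℝ) ≤ 4 * C.card := by exact_mod_cast h2
  have h5 := mul_le_mul_of_nonneg_right h4 hs.le
  linarith

end PendStep

open scoped RealInnerProductSpace

/-! ### Smooth functions -/

section Smooth

theorem norm_sum_sq_le {E ι : Type*} [SeminormedAddCommGroup E] (s : Finset ι) (z : ι → E) :
    ‖∑ i ∈ s, z i‖ ^ 2 ≤ s.card * ∑ i ∈ s, ‖z i‖ ^ 2 :=
  (pow_le_pow_left₀ (norm_nonneg _) (norm_sum_le s z) 2).trans sq_sum_le_card_mul_sum_sq

variable {E : Type*} [NormedAddCommGroup E] [InnerProductSpace ℝ E]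

theorem norm_add_sq_le_two (a b : E) : ‖a + b‖ ^ 2 ≤ 2 * ‖a‖ ^ 2 + 2 * ‖b‖ ^ 2 := by
  have h := parallelogram_law_with_norm ℝ a b
  nlinarith [norm_nonneg (a - b)]

variable [CompleteSpace E] {F : E → ℝ} {G : E → E} {L : ℝ}

theorem le_quadratic_of_lipschitz_gradient (hF : ∀ x, HasGradientAt F (G x) x)
    (hG : ∀ x y, ‖G x - G y‖ ≤ L * ‖x - y‖) (x v : E) :
    F (x + v) ≤ F x + ⟪G x, v⟫ + L / 2 * ‖v‖ ^ 2 := by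
  -- The claim is ψ 1 ≤ ψ 0, and ψ decreases on [0, 1] by Cauchy–Schwarz and the Lipschitz bound.
  let ψ : ℝ → ℝ := fun t => F (x + t • v) - t * ⟪G x, v⟫ - L / 2 * ‖v‖ ^ 2 * t ^ 2
  have hψ : ∀ t, HasDerivAt ψ (⟪G (x + t • v), v⟫ - ⟪G x, v⟫ - L * ‖v‖ ^ 2 * t) t := by
    intro t
    have h1 : HasDerivAt (fun t : ℝ => x + t • v) v t := by
      simpa using ((hasDerivAt_id t).smul_const v).const_add x
    have h2 : HasDerivAt (fun t : ℝ => F (x + t • v)) ⟪G (x + t • v), v⟫ t := by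
      have := (hF (x + t • v)).hasFDerivAt.comp_hasDerivAt t h1
      rwa [InnerProductSpace.toDual_apply_apply] at this
    have h3 := (h2.sub ((hasDerivAt_id t).mul_const ⟪G x, v⟫)).sub
      (((hasDerivAt_id t).pow 2).const_mul (L / 2 * ‖v‖ ^ 2))
    refine HasDerivAt.congr_deriv (f := ψ) h3 ?_
    simp only [id_eq, Nat.cast_ofNat]
    ring
  have hanti : AntitoneOn ψ (Set.Icc 0 1) := by
    refine antitoneOn_of_deriv_nonpos (convex_Icc 0 1)
      (fun t _ => (hψ t).continuousAt.continuousWithinAt)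
      (fun t _ => (hψ t).differentiableAt.differentiableWithinAt) fun t ht => ?_
    rw [interior_Icc] at ht
    rw [(hψ t).deriv, ← inner_sub_left]
    have h1 := real_inner_le_norm (G (x + t • v) - G x) v
    have h2 := hG (x + t • v) x
    rw [add_sub_cancel_left, norm_smul, Real.norm_of_nonneg ht.1.le] at h2
    have h3 := mul_le_mul_of_nonneg_right h2 (norm_nonneg v)
    nlinarith
  have h := hanti (Set.left_mem_Icc.2 zero_le_one) (Set.right_mem_Icc.2 zero_le_one) zero_le_one
  simp only [ψ, one_smul, zero_smul, add_zero] at h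
  linarith

/-- A gradient step of length 1/L lowers F by at least ‖G x‖²/(2L), and F cannot fall below m. -/
theorem norm_sq_gradient_le (hF : ∀ x, HasGradientAt F (G x) x)
    (hG : ∀ x y, ‖G x - G y‖ ≤ L * ‖x - y‖) (hL : 0 < L) {m : ℝ} (hm : ∀ x, m ≤ F x) (x : E) :
    ‖G x‖ ^ 2 ≤ 2 * L * (F x - m) := by
  have h := le_quadratic_of_lipschitz_gradient hF hG x (-(1 / L) • G x)
  rw [inner_smul_right, real_inner_self_eq_norm_sq, norm_smul, mul_pow, norm_neg,
    Real.norm_of_nonneg (by positivity)] at h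
  have h1 := hm (x + -(1 / L) • G x)
  have h2 : F x - m ≥ 1 / (2 * L) * ‖G x‖ ^ 2 := by
    have : -(1 / L) * ‖G x‖ ^ 2 + L / 2 * ((1 / L) ^ 2 * ‖G x‖ ^ 2)
      = -(1 / (2 * L) * ‖G x‖ ^ 2) := by
      field_simp
      ring
    linarith
  have h3 := mul_le_mul_of_nonneg_left h2 (by positivity : 0 ≤ 2 * L)
  have h4 : 2 * L * (1 / (2 * L) * ‖G x‖ ^ 2) = ‖G x‖ ^ 2 := by
    field_simp
  linarith

/-- One step of a perturbed gradient method, with the gradient `v + n` computed near `x`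
but used at `y`. -/
theorem descent_step (hF : ∀ x, HasGradientAt F (G x) x)
    (hG : ∀ x y, ‖G x - G y‖ ≤ L * ‖x - y‖) {ζ a : ℝ} (ha : 0 ≤ a)
    (haL : 4 * L * a ≤ 1) {x y v n : E} (hv : ‖v - G x‖ ^ 2 ≤ ζ ^ 2) :
    F (y - a • (v + n)) ≤ F y - a / 4 * ‖v‖ ^ 2 + a * L ^ 2 * ‖x - y‖ ^ 2 + a * ζ ^ 2
      + (L / 2 * a ^ 2 * ‖n‖ ^ 2 + ⟪n, -(a • G y) + (L * a ^ 2) • v⟫) := by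
  have h := le_quadratic_of_lipschitz_gradient hF hG y (-(a • (v + n)))
  rw [← sub_eq_add_neg, inner_neg_right, inner_smul_right, norm_neg, norm_smul, mul_pow,
    Real.norm_of_nonneg ha, inner_add_right, norm_add_sq_real] at h
  have h1 : ‖G y - v‖ ^ 2 ≤ 2 * L ^ 2 * ‖x - y‖ ^ 2 + 2 * ζ ^ 2 := by
    have h2 := norm_add_sq_le_two (G y - G x) (G x - v)
    rw [sub_add_sub_cancel, norm_sub_rev (G x) v] at h2
    have h3 := pow_le_pow_left₀ (norm_nonneg _) (hG y x) 2
    rw [norm_sub_rev y x, mul_pow] at h3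
    linarith
  -- Polarization turns -a⟪G y, v⟫ into -(a/2)‖v‖² - (a/2)‖G y‖² + (a/2)‖G y - v‖². The quadratic
  -- term then takes back at most (a/8)‖v‖², as 4La ≤ 1.
  have h4 : ‖G y - v‖ ^ 2 = ‖G y‖ ^ 2 - 2 * ⟪G y, v⟫ + ‖v‖ ^ 2 := norm_sub_sq_real _ _
  have h5 : ⟪n, -(a • G y) + (L * a ^ 2) • v⟫ = -(a * ⟪G y, n⟫) + L * a ^ 2 * ⟪v, n⟫ := by
    rw [inner_add_right, inner_neg_right, inner_smul_right, inner_smul_right, real_inner_comm,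
      real_inner_comm n v]
  rw [h5]
  have h6 : a / 2 * (‖G y‖ ^ 2 - 2 * ⟪G y, v⟫ + ‖v‖ ^ 2)
      ≤ a / 2 * (2 * L ^ 2 * ‖x - y‖ ^ 2 + 2 * ζ ^ 2) := by
    rw [← h4]
    exact mul_le_mul_of_nonneg_left h1 (by positivity)
  have h7 : 0 ≤ a / 2 * ‖G y‖ ^ 2 := by positivity
  have h8 : a * (4 * L * a) * ‖v‖ ^ 2 ≤ a * 1 * ‖v‖ ^ 2 := by gcongr
  have h9 : 0 ≤ a * ‖v‖ ^ 2 := by positivity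
  nlinarith

end Smooth

/-! ### Virtual iterates -/

section Virtual

variable {M : ℕ} {E : Type*} [NormedAddCommGroup E] [InnerProductSpace ℝ E]

/-- The virtual iterate: all gradients pending just before iteration `k + 1` are applied. -/
def virt (γ : ℕ → ℝ) (w : ℕ → Fin M) (x : ℕ → E) (g : ℕ → Fin M → E) (k : ℕ) : E :=
  x k - ∑ i, pendStep γ w (k + 1) i • g (prev w (k + 1) i) i

variable {γ : ℕ → ℝ} {w : ℕ → Fin M} {x : ℕ → E} {g : ℕ → Fin M → E}

/-- The gradient used in iteration k + 1 cancels against its own pending term. Note the shift: the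
fresh gradient at x_{k+1} is applied to `virt k`, so this difference is the perturbation in the
descent step. -/
theorem sub_virt_eq (hx : ∀ k, x (k + 1) = x k - γ (k + 1) •
      g (prev w (k + 1) (w (k + 1))) (w (k + 1))) (k : ℕ) :
    x (k + 1) - virt γ w x g k = ∑ i ∈ Finset.univ.erase (w (k + 1)),
      pendStep γ w (k + 1) i • g (prev w (k + 1) i) i := by
  unfold virt
  rw [hx, ← Finset.add_sum_erase _ _ (Finset.mem_univ (w (k + 1))), pendStep_self]
  abel

/-- Using a pending gradient does not move the virtual iterate; only starting a new one does. -/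
theorem virt_succ (hx : ∀ k, x (k + 1) = x k - γ (k + 1) •
      g (prev w (k + 1) (w (k + 1))) (w (k + 1))) (k : ℕ) :
    virt γ w x g (k + 1) = virt γ w x g k - hatStep γ w (k + 1) • g (k + 1) (w (k + 1)) := by
  have h := sub_virt_eq hx k
  have h2 : ∑ i, pendStep γ w (k + 1 + 1) i • g (prev w (k + 1 + 1) i) i
      = hatStep γ w (k + 1) • g (k + 1) (w (k + 1)) + ∑ i ∈ Finset.univ.erase (w (k + 1)),
      pendStep γ w (k + 1) i • g (prev w (k + 1) i) i := by
    rw [← Finset.add_sum_erase _ _ (Finset.mem_univ (w (k + 1))), hatStep_eq_pendStep,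
      prev_succ_self w (by omega : 1 ≤ k + 1)]
    congr 1
    refine Finset.sum_congr rfl fun i hi => ?_
    have hne := (Finset.ne_of_mem_erase hi).symm
    rw [prev_succ_of_ne (by omega) hne, pendStep_succ_of_ne γ hne]
  rw [virt, h2, ← h]
  abel

theorem virt_zero : virt γ w x g 0 = x 0 - ∑ i, pendStep γ w 1 i • g 0 i := by
  simp [virt, prev_one]

theorem virt_eq_sub_sum (hx : ∀ k, x (k + 1) = x k - γ (k + 1) •
      g (prev w (k + 1) (w (k + 1))) (w (k + 1))) (k : ℕ) :
    virt γ w x g k = x 0 - ∑ i, pendStep γ w 1 i • g 0 i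
      - ∑ l ∈ Finset.range k, hatStep γ w (l + 1) • g (l + 1) (w (l + 1)) := by
  induction k with
  | zero => simp [virt_zero]
  | succ k ih =>
    rw [virt_succ hx, ih, Finset.sum_range_succ]
    abel

/-- The sum of the squared norms of the expected gradients, weighted with their stepsizes. -/
def gradMass (γ : ℕ → ℝ) (w : ℕ → Fin M) (v : ℕ → Fin M → E) (T : ℕ) : ℝ :=
  ∑ i, pendStep γ w 1 i * ‖v 0 i‖ ^ 2
    + ∑ k ∈ Finset.range T, hatStep γ w (k + 1) * ‖v (k + 1) (w (k + 1))‖ ^ 2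

/-- The noise of the initial gradients. -/
def initNoise (γ : ℕ → ℝ) (w : ℕ → Fin M) (n : ℕ → Fin M → E) : E :=
  ∑ i, pendStep γ w 1 i • n 0 i

/-- The noise of the gradients of the other workers pending at iteration `k + 1`. -/
def pendNoise (γ : ℕ → ℝ) (w : ℕ → Fin M) (n : ℕ → Fin M → E) (k : ℕ) : E :=
  ∑ i ∈ Finset.univ.erase (w (k + 1)), pendStep γ w (k + 1) i • n (prev w (k + 1) i) i

/-- The total contribution of the noise to the descent inequality. -/
def totalNoise (L : ℝ) (G : E → E) (γ : ℕ → ℝ) (w : ℕ → Fin M) (x : ℕ → E)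
    (v n : ℕ → Fin M → E) (T : ℕ) : ℝ :=
  L / 2 * ‖initNoise γ w n‖ ^ 2
    + ⟪initNoise γ w n, -G (x 0) + L • ∑ i, pendStep γ w 1 i • v 0 i⟫
    + ∑ k ∈ Finset.range T, (L / 2 * hatStep γ w (k + 1) ^ 2 * ‖n (k + 1) (w (k + 1))‖ ^ 2
      + 2 * L ^ 2 * hatStep γ w (k + 1) * ‖pendNoise γ w n k‖ ^ 2
      + ⟪n (k + 1) (w (k + 1)), -(hatStep γ w (k + 1) • G (virt γ w x (v + n) k))
          + (L * hatStep γ w (k + 1) ^ 2) • v (k + 1) (w (k + 1))⟫)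

theorem gradMass_nonneg {E : Type*} [NormedAddCommGroup E] {L Δ σ : ℝ}
    {K : ℕ} {v : ℕ → Fin M → E} (hL : 0 < L) (hΔ : 0 < Δ) (hM : 0 < M) (hK : 0 < K)
    (hγ : ∀ k, γ k = stepsize L Δ σ M K (delay w k)) (T : ℕ) : 0 ≤ gradMass γ w v T :=
  add_nonneg
    (Finset.sum_nonneg fun _ _ => mul_nonneg (pendStep_nonneg hL hΔ hM hK hγ _ _) (sq_nonneg _))
    (Finset.sum_nonneg fun _ _ => mul_nonneg (pendStep_nonneg hL hΔ hM hK hγ _ _) (sq_nonneg _))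

theorem norm_sum_smul_sq_le
    {a : Fin M → ℝ} (s : Finset (Fin M)) (z : Fin M → E) :
    ‖∑ i ∈ s, a i • z i‖ ^ 2 ≤ M * ∑ i ∈ s, a i ^ 2 * ‖z i‖ ^ 2 := by
  have h := norm_sum_sq_le s fun i => a i • z i
  simp only [norm_smul, mul_pow, Real.norm_eq_abs, sq_abs] at h
  refine h.trans (mul_le_mul_of_nonneg_right ?_ (Finset.sum_nonneg fun i _ => by positivity))
  have := Finset.card_le_univ s
  rw [Fintype.card_fin] at this
  exact_mod_cast this

/-- Used equals computed minus pending, in vector form. It is read off from the virtual iterates of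
an artificial sequence `z` that starts at 0 and is driven by `g`. -/
theorem sum_used_smul_eq (γ : ℕ → ℝ) (w : ℕ → Fin M) (g : ℕ → Fin M → E) (k : ℕ) :
    ∑ l ∈ Finset.range (k + 1), γ (l + 1) • g (prev w (l + 1) (w (l + 1))) (w (l + 1))
      = ∑ i, pendStep γ w 1 i • g 0 i
        + ∑ l ∈ Finset.range k, hatStep γ w (l + 1) • g (l + 1) (w (l + 1))
        - ∑ i ∈ Finset.univ.erase (w (k + 1)),
          pendStep γ w (k + 1) i • g (prev w (k + 1) i) i := by
  let z : ℕ → E := fun k => -∑ l ∈ Finset.range k,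
      γ (l + 1) • g (prev w (l + 1) (w (l + 1))) (w (l + 1))
  have hz : ∀ k, z (k + 1) = z k - γ (k + 1) • g (prev w (k + 1) (w (k + 1))) (w (k + 1)) := by
    intro k
    simp only [z, Finset.sum_range_succ]
    abel
  have h := sub_virt_eq hz k
  rw [virt_eq_sub_sum hz] at h
  rw [← h]
  simp only [z, Finset.sum_range_zero, neg_zero, zero_sub]
  abel

variable {F : E → ℝ} {G : E → E} {L Δ σ ζ : ℝ} {K : ℕ} {v n : ℕ → Fin M → E}

/-- The iterates stay near the initial point, up to noise. -/
theorem norm_gradient_sq_le (hL : 0 < L) (hΔ : 0 < Δ) (hM : 0 < M) (hK : 0 < K)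
    (hγ : ∀ k, γ k = stepsize L Δ σ M K (delay w k))
    (hG : ∀ x y, ‖G x - G y‖ ≤ L * ‖x - y‖)
    (hx : ∀ k, x (k + 1) = x k - γ (k + 1) •
      (v + n) (prev w (k + 1) (w (k + 1))) (w (k + 1))) {k : ℕ} (hk : k < K) :
    ‖G (x (k + 1))‖ ^ 2 ≤ 2 * ‖G (x 0)‖ ^ 2
      + 4 * L ^ 2 * (K * stepCap L Δ σ M K * gradMass γ w v K)
      + 12 * L ^ 2 * (‖initNoise γ w n‖ ^ 2
        + ‖∑ l ∈ Finset.range k, hatStep γ w (l + 1) • n (l + 1) (w (l + 1))‖ ^ 2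
        + ‖pendNoise γ w n k‖ ^ 2) := by
  have hs := stepCap_pos (σ := σ) hL hΔ hM hK
  have hγ0 : ∀ l, 0 ≤ γ l := fun l => by
    rw [hγ]
    exact stepsize_nonneg hL hΔ hM hK _
  have hγs : ∀ l, γ l ≤ stepCap L Δ σ M K := fun l => by
    rw [hγ]
    exact stepsize_le_cap _
  have hxsum : ∀ T, x T - x 0 = -∑ l ∈ Finset.range T,
      γ (l + 1) • (v + n) (prev w (l + 1) (w (l + 1))) (w (l + 1)) := by
    intro T
    induction T with
    | zero => simp
    | succ T ih =>
      rw [Finset.sum_range_succ, neg_add, ← ih, hx]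
      abel
  set V := ∑ l ∈ Finset.range (k + 1),
      γ (l + 1) • v (prev w (l + 1) (w (l + 1))) (w (l + 1))
  set N := ∑ l ∈ Finset.range (k + 1),
      γ (l + 1) • n (prev w (l + 1) (w (l + 1))) (w (l + 1)) with hN
  have hsplit : x (k + 1) - x 0 = -(V + N) := by
    rw [hxsum, ← Finset.sum_add_distrib]
    simp [smul_add]
  have hVle : ‖V‖ ^ 2 ≤ K * stepCap L Δ σ M K * gradMass γ w v K := by
    have h1 := norm_sum_sq_le (Finset.range (k + 1)) fun l =>
      γ (l + 1) • v (prev w (l + 1) (w (l + 1))) (w (l + 1))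
    simp only [norm_smul, mul_pow, Real.norm_eq_abs, sq_abs, Finset.card_range] at h1
    refine h1.trans ?_
    rw [mul_assoc]
    have hk' : ((k + 1 : ℕ) : ℝ) ≤ K := by exact_mod_cast hk
    refine mul_le_mul hk' ?_ (Finset.sum_nonneg fun l _ => by positivity) (by positivity)
    -- Used and pending gradients together carry exactly the mass `gradMass`; the pending share is
    -- nonnegative.
    have h2 := sum_used_add_sum_pending (fun j i => pendStep γ w (j + 1) i * ‖v j i‖ ^ 2) w K
    simp only [pendStep_prev, pendStep_self] at h2
    have h3 : 0 ≤ ∑ i, pendStep γ w (K + 1) i * ‖v (prev w (K + 1) i) i‖ ^ 2 :=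
      Finset.sum_nonneg fun i _ =>
        mul_nonneg (pendStep_nonneg hL hΔ hM hK hγ _ _) (sq_nonneg _)
    calc ∑ l ∈ Finset.range (k + 1),
          γ (l + 1) ^ 2 * ‖v (prev w (l + 1) (w (l + 1))) (w (l + 1))‖ ^ 2
        ≤ ∑ l ∈ Finset.range (k + 1), stepCap L Δ σ M K *
          (γ (l + 1) * ‖v (prev w (l + 1) (w (l + 1))) (w (l + 1))‖ ^ 2) := by
          refine Finset.sum_le_sum fun l _ => ?_
          rw [sq, mul_assoc]
          exact mul_le_mul_of_nonneg_right (hγs _) (mul_nonneg (hγ0 _) (sq_nonneg _))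
      _ ≤ ∑ l ∈ Finset.range K, stepCap L Δ σ M K *
          (γ (l + 1) * ‖v (prev w (l + 1) (w (l + 1))) (w (l + 1))‖ ^ 2) :=
          Finset.sum_le_sum_of_subset_of_nonneg
            (Finset.range_subset_range.2 (by omega)) fun l _ _ =>
              mul_nonneg hs.le (mul_nonneg (hγ0 _) (sq_nonneg _))
      _ ≤ stepCap L Δ σ M K * gradMass γ w v K := by
          rw [← Finset.mul_sum]
          refine mul_le_mul_of_nonneg_left ?_ hs.le
          unfold gradMass
          simp only [hatStep_eq_pendStep, zero_add] at h2 ⊢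
          linarith
  -- The noise of the used gradients is that of the initial ones, plus that of those computed since,
  -- minus that of those still pending.
  have hNle : ‖N‖ ^ 2 ≤ 3 * (‖initNoise γ w n‖ ^ 2
        + ‖∑ l ∈ Finset.range k, hatStep γ w (l + 1) • n (l + 1) (w (l + 1))‖ ^ 2
        + ‖pendNoise γ w n k‖ ^ 2) := by
    have h1 := norm_sum_sq_le Finset.univ ![initNoise γ w n,
      ∑ l ∈ Finset.range k, hatStep γ w (l + 1) • n (l + 1) (w (l + 1)), -pendNoise γ w n k]
    simp only [Fin.sum_univ_three, Matrix.cons_val, norm_neg, Finset.card_univ,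
      Fintype.card_fin] at h1
    rw [hN, sum_used_smul_eq, sub_eq_add_neg]
    exact h1
  have h1 : ‖G (x (k + 1))‖ ^ 2 ≤ 2 * ‖G (x 0)‖ ^ 2 + 2 * (L ^ 2 * ‖V + N‖ ^ 2) := by
    have h2 := norm_add_sq_le_two (G (x 0)) (G (x (k + 1)) - G (x 0))
    rw [add_sub_cancel] at h2
    have h3 := pow_le_pow_left₀ (norm_nonneg _) (hG (x (k + 1)) (x 0)) 2
    rw [hsplit, norm_neg, mul_pow] at h3
    linarith
  have h2 := (norm_add_sq_le_two V N).trans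
    (add_le_add (mul_le_mul_of_nonneg_left hVle zero_le_two)
      (mul_le_mul_of_nonneg_left hNle zero_le_two))
  have h3 := mul_le_mul_of_nonneg_left h2 (sq_nonneg L)
  linarith

variable [CompleteSpace E]

/-- All initial gradients are taken at x_0 and applied there in one step, so there is no
perturbation. Polarization yields the factor -1/2, and the quadratic term gives back 1/8 because 4ML
times each step is at most 1. -/
theorem virt_zero_descent (hL : 0 < L) (hΔ : 0 < Δ) (hM : 0 < M) (hK : 0 < K)
    (hγ : ∀ k, γ k = stepsize L Δ σ M K (delay w k))
    (hF : ∀ x, HasGradientAt F (G x) x) (hG : ∀ x y, ‖G x - G y‖ ≤ L * ‖x - y‖)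
    (hv : ∀ j i, ‖v j i - G (x j)‖ ^ 2 ≤ ζ ^ 2) :
    F (virt γ w x (v + n) 0) ≤ F (x 0) - 3 / 8 * ∑ i, pendStep γ w 1 i * ‖v 0 i‖ ^ 2
      + ζ ^ 2 * ∑ i, pendStep γ w 1 i
      + (L / 2 * ‖initNoise γ w n‖ ^ 2
        + ⟪initNoise γ w n, -G (x 0) + L • ∑ i, pendStep γ w 1 i • v 0 i⟫) := by
  set V := ∑ i, pendStep γ w 1 i • v 0 i with hV
  have hY : virt γ w x (v + n) 0 = x 0 + -(V + initNoise γ w n) := by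
    rw [virt_zero, hV, initNoise, ← Finset.sum_add_distrib, sub_eq_add_neg]
    simp [smul_add]
  rw [hY]
  have h := le_quadratic_of_lipschitz_gradient hF hG (x 0) (-(V + initNoise γ w n))
  rw [inner_neg_right, norm_neg, inner_add_right, norm_add_sq_real] at h
  have ha : ∀ i, 0 ≤ pendStep γ w 1 i := pendStep_nonneg hL hΔ hM hK hγ 1
  have ha' : ∀ i, pendStep γ w 1 i ≤ stepCap L Δ σ M K := pendStep_le_cap hL hΔ hM hK hγ 1
  have hcap := mul_stepCap_le (Δ := Δ) (σ := σ) (K := K) hL hM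
  have h1 : L * ‖V‖ ^ 2 ≤ 1 / 4 * ∑ i, pendStep γ w 1 i * ‖v 0 i‖ ^ 2 := by
    have h2 := norm_sum_smul_sq_le (a := pendStep γ w 1) Finset.univ (v 0)
    calc L * ‖V‖ ^ 2 ≤ L * (M * ∑ i, pendStep γ w 1 i ^ 2 * ‖v 0 i‖ ^ 2) := by gcongr
      _ = 1 / 4 * ∑ i, (4 * M * L * pendStep γ w 1 i) * (pendStep γ w 1 i * ‖v 0 i‖ ^ 2) := by
        rw [Finset.mul_sum, Finset.mul_sum, Finset.mul_sum]
        exact Finset.sum_congr rfl fun i _ => by ring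
      _ ≤ 1 / 4 * ∑ i, 1 * (pendStep γ w 1 i * ‖v 0 i‖ ^ 2) := by
        gcongr with i
        · exact mul_nonneg (ha i) (sq_nonneg _)
        · exact le_trans (mul_le_mul_of_nonneg_left (ha' i) (by positivity)) hcap
      _ = _ := by simp
  have h3 : ∑ i, pendStep γ w 1 i * ‖v 0 i‖ ^ 2 ≤ 2 * ⟪G (x 0), V⟫
      + ζ ^ 2 * ∑ i, pendStep γ w 1 i := by
    rw [hV, inner_sum, Finset.mul_sum, Finset.mul_sum, ← Finset.sum_add_distrib]
    refine Finset.sum_le_sum fun i _ => ?_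
    rw [inner_smul_right]
    have h4 := hv 0 i
    rw [norm_sub_sq_real, real_inner_comm] at h4
    nlinarith [mul_le_mul_of_nonneg_left h4 (ha i), mul_nonneg (ha i) (sq_nonneg ‖G (x 0)‖)]
  have h5 : ⟪initNoise γ w n, -G (x 0) + L • V⟫
      = -⟪G (x 0), initNoise γ w n⟫ + L * ⟪V, initNoise γ w n⟫ := by
    rw [inner_add_right, inner_neg_right, inner_smul_right, real_inner_comm,
      real_inner_comm _ V]
  rw [h5]
  have h6 : 0 ≤ ζ ^ 2 * ∑ i, pendStep γ w 1 i :=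
    mul_nonneg (sq_nonneg _) (Finset.sum_nonneg fun i _ => ha i)
  linarith

/-- This is `descent_step` at y = `virt k`. With S the sum over the pending gradients of the other
workers, the squared perturbation is at most 2MS plus noise, and aL² · 2MS ≤ (L/2) S since 4MLa ≤ 1.
-/
theorem virt_succ_descent (hL : 0 < L) (hΔ : 0 < Δ) (hM : 0 < M) (hK : 0 < K)
    (hγ : ∀ k, γ k = stepsize L Δ σ M K (delay w k))
    (hF : ∀ x, HasGradientAt F (G x) x) (hG : ∀ x y, ‖G x - G y‖ ≤ L * ‖x - y‖)
    (hx : ∀ k, x (k + 1) = x k - γ (k + 1) •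
      (v + n) (prev w (k + 1) (w (k + 1))) (w (k + 1)))
    (hv : ∀ j i, ‖v j i - G (x j)‖ ^ 2 ≤ ζ ^ 2) (k : ℕ) :
    F (virt γ w x (v + n) (k + 1)) ≤ F (virt γ w x (v + n) k)
      - 1 / 4 * (hatStep γ w (k + 1) * ‖v (k + 1) (w (k + 1))‖ ^ 2)
      + L / 2 * ∑ i ∈ Finset.univ.erase (w (k + 1)),
        pendStep γ w (k + 1) i ^ 2 * ‖v (prev w (k + 1) i) i‖ ^ 2
      + ζ ^ 2 * hatStep γ w (k + 1)
      + (L / 2 * hatStep γ w (k + 1) ^ 2 * ‖n (k + 1) (w (k + 1))‖ ^ 2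
        + 2 * L ^ 2 * hatStep γ w (k + 1) * ‖pendNoise γ w n k‖ ^ 2
        + ⟪n (k + 1) (w (k + 1)), -(hatStep γ w (k + 1) • G (virt γ w x (v + n) k))
          + (L * hatStep γ w (k + 1) ^ 2) • v (k + 1) (w (k + 1))⟫) := by
  set a := hatStep γ w (k + 1)
  have ha : 0 ≤ a := pendStep_nonneg hL hΔ hM hK hγ _ _
  have ha' : a ≤ stepCap L Δ σ M K := pendStep_le_cap hL hΔ hM hK hγ _ _
  have hcap := mul_stepCap_le (Δ := Δ) (σ := σ) (K := K) hL hM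
  have haM : 4 * M * L * a ≤ 1 :=
    le_trans (mul_le_mul_of_nonneg_left ha' (by positivity)) hcap
  have hM1 : (1 : ℝ) ≤ M := by exact_mod_cast hM
  have haL : 4 * L * a ≤ 1 := by
    refine le_trans ?_ haM
    have : 0 ≤ L * a := by positivity
    nlinarith
  have h := descent_step hF hG ha haL (y := virt γ w x (v + n) k) (n := n (k + 1) (w (k + 1)))
    (hv (k + 1) (w (k + 1)))
  rw [virt_succ hx]
  set S := ∑ i ∈ Finset.univ.erase (w (k + 1)),
        pendStep γ w (k + 1) i ^ 2 * ‖v (prev w (k + 1) i) i‖ ^ 2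
  have hS0 : 0 ≤ S := Finset.sum_nonneg fun i _ => by positivity
  have h1 : ‖x (k + 1) - virt γ w x (v + n) k‖ ^ 2
      ≤ 2 * (M * S) + 2 * ‖pendNoise γ w n k‖ ^ 2 := by
    rw [sub_virt_eq hx]
    have h2 : ∑ i ∈ Finset.univ.erase (w (k + 1)),
        pendStep γ w (k + 1) i • (v + n) (prev w (k + 1) i) i
        = ∑ i ∈ Finset.univ.erase (w (k + 1)),
          pendStep γ w (k + 1) i • v (prev w (k + 1) i) i + pendNoise γ w n k := by
      rw [pendNoise, ← Finset.sum_add_distrib]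
      simp [smul_add]
    rw [h2]
    refine (norm_add_sq_le_two _ _).trans ?_
    gcongr
    exact norm_sum_smul_sq_le _ _
  have h3 : a * L ^ 2 * ‖x (k + 1) - virt γ w x (v + n) k‖ ^ 2
      ≤ L / 2 * S + 2 * L ^ 2 * a * ‖pendNoise γ w n k‖ ^ 2 := by
    have h4 := mul_le_mul_of_nonneg_left h1 (by positivity : 0 ≤ a * L ^ 2)
    have h5 := mul_le_mul_of_nonneg_right haM (by positivity : 0 ≤ L / 2 * S)
    nlinarith
  have e : (v + n) (k + 1) (w (k + 1)) = v (k + 1) (w (k + 1)) + n (k + 1) (w (k + 1)) := rfl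
  rw [e]
  linarith

/-- The gradients along a run are controlled by the initial suboptimality, the heterogeneity
and the noise. -/
theorem gradMass_le (hL : 0 < L) (hΔ : 0 < Δ) (hM : 0 < M) (hMK : M ≤ K)
    (hγ : ∀ k, γ k = stepsize L Δ σ M K (delay w k))
    (hF : ∀ x, HasGradientAt F (G x) x) (hG : ∀ x y, ‖G x - G y‖ ≤ L * ‖x - y‖)
    (hx : ∀ k, x (k + 1) = x k - γ (k + 1) •
      (v + n) (prev w (k + 1) (w (k + 1))) (w (k + 1)))
    (hv : ∀ j i, ‖v j i - G (x j)‖ ^ 2 ≤ ζ ^ 2) {m : ℝ} (hm : ∀ y, m ≤ F y) :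
    3 / 16 * gradMass γ w v K ≤ F (x 0) - m + 2 * K * stepCap L Δ σ M K * ζ ^ 2
      + totalNoise L G γ w x v n K := by
  have hK : 0 < K := hM.trans_le hMK
  have hs := stepCap_pos (σ := σ) hL hΔ hM hK
  have key : ∀ T, F (virt γ w x (v + n) T)
      ≤ F (x 0) - 3 / 8 * ∑ i, pendStep γ w 1 i * ‖v 0 i‖ ^ 2
        - 1 / 4 * ∑ k ∈ Finset.range T, hatStep γ w (k + 1) * ‖v (k + 1) (w (k + 1))‖ ^ 2
        + L / 2 * ∑ k ∈ Finset.range T, ∑ i ∈ Finset.univ.erase (w (k + 1)),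
          pendStep γ w (k + 1) i ^ 2 * ‖v (prev w (k + 1) i) i‖ ^ 2
        + ζ ^ 2 * (∑ i, pendStep γ w 1 i + ∑ k ∈ Finset.range T, hatStep γ w (k + 1))
        + totalNoise L G γ w x v n T := by
    intro T
    induction T with
    | zero =>
      have := virt_zero_descent hL hΔ hM hK hγ hF hG hv (n := n)
      simp only [totalNoise, Finset.range_zero, Finset.sum_empty, add_zero, mul_zero]
      linarith
    | succ T ih =>
      have := virt_succ_descent hL hΔ hM hK hγ hF hG hx hv T
      simp only [totalNoise, Finset.sum_range_succ] at ih ⊢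
      linarith
  have h1 := key K
  -- The pending terms cost at most 1/16 of the mass, which leaves 1/4 - 1/16 = 3/16.
  have h2 := sum_sq_pendStep_le hL hΔ hM hK hγ (fun j i => ‖v j i‖ ^ 2) (fun _ _ => sq_nonneg _) K
  -- M + K gradients occur, and M ≤ K.
  have h3 : ∑ i, pendStep γ w 1 i + ∑ k ∈ Finset.range K, hatStep γ w (k + 1)
      ≤ 2 * K * stepCap L Δ σ M K := by
    have h4 : ∑ i, pendStep γ w 1 i ≤ M * stepCap L Δ σ M K := by
      refine (Finset.sum_le_sum fun i _ => pendStep_le_cap hL hΔ hM hK hγ 1 i).trans ?_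
      simp
    have h5 : ∑ k ∈ Finset.range K, hatStep γ w (k + 1) ≤ K * stepCap L Δ σ M K := by
      refine (Finset.sum_le_sum fun k _ => pendStep_le_cap hL hΔ hM hK hγ _ _).trans ?_
      simp
    have h6 : (M : ℝ) * stepCap L Δ σ M K ≤ K * stepCap L Δ σ M K := by gcongr
    linarith
  have h7 := mul_le_mul_of_nonneg_left h3 (sq_nonneg ζ)
  have h8 := hm (virt γ w x (v + n) K)
  have h9 : 0 ≤ ∑ i, pendStep γ w 1 i * ‖v 0 i‖ ^ 2 :=
    Finset.sum_nonneg fun i _ => mul_nonneg (pendStep_nonneg hL hΔ hM hK hγ _ _) (sq_nonneg _)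
  unfold gradMass
  linarith

end Virtual

/-! ### Independence and conditional expectations -/

section Indep

/-- The intersections of a set of m₁ with a set of m₂ form a π-system generating the join, on which
the product formula is immediate. The application has m₁ the schedule, m₃ one sample and m₂ all the
others. -/
theorem indep_sup_left_of_indep_sup_right {Ω : Type*} {m₁ m₂ m₃ mΩ : MeasurableSpace Ω}
    {P : Measure Ω} [IsProbabilityMeasure P] (h₁ : m₁ ≤ mΩ) (h₂ : m₂ ≤ mΩ) (h₃ : m₃ ≤ mΩ)
    (h : Indep m₁ (m₂ ⊔ m₃) P) (h' : Indep m₂ m₃ P) : Indep (m₁ ⊔ m₂) m₃ P := by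
  let G : Set (Set Ω) := {u | ∃ s t, MeasurableSet[m₁] s ∧ MeasurableSet[m₂] t ∧ u = s ∩ t}
  have hG : m₁ ⊔ m₂ = MeasurableSpace.generateFrom G := by
    refine le_antisymm (sup_le ?_ ?_) (MeasurableSpace.generateFrom_le ?_)
    · exact fun s hs => MeasurableSpace.measurableSet_generateFrom
        ⟨s, Set.univ, hs, MeasurableSet.univ, (Set.inter_univ s).symm⟩
    · exact fun t ht => MeasurableSpace.measurableSet_generateFrom
        ⟨Set.univ, t, MeasurableSet.univ, ht, (Set.univ_inter t).symm⟩
    · rintro u ⟨s, t, hs, ht, rfl⟩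
      exact MeasurableSet.inter ((le_sup_left : m₁ ≤ m₁ ⊔ m₂) s hs)
        ((le_sup_right : m₂ ≤ m₁ ⊔ m₂) t ht)
  have hpi : IsPiSystem G := by
    rintro u ⟨s, t, hs, ht, rfl⟩ u' ⟨s', t', hs', ht', rfl⟩ -
    exact ⟨s ∩ s', t ∩ t', MeasurableSet.inter hs hs', MeasurableSet.inter ht ht',
      Set.inter_inter_inter_comm _ _ _ _⟩
  refine IndepSets.indep (sup_le h₁ h₂) h₃ hpi (@MeasurableSpace.isPiSystem_measurableSet Ω m₃)
    hG (@MeasurableSpace.generateFrom_measurableSet Ω m₃).symm ?_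
  rw [IndepSets_iff]
  rintro u c ⟨s, t, hs, ht, rfl⟩ hc
  rw [Indep_iff] at h h'
  have htc : MeasurableSet[m₂ ⊔ m₃] (t ∩ c) :=
    MeasurableSet.inter ((le_sup_left : m₂ ≤ m₂ ⊔ m₃) t ht) ((le_sup_right : m₃ ≤ m₂ ⊔ m₃) c hc)
  have ht' : MeasurableSet[m₂ ⊔ m₃] t := (le_sup_left : m₂ ≤ m₂ ⊔ m₃) t ht
  rw [Set.inter_assoc, h s _ hs htc, h' t c ht hc, h s t hs ht', mul_assoc]

variable {Ω S Ξ E : Type*} {𝓖 𝓗 mΩ : MeasurableSpace Ω} [MeasurableSpace S] [MeasurableSpace Ξ]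
  {P : Measure Ω} [IsProbabilityMeasure P] [NormedAddCommGroup E] [NormedSpace ℝ E]
  [CompleteSpace E]

/-- If `Z` is `𝓗`-measurable and `ξ` is independent of `𝓗`, the conditional expectation of
`Φ(Z, ξ)` given `𝓗` is obtained by integrating out `ξ`. -/
theorem condExp_comp_prodMk_of_indep (h𝓗 : 𝓗 ≤ mΩ) {Z : Ω → S}
    {ξ : Ω → Ξ} (hZ : Measurable[𝓗] Z) (hξ : Measurable ξ)
    (hind : Indep 𝓗 (MeasurableSpace.comap ξ inferInstance) P) {Φ : S × Ξ → E}
    (hΦ : StronglyMeasurable Φ) (hint : Integrable (fun ω => Φ (Z ω, ξ ω)) P) :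
    P[fun ω => Φ (Z ω, ξ ω) | 𝓗] =ᵐ[P] fun ω => ∫ s, Φ (Z ω, s) ∂(P.map ξ) := by
  have hprob : IsProbabilityMeasure (P.map ξ) := Measure.isProbabilityMeasure_map hξ.aemeasurable
  have hZ' : Measurable Z := hZ.mono h𝓗 le_rfl
  have hprobZ : IsProbabilityMeasure (P.map Z) :=
    Measure.isProbabilityMeasure_map hZ'.aemeasurable
  have hindZ : IndepFun Z ξ P := by
    rw [IndepFun_iff_Indep]
    exact indep_of_indep_of_le_left hind hZ.comap_le
  have hlaw := (indepFun_iff_map_prod_eq_prod_map_map hZ'.aemeasurable hξ.aemeasurable).1 hindZ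
  have hint' : Integrable Φ ((P.map Z).prod (P.map ξ)) := by
    rw [← hlaw, integrable_map_measure hΦ.aestronglyMeasurable (hZ'.prodMk hξ).aemeasurable]
    exact hint
  have hHint : Integrable (fun ω => ∫ s, Φ (Z ω, s) ∂(P.map ξ)) P :=
    hint'.integral_prod_left.comp_measurable hZ'
  have hHm : StronglyMeasurable (fun z => ∫ s, Φ (z, s) ∂(P.map ξ)) := hΦ.integral_prod_right'
  refine (ae_eq_condExp_of_forall_setIntegral_eq h𝓗 hint (fun s _ _ => hHint.integrableOn) ?_
    (hHm.comp_measurable hZ).aestronglyMeasurable).symm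
  intro A hA _
  have hA' : MeasurableSet A := h𝓗 A hA
  -- The indicator of A is adjoined to Z as a coordinate, so that the integral over A becomes that
  -- of a function of two independent variables and Fubini applies.
  let T : Ω → S × ℝ := fun ω => (Z ω, A.indicator (fun _ => 1) ω)
  have hT : Measurable[𝓗] T := hZ.prodMk ((@measurable_const _ _ _ 𝓗 (1 : ℝ)).indicator hA)
  have hT' : Measurable T := hT.mono h𝓗 le_rfl
  have hprobT : IsProbabilityMeasure (P.map T) :=
    Measure.isProbabilityMeasure_map hT'.aemeasurable
  have hindT : IndepFun T ξ P := by
    rw [IndepFun_iff_Indep]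
    exact indep_of_indep_of_le_left hind hT.comap_le
  have hlawT := (indepFun_iff_map_prod_eq_prod_map_map hT'.aemeasurable hξ.aemeasurable).1 hindT
  let Ψ : (S × ℝ) × Ξ → E := fun p => p.1.2 • Φ (p.1.1, p.2)
  have hΨ : StronglyMeasurable Ψ :=
    (measurable_fst.snd).stronglyMeasurable.smul
      (hΦ.comp_measurable (measurable_fst.fst.prodMk measurable_snd))
  have hΨeq : (fun ω => Ψ (T ω, ξ ω)) = A.indicator fun ω => Φ (Z ω, ξ ω) := by
    ext ω
    by_cases hω : ω ∈ A <;> simp [Ψ, T, hω]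
  have hΨint : Integrable Ψ ((P.map T).prod (P.map ξ)) := by
    rw [← hlawT, integrable_map_measure hΨ.aestronglyMeasurable (hT'.prodMk hξ).aemeasurable]
    exact (hint.indicator hA').congr (Filter.EventuallyEq.of_eq hΨeq.symm)
  calc ∫ ω in A, ∫ s, Φ (Z ω, s) ∂(P.map ξ) ∂P
      = ∫ ω, ∫ s, Ψ (T ω, s) ∂(P.map ξ) ∂P := by
        rw [← integral_indicator hA']
        congr 1
        ext ω
        by_cases hω : ω ∈ A <;> simp [Ψ, T, hω]
    _ = ∫ t, ∫ s, Ψ (t, s) ∂(P.map ξ) ∂(P.map T) :=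
        (integral_map hT'.aemeasurable hΨ.integral_prod_right'.aestronglyMeasurable).symm
    _ = ∫ p, Ψ p ∂((P.map T).prod (P.map ξ)) := (integral_prod _ hΨint).symm
    _ = ∫ ω, Ψ (T ω, ξ ω) ∂P := by
        rw [← hlawT, integral_map (hT'.prodMk hξ).aemeasurable hΨ.aestronglyMeasurable]
    _ = ∫ ω in A, Φ (Z ω, ξ ω) ∂P := by
        rw [hΨeq, integral_indicator hA']

/-- If `Z` is measurable for `𝓖 ≤ 𝓗` and `ξ` is independent of `𝓗`, then conditioning `Φ(Z, ξ)`
on `𝓗` is the same as conditioning on `𝓖`. -/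
theorem condExp_comp_prodMk_eq_of_le (h𝓖 : 𝓖 ≤ 𝓗) (h𝓗 : 𝓗 ≤ mΩ)
    {Z : Ω → S} {ξ : Ω → Ξ} (hZ : Measurable[𝓖] Z) (hξ : Measurable ξ)
    (hind : Indep 𝓗 (MeasurableSpace.comap ξ inferInstance) P) {Φ : S × Ξ → E}
    (hΦ : StronglyMeasurable Φ) (hint : Integrable (fun ω => Φ (Z ω, ξ ω)) P) :
    P[fun ω => Φ (Z ω, ξ ω) | 𝓗] =ᵐ[P] P[fun ω => Φ (Z ω, ξ ω) | 𝓖] :=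
  (condExp_comp_prodMk_of_indep h𝓗 (hZ.mono h𝓖 le_rfl) hξ hind hΦ hint).trans
    (condExp_comp_prodMk_of_indep (h𝓖.trans h𝓗) hZ hξ (indep_of_indep_of_le_left hind h𝓖)
      hΦ hint).symm

end Indep

/-! ### Sums of conditionally centred vectors -/

section Centred

variable {Ω E : Type*} {𝓦 𝓗 mΩ : MeasurableSpace Ω} {P : Measure Ω}
  [NormedAddCommGroup E] [InnerProductSpace ℝ E]

theorem integrable_inner_of_memLp {f g : Ω → E} (hf : MemLp f 2 P) (hg : MemLp g 2 P) :
    Integrable (fun ω => ⟪f ω, g ω⟫) P := by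
  refine ((hf.integrable_norm_pow two_ne_zero).add (hg.integrable_norm_pow two_ne_zero)).mono'
    (hf.1.inner hg.1) (Filter.Eventually.of_forall fun ω => ?_)
  have h := norm_inner_le_norm (𝕜 := ℝ) (f ω) (g ω)
  simp only [Pi.add_apply]
  nlinarith [sq_nonneg (‖f ω‖ - ‖g ω‖), sq_nonneg ‖f ω‖, sq_nonneg ‖g ω‖]

theorem MemLp.smul_of_bounded {n : Ω → E} {c : Ω → ℝ} {C : ℝ} (hn : MemLp n 2 P)
    (hc : AEStronglyMeasurable c P) (hC : ∀ ω, |c ω| ≤ C) : MemLp (fun ω => c ω • n ω) 2 P := by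
  refine hn.of_le_mul (c := C) (hc.smul hn.1) (Filter.Eventually.of_forall fun ω => ?_)
  rw [norm_smul, Real.norm_eq_abs]
  exact mul_le_mul_of_nonneg_right (hC ω) (norm_nonneg _)

variable [IsProbabilityMeasure P]

theorem integral_sq_smul_le (h𝓗 : 𝓗 ≤ mΩ) {n : Ω → E} {c : Ω → ℝ}
    {σ C : ℝ} (hn : MemLp n 2 P) (hcm : StronglyMeasurable[𝓗] c) (hC : ∀ ω, |c ω| ≤ C)
    (hvar : ∀ᵐ ω ∂P, (P[fun ω' => ‖n ω'‖ ^ 2 | 𝓗]) ω ≤ σ ^ 2) :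
    ∫ ω, ‖c ω • n ω‖ ^ 2 ∂P ≤ σ ^ 2 * ∫ ω, c ω ^ 2 ∂P := by
  have hcm' : AEStronglyMeasurable c P := (hcm.mono h𝓗).aestronglyMeasurable
  have hint : Integrable (fun ω => c ω ^ 2 * ‖n ω‖ ^ 2) P := by
    have := (MemLp.smul_of_bounded hn hcm' hC).integrable_norm_pow two_ne_zero
    simpa only [norm_smul, mul_pow, Real.norm_eq_abs, sq_abs] using this
  have hc2 : Integrable (fun ω => c ω ^ 2) P := by
    refine (integrable_const (C ^ 2)).mono' (hcm'.pow 2) (Filter.Eventually.of_forall fun ω => ?_)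
    rw [Real.norm_eq_abs, abs_pow]
    exact pow_le_pow_left₀ (abs_nonneg _) (hC ω) 2
  have h := condExp_mul_of_stronglyMeasurable_left (hcm.pow 2) (μ := P)
    (g := fun ω => ‖n ω‖ ^ 2) hint (hn.integrable_norm_pow two_ne_zero)
  have hint' : Integrable (fun ω => c ω ^ 2 * (P[fun ω' => ‖n ω'‖ ^ 2 | 𝓗]) ω) P :=
    integrable_condExp.congr h
  calc ∫ ω, ‖c ω • n ω‖ ^ 2 ∂P = ∫ ω, c ω ^ 2 * ‖n ω‖ ^ 2 ∂P := by
        simp only [norm_smul, mul_pow, Real.norm_eq_abs, sq_abs]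
    _ = ∫ ω, (P[fun ω => c ω ^ 2 * ‖n ω‖ ^ 2 | 𝓗]) ω ∂P := (integral_condExp h𝓗).symm
    _ = ∫ ω, c ω ^ 2 * (P[fun ω' => ‖n ω'‖ ^ 2 | 𝓗]) ω ∂P := integral_congr_ae h
    _ ≤ ∫ ω, σ ^ 2 * c ω ^ 2 ∂P := by
        refine integral_mono_ae hint' (hc2.const_mul _) ?_
        filter_upwards [hvar] with ω hω
        nlinarith [mul_le_mul_of_nonneg_left hω (sq_nonneg (c ω))]
    _ = _ := integral_const_mul _ _

variable [CompleteSpace E]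

theorem integral_inner_eq_zero (h𝓗 : 𝓗 ≤ mΩ) {n U : Ω → E}
    (hn : MemLp n 2 P) (hU : MemLp U 2 P) (hUm : StronglyMeasurable[𝓗] U)
    (hmean : P[n | 𝓗] =ᵐ[P] 0) : ∫ ω, ⟪n ω, U ω⟫ ∂P = 0 := by
  have h := condExp_bilin_of_stronglyMeasurable_right (innerSL ℝ) hUm
    (integrable_inner_of_memLp hn hU) (hn.integrable one_le_two)
  calc ∫ ω, ⟪n ω, U ω⟫ ∂P = ∫ ω, (P[fun ω => ⟪n ω, U ω⟫ | 𝓗]) ω ∂P := (integral_condExp h𝓗).symm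
    _ = ∫ _, (0 : ℝ) ∂P := by
      refine integral_congr_ae ?_
      filter_upwards [h, hmean] with ω h1 h2
      refine h1.trans ?_
      rw [h2]
      simp
    _ = 0 := by simp

/-- The second moment of a sum of orthogonal noise vectors with random coefficients. -/
theorem integral_norm_sum_sq_le {ι : Type*} {n : ι → Ω → E} {𝓗 : ι → MeasurableSpace Ω} {σ C : ℝ}
    (h𝓗 : ∀ q, 𝓗 q ≤ mΩ) (h𝓦 : ∀ q, 𝓦 ≤ 𝓗 q)
    (hn : ∀ q, MemLp (n q) 2 P) (hmean : ∀ q, P[n q | 𝓗 q] =ᵐ[P] 0)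
    (hvar : ∀ q, ∀ᵐ ω ∂P, (P[fun ω' => ‖n q ω'‖ ^ 2 | 𝓗 q]) ω ≤ σ ^ 2)
    (hcross : ∀ q q', q ≠ q' →
      StronglyMeasurable[𝓗 q'] (n q) ∨ StronglyMeasurable[𝓗 q] (n q'))
    {c : ι → Ω → ℝ} (hc : ∀ q, StronglyMeasurable[𝓦] (c q)) (hC : ∀ q ω, |c q ω| ≤ C)
    (Q : Finset ι) :
    MemLp (fun ω => ∑ q ∈ Q, c q ω • n q ω) 2 P ∧
      ∫ ω, ‖∑ q ∈ Q, c q ω • n q ω‖ ^ 2 ∂P ≤ σ ^ 2 * ∫ ω, ∑ q ∈ Q, c q ω ^ 2 ∂P := by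
  classical
  have hc' : ∀ q, AEStronglyMeasurable (c q) P := fun q =>
    ((hc q).mono ((h𝓦 q).trans (h𝓗 q))).aestronglyMeasurable
  have hcn : ∀ q, MemLp (fun ω => c q ω • n q ω) 2 P := fun q =>
    MemLp.smul_of_bounded (hn q) (hc' q) (hC q)
  have hc2 : ∀ q, Integrable (fun ω => c q ω ^ 2) P := fun q => by
    refine (integrable_const (C ^ 2)).mono' ((hc' q).pow 2)
      (Filter.Eventually.of_forall fun ω => ?_)
    rw [Real.norm_eq_abs, abs_pow]
    exact pow_le_pow_left₀ (abs_nonneg _) (hC q ω) 2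
  -- Everything but n q is 𝓗 q-measurable, and n q is centred given 𝓗 q.
  have horth : ∀ q q', StronglyMeasurable[𝓗 q] (n q') →
      ∫ ω, ⟪c q ω • n q ω, c q' ω • n q' ω⟫ ∂P = 0 := by
    intro q q' hm
    have hU : StronglyMeasurable[𝓗 q] fun ω => c q ω • c q' ω • n q' ω :=
      ((hc q).mono (h𝓦 q)).smul (((hc q').mono (h𝓦 q)).smul hm)
    have := integral_inner_eq_zero (h𝓗 q) (hn q)
      (MemLp.smul_of_bounded (hcn q') (hc' q) (hC q)) hU (hmean q)
    rw [← this]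
    congr 1
    ext ω
    simp only [real_inner_smul_left, real_inner_smul_right]
    ring
  have horth' : ∀ q q', q ≠ q' → ∫ ω, ⟪c q ω • n q ω, c q' ω • n q' ω⟫ ∂P = 0 := by
    intro q q' hne
    rcases hcross q q' hne with h | h
    · rw [← horth q' q h]
      simp only [real_inner_comm]
    · exact horth q q' h
  have hmem : ∀ Q : Finset ι, MemLp (fun ω => ∑ q ∈ Q, c q ω • n q ω) 2 P := fun Q =>
    memLp_finsetSum Q fun q _ => hcn q
  refine ⟨hmem Q, ?_⟩
  induction Q using Finset.induction_on with
  | empty => simp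
  | insert q Q hq ih =>
    have h1 : ∀ ω, ‖∑ q ∈ insert q Q, c q ω • n q ω‖ ^ 2
        = ‖c q ω • n q ω‖ ^ 2 + 2 * ∑ q' ∈ Q, ⟪c q ω • n q ω, c q' ω • n q' ω⟫
          + ‖∑ q ∈ Q, c q ω • n q ω‖ ^ 2 := by
      intro ω
      rw [Finset.sum_insert hq, norm_add_sq_real, inner_sum]
    have hI1 := (hcn q).integrable_norm_pow two_ne_zero
    have hI2 : ∀ q' ∈ Q, Integrable (fun ω => ⟪c q ω • n q ω, c q' ω • n q' ω⟫) P := fun q' _ =>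
      integrable_inner_of_memLp (hcn q) (hcn q')
    have hI3 := (hmem Q).integrable_norm_pow two_ne_zero
    have hI4 : Integrable (fun ω => 2 * ∑ q' ∈ Q, ⟪c q ω • n q ω, c q' ω • n q' ω⟫) P :=
      (integrable_finsetSum Q hI2).const_mul 2
    have hI5 : Integrable (fun ω => ‖c q ω • n q ω‖ ^ 2
        + 2 * ∑ q' ∈ Q, ⟪c q ω • n q ω, c q' ω • n q' ω⟫) P := hI1.add hI4
    simp only [h1]
    rw [integral_add hI5 hI3, integral_add hI1 hI4, integral_const_mul, integral_finsetSum Q hI2,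
      Finset.sum_eq_zero fun q' hq' => horth' q q' (by rintro rfl; exact hq hq')]
    simp only [Finset.sum_insert hq]
    rw [integral_add (hc2 q) (integrable_finsetSum Q fun q _ => hc2 q), mul_add]
    have := integral_sq_smul_le (h𝓗 q) (hn q) ((hc q).mono (h𝓦 q)) (hC q) (hvar q)
    linarith

end Centred

/-! ### Measurability along a run -/

section Measurability

variable {Ω : Type*} {M : ℕ} [MeasurableSpace Ω] {w : ℕ → Ω → Fin M} {γ : ℕ → Ω → ℝ}

theorem measurable_eval_of_countable {I β : Type*} [Countable I] [MeasurableSpace I]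
    [MeasurableSingletonClass I] [MeasurableSpace β] {f : Ω → I} {h : I → Ω → β}
    (hf : Measurable f) (hh : ∀ i, Measurable (h i)) : Measurable fun ω => h (f ω) ω :=
  (measurable_from_prod_countable_right (f := fun p : I × Ω => h p.1 p.2) hh).comp
    (hf.prodMk measurable_id)

theorem measurableSet_worker_eq (hw : ∀ k, 1 ≤ k → Measurable (w k)) {k : ℕ} (hk : 1 ≤ k)
    (i : Fin M) : MeasurableSet {ω | w k ω = i} :=
  hw k hk (measurableSet_singleton i)

theorem measurable_prev (hw : ∀ k, 1 ≤ k → Measurable (w k)) (k : ℕ) (i : Fin M) :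
    Measurable fun ω => prev (fun j => w j ω) (k + 1) i := by
  induction k with
  | zero => simp only [zero_add, prev_one, measurable_const]
  | succ k ih =>
    simp only [prev_succ _ (by omega : 1 ≤ k + 1)]
    exact Measurable.ite (measurableSet_worker_eq hw (by omega) i) measurable_const ih

theorem measurable_prev_worker (hw : ∀ k, 1 ≤ k → Measurable (w k)) (k : ℕ) :
    Measurable fun ω => prev (fun j => w j ω) (k + 1) (w (k + 1) ω) :=
  measurable_eval_of_countable (hw (k + 1) (by omega)) (measurable_prev hw k)

theorem measurable_step (hw : ∀ k, 1 ≤ k → Measurable (w k)) {L Δ σ : ℝ} {K : ℕ}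
    (hγ : ∀ k ω, γ k ω = stepsize L Δ σ M K (delay (fun j => w j ω) k)) (k : ℕ) :
    Measurable (γ (k + 1)) := by
  have : γ (k + 1) = fun ω => stepsize L Δ σ M K
      (k + 1 - prev (fun j => w j ω) (k + 1) (w (k + 1) ω)) := funext (hγ (k + 1))
  rw [this]
  exact (measurable_from_nat (f := fun τ => stepsize L Δ σ M K τ)).comp
    (measurable_from_nat (f := fun p => k + 1 - p) |>.comp (measurable_prev_worker hw k))

theorem measurableSet_exists_worker (hw : ∀ k, 1 ≤ k → Measurable (w k)) (k : ℕ) (i : Fin M) :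
    MeasurableSet {ω | ∃ j, k + 1 ≤ j ∧ w j ω = i} := by
  have : {ω | ∃ j, k + 1 ≤ j ∧ w j ω = i} = ⋃ j, {ω | w (k + 1 + j) ω = i} := by
    ext ω
    simp only [Set.mem_ofPred_eq, Set.mem_iUnion]
    constructor
    · rintro ⟨j, h1, h2⟩
      exact ⟨j - (k + 1), by rwa [Nat.add_sub_cancel' h1]⟩
    · rintro ⟨j, h⟩
      exact ⟨k + 1 + j, by omega, h⟩
  rw [this]
  exact MeasurableSet.iUnion fun j => measurableSet_worker_eq hw (by omega) i

theorem measurable_next (hw : ∀ k, 1 ≤ k → Measurable (w k)) (k : ℕ) (i : Fin M) :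
    Measurable fun ω => next (fun j => w j ω) (k + 1) i := by
  refine measurable_to_countable' fun n => ?_
  have hset : ∀ j, MeasurableSet {ω | k + 1 ≤ j ∧ w j ω = i} := by
    intro j
    by_cases hj : k + 1 ≤ j
    · simpa [hj] using measurableSet_worker_eq hw (by omega : 1 ≤ j) i
    · simp [hj]
  -- As the infimum of the empty set is 0, the value 0 also stands for a worker that never returns.
  have : (fun ω => next (fun j => w j ω) (k + 1) i) ⁻¹' {n}
      = ({ω | k + 1 ≤ n ∧ w n ω = i} ∩ ⋂ j ∈ Finset.range n, {ω | k + 1 ≤ j ∧ w j ω = i}ᶜ)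
        ∪ ({_ω | n = 0} ∩ {ω | ∃ j, k + 1 ≤ j ∧ w j ω = i}ᶜ) := by
    ext ω
    simp only [Set.mem_preimage, Set.mem_singleton_iff, Set.mem_union, Set.mem_inter_iff,
      Set.mem_ofPred_eq, Set.mem_iInter, Set.mem_compl_iff, Finset.mem_range]
    constructor
    · intro h
      by_cases hne : ∃ j, k + 1 ≤ j ∧ w j ω = i
      · left
        refine ⟨h ▸ Nat.sInf_mem (s := {j | k + 1 ≤ j ∧ w j ω = i}) hne, fun j hj hj' => ?_⟩
        have : next (fun j => w j ω) (k + 1) i ≤ j := Nat.sInf_le hj'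
        omega
      · refine Or.inr ⟨?_, hne⟩
        rw [← h, next, Nat.sInf_eq_zero]
        right
        ext j
        simpa using fun h1 h2 => hne ⟨j, h1, h2⟩
    · rintro (⟨h1, h2⟩ | ⟨h1, h2⟩)
      · refine le_antisymm (Nat.sInf_le h1) ?_
        by_contra hlt
        exact h2 _ (not_le.1 hlt)
          (Nat.sInf_mem (s := {j | k + 1 ≤ j ∧ w j ω = i}) ⟨n, h1⟩)
      · rw [h1, next, Nat.sInf_eq_zero]
        right
        ext j
        simpa using fun h3 h4 => h2 ⟨j, h3, h4⟩
  rw [this]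
  refine ((hset n).inter (Finset.measurableSet_biInter _ fun j _ => (hset j).compl)).union
    ((MeasurableSet.const _).inter (measurableSet_exists_worker hw k i).compl)

theorem measurable_pendStep (hw : ∀ k, 1 ≤ k → Measurable (w k)) {L Δ σ : ℝ} {K : ℕ}
    (hγ : ∀ k ω, γ k ω = stepsize L Δ σ M K (delay (fun j => w j ω) k)) (k : ℕ) (i : Fin M) :
    Measurable fun ω => pendStep (fun j => γ j ω) (fun j => w j ω) (k + 1) i := by
  classical
  -- `measurable_step` covers positive indices only; n - 1 + 1 = n at the relevant values, which are
  -- at least k + 1.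
  have h : (fun ω => pendStep (fun j => γ j ω) (fun j => w j ω) (k + 1) i)
      = fun ω => if ω ∈ {ω | ∃ j, k + 1 ≤ j ∧ w j ω = i} then
        (fun n => γ (n - 1 + 1)) (next (fun j => w j ω) (k + 1) i) ω else 0 := by
    ext ω
    unfold pendStep
    simp only [Set.mem_ofPred_eq]
    split_ifs with hex
    · have := (prev_next (by omega) hex).1
      rw [Nat.sub_add_cancel (by omega)]
    · rfl
  rw [h]
  exact Measurable.ite (measurableSet_exists_worker hw k i)
    (measurable_eval_of_countable (h := fun n => γ (n - 1 + 1)) (measurable_next hw k i)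
      fun n => measurable_step hw hγ (n - 1))
    measurable_const

theorem measurable_hatStep (hw : ∀ k, 1 ≤ k → Measurable (w k)) {L Δ σ : ℝ} {K : ℕ}
    (hγ : ∀ k ω, γ k ω = stepsize L Δ σ M K (delay (fun j => w j ω) k)) (k : ℕ) :
    Measurable fun ω => hatStep (fun j => γ j ω) (fun j => w j ω) (k + 1) :=
  measurable_eval_of_countable (hw (k + 1) (by omega)) (measurable_pendStep hw hγ (k + 1))

variable {Ξ E : Type*} [MeasurableSpace Ξ] [NormedAddCommGroup E] [NormedSpace ℝ E]
  [MeasurableSpace E] [BorelSpace E] [SecondCountableTopology E]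
  {Φ : Fin M → E → Ξ → E} {x : ℕ → Ω → E} {ξ : ℕ → Fin M → Ω → Ξ}

theorem measurable_iterate (hw : ∀ k, 1 ≤ k → Measurable (w k)) {L Δ σ : ℝ} {K : ℕ}
    (hγ : ∀ k ω, γ k ω = stepsize L Δ σ M K (delay (fun j => w j ω) k))
    (hΦ : ∀ i, Measurable fun p : E × Ξ => Φ i p.1 p.2) (hx₀ : Measurable (x 0))
    (hx : ∀ k ω, x (k + 1) ω = x k ω - γ (k + 1) ω •
      Φ (w (k + 1) ω) (x (prev (fun j => w j ω) (k + 1) (w (k + 1) ω)) ω)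
        (ξ (prev (fun j => w j ω) (k + 1) (w (k + 1) ω)) (w (k + 1) ω) ω))
    (k : ℕ) (hξ : ∀ j < k, ∀ i, Measurable (ξ j i)) : Measurable (x k) := by
  induction k using Nat.strong_induction_on with
  | _ k ih =>
    rcases k with _ | k
    · exact hx₀
    · have hxk : ∀ j, j ≤ k → Measurable (x j) := fun j hj =>
        ih j (by omega) fun l hl => hξ l (by omega)
      have hg : Measurable fun ω => Φ (w (k + 1) ω)
          (x (prev (fun j => w j ω) (k + 1) (w (k + 1) ω)) ω)
          (ξ (prev (fun j => w j ω) (k + 1) (w (k + 1) ω)) (w (k + 1) ω) ω) := by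
        -- Truncation at k keeps the family inside the range of the induction hypothesis and changes
        -- nothing, as prev is at most k.
        have h1 : ∀ i, Measurable fun ω =>
            (fun j ω => Φ i (x (min j k) ω) (ξ (min j k) i ω))
              (prev (fun j => w j ω) (k + 1) i) ω := fun i =>
          measurable_eval_of_countable
            (h := fun j ω => Φ i (x (min j k) ω) (ξ (min j k) i ω)) (measurable_prev hw k i) fun j =>
            (hΦ i).comp ((hxk _ (min_le_right _ _)).prodMk (hξ (min j k) (by omega) i))
        have h2 := measurable_eval_of_countable (hw (k + 1) (by omega)) h1
        simpa only [min_eq_left (prev_le _ _ _)] using h2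
      have : x (k + 1) = fun ω => x k ω - γ (k + 1) ω •
          Φ (w (k + 1) ω) (x (prev (fun j => w j ω) (k + 1) (w (k + 1) ω)) ω)
          (ξ (prev (fun j => w j ω) (k + 1) (w (k + 1) ω)) (w (k + 1) ω) ω) := funext (hx k)
      rw [this]
      exact (hxk k le_rfl).sub ((measurable_step hw hγ k).smul hg)

end Measurability

/-! ### Runs -/

/-- The assumptions on a run of Asynchronous SGD. Here `Φ i x s` is the stochastic
gradient of worker `i` at `x` and `H i` is the gradient of its local objective. -/
structure IsRun {d M : ℕ} {Ξ Ω : Type*} [MeasurableSpace Ξ] [MeasurableSpace Ω] (P : Measure Ω)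
    (Φ : Fin M → EuclideanSpace ℝ (Fin d) → Ξ → EuclideanSpace ℝ (Fin d))
    (H : Fin M → EuclideanSpace ℝ (Fin d) → EuclideanSpace ℝ (Fin d)) (L Δ σ : ℝ) (K : ℕ)
    (w : ℕ → Ω → Fin M) (ξ : ℕ → Fin M → Ω → Ξ) (γ : ℕ → Ω → ℝ)
    (x : ℕ → Ω → EuclideanSpace ℝ (Fin d)) : Prop where
  L_pos : 0 < L
  Δ_pos : 0 < Δ
  M_pos : 0 < M
  M_le : M ≤ K
  measurable_stoch : ∀ i, Measurable fun p : EuclideanSpace ℝ (Fin d) × Ξ => Φ i p.1 p.2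
  measurable_grad : ∀ i, Measurable (H i)
  measurable_init : Measurable (x 0)
  measurable_worker : ∀ k, 1 ≤ k → Measurable (w k)
  measurable_sample : ∀ k i, Measurable (ξ k i)
  iIndepFun_sample : iIndepFun (fun (p : ℕ × Fin M) ω => ξ p.1 p.2 ω) P
  indepFun_sample : IndepFun (fun ω => (x 0 ω, fun k : ℕ => w (k + 1) ω))
    (fun ω (p : ℕ × Fin M) => ξ p.1 p.2 ω) P
  step_eq : ∀ k ω, γ k ω = stepsize L Δ σ M K (delay (fun j => w j ω) k)
  iterate_succ : ∀ k ω, x (k + 1) ω = x k ω - γ (k + 1) ω •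
    Φ (w (k + 1) ω) (x (prev (fun j => w j ω) (k + 1) (w (k + 1) ω)) ω)
      (ξ (prev (fun j => w j ω) (k + 1) (w (k + 1) ω)) (w (k + 1) ω) ω)
  noise : ∀ k, 1 ≤ k → CondUnbiasedBoundedVariance P
    (MeasurableSpace.comap (fun ω => (x k ω, w k ω)) inferInstance)
    (fun ω => Φ (w k ω) (x k ω) (ξ k (w k ω) ω)) (fun ω => H (w k ω) (x k ω)) σ
  noise_init : ∀ i, CondUnbiasedBoundedVariance P (MeasurableSpace.comap (x 0) inferInstance)
    (fun ω => Φ i (x 0 ω) (ξ 0 i ω)) (fun ω => H i (x 0 ω)) σ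

/-- The σ-algebra of the initial point and the sequence of active workers. -/
@[reducible]
def scheduleAlg {d M : ℕ} {Ω : Type*} (w : ℕ → Ω → Fin M)
    (x : ℕ → Ω → EuclideanSpace ℝ (Fin d)) : MeasurableSpace Ω :=
  MeasurableSpace.comap (fun ω => (x 0 ω, fun k : ℕ => w (k + 1) ω)) inferInstance

/-- The σ-algebra of the initial point, the active workers, and all samples but one. -/
@[reducible]
def otherAlg {d M : ℕ} {Ξ Ω : Type*} [MeasurableSpace Ξ] (w : ℕ → Ω → Fin M)
    (ξ : ℕ → Fin M → Ω → Ξ) (x : ℕ → Ω → EuclideanSpace ℝ (Fin d)) (q : ℕ × Fin M) :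
    MeasurableSpace Ω :=
  scheduleAlg w x ⊔ ⨆ p ∈ ({q}ᶜ : Set (ℕ × Fin M)),
    MeasurableSpace.comap (ξ p.1 p.2) inferInstance

open Classical in
/-- The noise of the gradient of worker `i` at `x j`, if that gradient is computed at all. -/
def runNoise {d M : ℕ} {Ξ Ω : Type*}
    (Φ : Fin M → EuclideanSpace ℝ (Fin d) → Ξ → EuclideanSpace ℝ (Fin d))
    (H : Fin M → EuclideanSpace ℝ (Fin d) → EuclideanSpace ℝ (Fin d))
    (w : ℕ → Ω → Fin M) (ξ : ℕ → Fin M → Ω → Ξ) (x : ℕ → Ω → EuclideanSpace ℝ (Fin d))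
    (q : ℕ × Fin M) (ω : Ω) : EuclideanSpace ℝ (Fin d) :=
  if q.1 = 0 ∨ w q.1 ω = q.2 then
    Φ q.2 (x q.1 ω) (ξ q.1 q.2 ω) - H q.2 (x q.1 ω) else 0

/-- The noise of worker i at x_k is controlled only where i is the active worker, an event of the
conditioning σ-algebra; restriction to such an event keeps mean 0 and the variance bound. -/
theorem CondUnbiasedBoundedVariance.indicator {d : ℕ} {Ω : Type*} {𝓖 mΩ : MeasurableSpace Ω}
    {P : Measure Ω} [IsProbabilityMeasure P] {g v : Ω → EuclideanSpace ℝ (Fin d)} {σ : ℝ}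
    (h : CondUnbiasedBoundedVariance P 𝓖 g v σ) (h𝓖 : 𝓖 ≤ mΩ) (hv : StronglyMeasurable[𝓖] v)
    {A : Set Ω} (hA : MeasurableSet[𝓖] A) :
    MemLp (A.indicator fun ω => g ω - v ω) 2 P ∧
      P[A.indicator fun ω => g ω - v ω | 𝓖] =ᵐ[P] 0 ∧
      ∀ᵐ ω ∂P, (P[fun ω => ‖A.indicator (fun ω => g ω - v ω) ω‖ ^ 2 | 𝓖]) ω ≤ σ ^ 2 := by
  obtain ⟨hg, hmean, hint, hvar⟩ := h
  have hvint : Integrable v P := (integrable_congr hmean).1 integrable_condExp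
  have hgv : Integrable (fun ω => g ω - v ω) P := hg.sub hvint
  refine ⟨?_, ?_, ?_⟩
  · exact ((memLp_two_iff_integrable_sq_norm hgv.1).2 hint).indicator (h𝓖 A hA)
  · have h1 := condExp_sub hg hvint 𝓖
    have h2 := condExp_indicator hgv hA
    have h3 := condExp_of_stronglyMeasurable h𝓖 hv hvint
    filter_upwards [h1, h2, hmean] with ω e1 e2 e3
    rw [e2]
    by_cases hω : ω ∈ A
    · rw [Set.indicator_of_mem hω]
      refine Eq.trans e1 ?_
      rw [Pi.sub_apply, e3, h3, sub_self]
      rfl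
    · rw [Set.indicator_of_notMem hω]
      rfl
  · have h1 : (fun ω => ‖A.indicator (fun ω => g ω - v ω) ω‖ ^ 2)
        = A.indicator fun ω => ‖g ω - v ω‖ ^ 2 := by
      ext ω
      by_cases hω : ω ∈ A <;> simp [hω]
    rw [h1]
    filter_upwards [condExp_indicator hint hA, hvar] with ω e1 e2
    rw [e1]
    by_cases hω : ω ∈ A
    · rwa [Set.indicator_of_mem hω]
    · rw [Set.indicator_of_notMem hω]
      positivity

/-! ### Conditioning on the schedule and on all samples but one -/

namespace IsRun

section Schedule

variable {d M : ℕ} {Ξ Ω : Type*} [MeasurableSpace Ξ]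
  {w : ℕ → Ω → Fin M} {ξ : ℕ → Fin M → Ω → Ξ} {x : ℕ → Ω → EuclideanSpace ℝ (Fin d)}

theorem scheduleAlg_le_otherAlg (q : ℕ × Fin M) : scheduleAlg w x ≤ otherAlg w ξ x q :=
  le_sup_left

theorem measurable_init_schedule : Measurable[scheduleAlg w x] (x 0) :=
  measurable_fst.comp (comap_measurable _)

theorem measurable_worker_schedule (k : ℕ) (hk : 1 ≤ k) : Measurable[scheduleAlg w x] (w k) := by
  have h1 : Measurable[scheduleAlg w x] fun ω => (fun k : ℕ => w (k + 1) ω) :=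
    measurable_snd.comp (comap_measurable _)
  have h2 := (measurable_pi_apply (k - 1)).comp h1
  have : (fun f : ℕ → Fin M => f (k - 1)) ∘ (fun ω => (fun k : ℕ => w (k + 1) ω)) = w k := by
    ext ω
    simp [Nat.sub_add_cancel hk]
  rwa [this] at h2

theorem measurable_sample_otherAlg {p q : ℕ × Fin M} (hpq : p ≠ q) :
    Measurable[otherAlg w ξ x q] (ξ p.1 p.2) := by
  have : MeasurableSpace.comap (ξ p.1 p.2) inferInstance ≤ otherAlg w ξ x q :=
    (le_iSup₂ (f := fun (p : ℕ × Fin M) (_ : p ∈ ({q}ᶜ : Set (ℕ × Fin M))) =>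
      MeasurableSpace.comap (ξ p.1 p.2) inferInstance) p hpq).trans le_sup_right
  exact (comap_measurable (ξ p.1 p.2)).mono this le_rfl

end Schedule

variable {d M K : ℕ} {Ξ Ω : Type*} [MeasurableSpace Ξ] {m : MeasurableSpace Ω} [mΩ : MeasurableSpace Ω] {P : Measure Ω}
  {Φ : Fin M → EuclideanSpace ℝ (Fin d) → Ξ → EuclideanSpace ℝ (Fin d)}
  {H : Fin M → EuclideanSpace ℝ (Fin d) → EuclideanSpace ℝ (Fin d)} {L Δ σ : ℝ}
  {w : ℕ → Ω → Fin M} {ξ : ℕ → Fin M → Ω → Ξ} {γ : ℕ → Ω → ℝ}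
  {x : ℕ → Ω → EuclideanSpace ℝ (Fin d)}

theorem measurable_schedule (h : IsRun P Φ H L Δ σ K w ξ γ x) :
    Measurable fun ω => (x 0 ω, fun k : ℕ => w (k + 1) ω) :=
  h.measurable_init.prodMk
    (measurable_pi_lambda _ fun k => h.measurable_worker (k + 1) (by omega))

theorem scheduleAlg_le (h : IsRun P Φ H L Δ σ K w ξ γ x) : scheduleAlg w x ≤ mΩ :=
  h.measurable_schedule.comap_le

theorem otherAlg_le (h : IsRun P Φ H L Δ σ K w ξ γ x) (q : ℕ × Fin M) :
    otherAlg w ξ x q ≤ mΩ :=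
  sup_le h.scheduleAlg_le (iSup₂_le fun p _ => (h.measurable_sample p.1 p.2).comap_le)

/-- Iterates are functions of the schedule and of earlier samples. -/
theorem measurable_iterate_of (h : IsRun P Φ H L Δ σ K w ξ γ x)
    (hm : scheduleAlg w x ≤ m) (k : ℕ) (hξ : ∀ j < k, ∀ i, Measurable[m] (ξ j i)) :
    Measurable[m] (x k) :=
  @measurable_iterate Ω M m w γ Ξ _ _ _ _ _ _ _ Φ x ξ
    (fun k hk => (measurable_worker_schedule k hk).mono hm le_rfl) _ _ _ _ h.step_eq
    h.measurable_stoch (measurable_init_schedule.mono hm le_rfl) h.iterate_succ k hξ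

/-- x_k involves only samples drawn at x_j with j < k, so it does not see the omitted sample. -/
theorem measurable_iterate_otherAlg (h : IsRun P Φ H L Δ σ K w ξ γ x) {k : ℕ} {q : ℕ × Fin M}
    (hk : k ≤ q.1) : Measurable[otherAlg w ξ x q] (x k) := by
  refine h.measurable_iterate_of (scheduleAlg_le_otherAlg q) k fun j hj i => ?_
  refine measurable_sample_otherAlg (p := (j, i)) ?_
  rintro rfl
  exact absurd hk (not_le.2 hj)

theorem measurable_iterate' (h : IsRun P Φ H L Δ σ K w ξ γ x) (k : ℕ) : Measurable (x k) :=
  h.measurable_iterate_of h.scheduleAlg_le k fun j _ i => h.measurable_sample j i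

theorem indep_otherAlg [IsProbabilityMeasure P] (h : IsRun P Φ H L Δ σ K w ξ γ x)
    (q : ℕ × Fin M) :
    Indep (otherAlg w ξ x q) (MeasurableSpace.comap (ξ q.1 q.2) inferInstance) P := by
  have hle : ∀ p : ℕ × Fin M, MeasurableSpace.comap (ξ p.1 p.2) inferInstance ≤ mΩ := fun p =>
    (h.measurable_sample p.1 p.2).comap_le
  refine indep_sup_left_of_indep_sup_right h.scheduleAlg_le (iSup₂_le fun p _ => hle p) (hle q)
    ?_ ?_
  · refine indep_of_indep_of_le_right ((IndepFun_iff_Indep _ _ _).1 h.indepFun_sample) ?_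
    have : ∀ p : ℕ × Fin M, MeasurableSpace.comap (ξ p.1 p.2) inferInstance
        ≤ MeasurableSpace.comap (fun ω (p : ℕ × Fin M) => ξ p.1 p.2 ω) inferInstance := by
      intro p
      exact ((measurable_pi_apply p).comp
        (comap_measurable (fun ω (p : ℕ × Fin M) => ξ p.1 p.2 ω))).comap_le
    exact sup_le (iSup₂_le fun p _ => this p) (this q)
  · have := indep_iSup_of_disjoint (m := fun p : ℕ × Fin M =>
      MeasurableSpace.comap (ξ p.1 p.2) inferInstance) hle h.iIndepFun_sample.iIndep
      (S := {q}ᶜ) (T := {q}) disjoint_compl_left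
    simpa using this

theorem measurable_runNoise_of (h : IsRun P Φ H L Δ σ K w ξ γ x)
    (hm : scheduleAlg w x ≤ m) (q : ℕ × Fin M) (hx : Measurable[m] (x q.1))
    (hξ : Measurable[m] (ξ q.1 q.2)) : Measurable[m] (runNoise Φ H w ξ x q) := by
  classical
  have hset : MeasurableSet[m] {ω | q.1 = 0 ∨ w q.1 ω = q.2} := by
    by_cases h0 : q.1 = 0
    · simp [h0]
    · simp only [h0, false_or]
      exact (measurable_worker_schedule q.1 (by omega)).mono hm le_rfl
        (measurableSet_singleton q.2)
  exact Measurable.ite hset (((h.measurable_stoch q.2).comp (hx.prodMk hξ)).sub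
    ((h.measurable_grad q.2).comp hx)) measurable_const

theorem measurable_runNoise (h : IsRun P Φ H L Δ σ K w ξ γ x) (q : ℕ × Fin M) :
    Measurable (runNoise Φ H w ξ x q) :=
  h.measurable_runNoise_of h.scheduleAlg_le q (h.measurable_iterate' q.1)
    (h.measurable_sample q.1 q.2)

/-- Of two distinct noise vectors, one is known to the σ-algebra of the other. Equal indices are
allowed, which covers the gradients that different workers compute at x_0. -/
theorem measurable_runNoise_otherAlg (h : IsRun P Φ H L Δ σ K w ξ γ x) {q q' : ℕ × Fin M}
    (hne : q ≠ q') (hle : q.1 ≤ q'.1) : Measurable[otherAlg w ξ x q'] (runNoise Φ H w ξ x q) :=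
  h.measurable_runNoise_of (scheduleAlg_le_otherAlg q') q (h.measurable_iterate_otherAlg hle)
    (measurable_sample_otherAlg hne)

/-- The assumptions condition only on x_0, or on x_k and the active worker. The noise is a function
of these and of one sample independent of `otherAlg`, so passing to the larger σ-algebra changes
neither conditional moment. -/
theorem runNoise_condExp [IsProbabilityMeasure P] (h : IsRun P Φ H L Δ σ K w ξ γ x)
    (q : ℕ × Fin M) :
    MemLp (runNoise Φ H w ξ x q) 2 P ∧ P[runNoise Φ H w ξ x q | otherAlg w ξ x q] =ᵐ[P] 0 ∧
      ∀ᵐ ω ∂P, (P[fun ω => ‖runNoise Φ H w ξ x q ω‖ ^ 2 | otherAlg w ξ x q]) ω ≤ σ ^ 2 := by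
  classical
  obtain ⟨k, i⟩ := q
  have hxk : Measurable[otherAlg w ξ x (k, i)] (x k) := h.measurable_iterate_otherAlg le_rfl
  rcases Nat.eq_zero_or_pos k with rfl | hk
  · have hZ : Measurable[MeasurableSpace.comap (x 0) inferInstance] (x 0) := comap_measurable _
    have hle : MeasurableSpace.comap (x 0) inferInstance ≤ otherAlg w ξ x (0, i) := hxk.comap_le
    have hv : StronglyMeasurable[MeasurableSpace.comap (x 0) inferInstance]
        fun ω => H i (x 0 ω) := ((h.measurable_grad i).comp hZ).stronglyMeasurable
    obtain ⟨h1, h2, h3⟩ := (h.noise_init i).indicator h.measurable_init.comap_le hv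
      MeasurableSet.univ
    let Ψ : EuclideanSpace ℝ (Fin d) × Ξ → EuclideanSpace ℝ (Fin d) := fun p =>
      Φ i p.1 p.2 - H i p.1
    have hΨ : Measurable Ψ :=
      (h.measurable_stoch i).sub ((h.measurable_grad i).comp measurable_fst)
    have heq : (Set.univ.indicator fun ω => Φ i (x 0 ω) (ξ 0 i ω) - H i (x 0 ω))
        = fun ω => Ψ (x 0 ω, ξ 0 i ω) := by
      ext1 ω
      simp [Ψ]
    have heq' : runNoise Φ H w ξ x (0, i) = fun ω => Ψ (x 0 ω, ξ 0 i ω) := by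
      ext1 ω
      simp [Ψ, runNoise]
    rw [heq] at h1 h2 h3
    rw [heq']
    have hind := h.indep_otherAlg (0, i)
    refine ⟨h1, (condExp_comp_prodMk_eq_of_le hle (h.otherAlg_le _) hZ (h.measurable_sample 0 i)
      hind hΨ.stronglyMeasurable (h1.integrable one_le_two)).trans h2, ?_⟩
    have h4 := condExp_comp_prodMk_eq_of_le hle (h.otherAlg_le _) hZ (h.measurable_sample 0 i)
      hind (Φ := fun p => ‖Ψ p‖ ^ 2) (hΨ.norm.pow_const 2).stronglyMeasurable
      (h1.integrable_norm_pow two_ne_zero)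
    filter_upwards [h3, h4] with ω e1 e2
    exact e2.trans_le e1
  · let Z : Ω → EuclideanSpace ℝ (Fin d) × Fin M := fun ω => (x k ω, w k ω)
    have hZ : Measurable[MeasurableSpace.comap Z inferInstance] Z := comap_measurable _
    have hZ' : Measurable[otherAlg w ξ x (k, i)] Z := hxk.prodMk
      ((measurable_worker_schedule k hk).mono (scheduleAlg_le_otherAlg _) le_rfl)
    have hle : MeasurableSpace.comap Z inferInstance ≤ otherAlg w ξ x (k, i) := hZ'.comap_le
    have hHm : Measurable fun p : EuclideanSpace ℝ (Fin d) × Fin M => H p.2 p.1 :=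
      measurable_eval_of_countable measurable_snd
        (h := fun i (p : EuclideanSpace ℝ (Fin d) × Fin M) => H i p.1)
        fun i => (h.measurable_grad i).comp measurable_fst
    have hv : StronglyMeasurable[MeasurableSpace.comap Z inferInstance]
        fun ω => H (w k ω) (x k ω) := (hHm.comp hZ).stronglyMeasurable
    have hA : MeasurableSet[MeasurableSpace.comap Z inferInstance] {ω | w k ω = i} :=
      (measurable_snd.comp hZ) (measurableSet_singleton i)
    obtain ⟨h1, h2, h3⟩ := (h.noise k hk).indicator (hle.trans (h.otherAlg_le _)) hv hA
    let Ψ : (EuclideanSpace ℝ (Fin d) × Fin M) × Ξ → EuclideanSpace ℝ (Fin d) := fun p =>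
      if p.1.2 = i then Φ i p.1.1 p.2 - H i p.1.1 else 0
    have hΨ : Measurable Ψ :=
      Measurable.ite (measurable_fst.snd (measurableSet_singleton i))
        (((h.measurable_stoch i).comp (measurable_fst.fst.prodMk measurable_snd)).sub
          ((h.measurable_grad i).comp measurable_fst.fst)) measurable_const
    have heq : ({ω | w k ω = i}.indicator fun ω =>
        Φ (w k ω) (x k ω) (ξ k (w k ω) ω) - H (w k ω) (x k ω))
        = fun ω => Ψ (Z ω, ξ k i ω) := by
      ext1 ω
      by_cases hω : w k ω = i
      · simp [Ψ, Z, hω]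
      · simp [Ψ, Z, hω]
    have heq' : runNoise Φ H w ξ x (k, i) = fun ω => Ψ (Z ω, ξ k i ω) := by
      ext1 ω
      simp [Ψ, Z, runNoise, hk.ne']
    rw [heq] at h1 h2 h3
    rw [heq']
    have hind := h.indep_otherAlg (k, i)
    refine ⟨h1, (condExp_comp_prodMk_eq_of_le hle (h.otherAlg_le _) hZ (h.measurable_sample k i)
      hind hΨ.stronglyMeasurable (h1.integrable one_le_two)).trans h2, ?_⟩
    have h4 := condExp_comp_prodMk_eq_of_le hle (h.otherAlg_le _) hZ (h.measurable_sample k i)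
      hind (Φ := fun p => ‖Ψ p‖ ^ 2) (hΨ.norm.pow_const 2).stronglyMeasurable
      (h1.integrable_norm_pow two_ne_zero)
    filter_upwards [h3, h4] with ω e1 e2
    exact e2.trans_le e1

/-- Second moments of combinations of noise vectors whose coefficients depend on the schedule. -/
theorem integral_norm_sum_runNoise_sq_le [IsProbabilityMeasure P]
    (h : IsRun P Φ H L Δ σ K w ξ γ x) {c : ℕ × Fin M → Ω → ℝ} {C : ℝ}
    (hc : ∀ q, Measurable[scheduleAlg w x] (c q)) (hC : ∀ q ω, |c q ω| ≤ C)
    (Q : Finset (ℕ × Fin M)) :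
    MemLp (fun ω => ∑ q ∈ Q, c q ω • runNoise Φ H w ξ x q ω) 2 P ∧
      ∫ ω, ‖∑ q ∈ Q, c q ω • runNoise Φ H w ξ x q ω‖ ^ 2 ∂P
        ≤ σ ^ 2 * ∫ ω, ∑ q ∈ Q, c q ω ^ 2 ∂P := by
  refine integral_norm_sum_sq_le (𝓗 := otherAlg w ξ x) (h.otherAlg_le)
    scheduleAlg_le_otherAlg (fun q => (h.runNoise_condExp q).1)
    (fun q => (h.runNoise_condExp q).2.1) (fun q => (h.runNoise_condExp q).2.2) ?_
    (fun q => (hc q).stronglyMeasurable) hC Q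
  intro q q' hne
  rcases le_total q.1 q'.1 with hle | hle
  · exact Or.inl (h.measurable_runNoise_otherAlg hne hle).stronglyMeasurable
  · exact Or.inr (h.measurable_runNoise_otherAlg hne.symm hle).stronglyMeasurable

end IsRun

/-- The assumptions on the objective: `F` is smooth with gradient `G` and bounded below by `m`,
and the local gradients `H i` are close to `G`. -/
structure IsSmoothObjective {d M : ℕ} (F : EuclideanSpace ℝ (Fin d) → ℝ)
    (G : EuclideanSpace ℝ (Fin d) → EuclideanSpace ℝ (Fin d))
    (H : Fin M → EuclideanSpace ℝ (Fin d) → EuclideanSpace ℝ (Fin d)) (L ζ m : ℝ) : Prop where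
  hasGradientAt : ∀ y, HasGradientAt F (G y) y
  lipschitz : ∀ y z, ‖G y - G z‖ ≤ L * ‖y - z‖
  dissimilarity : ∀ i y, ‖H i y - G y‖ ^ 2 ≤ ζ ^ 2
  lower_bound : ∀ y, m ≤ F y

/-- For vectors with a random index: they are dominated by the sum over all values of the index. -/
theorem memLp_of_norm_le_sum {Ω E ι : Type*} {mΩ : MeasurableSpace Ω} {P : Measure Ω}
    [NormedAddCommGroup E] {f : Ω → E} {z : ι → Ω → E} {C : ℝ} {Q : Finset ι}
    (hf : AEStronglyMeasurable f P) (hz : ∀ q ∈ Q, MemLp (z q) 2 P)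
    (h : ∀ ω, ‖f ω‖ ≤ C * ∑ q ∈ Q, ‖z q ω‖) : MemLp f 2 P := by
  have hsum : MemLp (fun ω => ∑ q ∈ Q, ‖z q ω‖) 2 P := memLp_finsetSum Q fun q hq => (hz q hq).norm
  refine hsum.of_le_mul (c := C) hf (Filter.Eventually.of_forall fun ω => ?_)
  rw [Real.norm_of_nonneg (Finset.sum_nonneg fun q _ => norm_nonneg _)]
  exact h ω

namespace IsRun

variable {d M K : ℕ} {Ξ Ω : Type*} [MeasurableSpace Ξ] {m : MeasurableSpace Ω}
  [mΩ : MeasurableSpace Ω] {P : Measure Ω}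
  {Φ : Fin M → EuclideanSpace ℝ (Fin d) → Ξ → EuclideanSpace ℝ (Fin d)}
  {H : Fin M → EuclideanSpace ℝ (Fin d) → EuclideanSpace ℝ (Fin d)} {L Δ σ : ℝ}
  {w : ℕ → Ω → Fin M} {ξ : ℕ → Fin M → Ω → Ξ} {γ : ℕ → Ω → ℝ}
  {x : ℕ → Ω → EuclideanSpace ℝ (Fin d)}

/-! ### The steps along a run -/

theorem K_pos (h : IsRun P Φ H L Δ σ K w ξ γ x) : 0 < K := h.M_pos.trans_le h.M_le

theorem cap_pos (h : IsRun P Φ H L Δ σ K w ξ γ x) : 0 < stepCap L Δ σ M K :=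
  stepCap_pos h.L_pos h.Δ_pos h.M_pos h.K_pos

theorem pendStep_nonneg (h : IsRun P Φ H L Δ σ K w ξ γ x) (k : ℕ) (i : Fin M) (ω : Ω) :
    0 ≤ pendStep (fun j => γ j ω) (fun j => w j ω) k i :=
  AsyncSGD.pendStep_nonneg h.L_pos h.Δ_pos h.M_pos h.K_pos (fun k => h.step_eq k ω) k i

theorem pendStep_le (h : IsRun P Φ H L Δ σ K w ξ γ x) (k : ℕ) (i : Fin M) (ω : Ω) :
    pendStep (fun j => γ j ω) (fun j => w j ω) k i ≤ stepCap L Δ σ M K :=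
  pendStep_le_cap h.L_pos h.Δ_pos h.M_pos h.K_pos (fun k => h.step_eq k ω) k i

theorem abs_pendStep_le (h : IsRun P Φ H L Δ σ K w ξ γ x) (k : ℕ) (i : Fin M) (ω : Ω) :
    |pendStep (fun j => γ j ω) (fun j => w j ω) k i| ≤ stepCap L Δ σ M K := by
  rw [abs_of_nonneg (h.pendStep_nonneg k i ω)]
  exact h.pendStep_le k i ω

theorem sq_pendStep_le (h : IsRun P Φ H L Δ σ K w ξ γ x) (k : ℕ) (i : Fin M) (ω : Ω) :
    pendStep (fun j => γ j ω) (fun j => w j ω) k i ^ 2 ≤ stepCap L Δ σ M K ^ 2 :=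
  pow_le_pow_left₀ (h.pendStep_nonneg k i ω) (h.pendStep_le k i ω) 2

theorem measurable_pendStep (h : IsRun P Φ H L Δ σ K w ξ γ x) (k : ℕ) (i : Fin M) :
    Measurable[scheduleAlg w x] fun ω =>
      pendStep (fun j => γ j ω) (fun j => w j ω) (k + 1) i :=
  @AsyncSGD.measurable_pendStep Ω M (scheduleAlg w x) w γ measurable_worker_schedule _ _ _ _
    h.step_eq k i

theorem measurable_hatStep (h : IsRun P Φ H L Δ σ K w ξ γ x) (k : ℕ) :
    Measurable[scheduleAlg w x] fun ω =>
      hatStep (fun j => γ j ω) (fun j => w j ω) (k + 1) :=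
  @AsyncSGD.measurable_hatStep Ω M (scheduleAlg w x) w γ measurable_worker_schedule _ _ _ _
    h.step_eq k

theorem iterate_succ_eq (h : IsRun P Φ H L Δ σ K w ξ γ x) (ω : Ω) (k : ℕ) :
    x (k + 1) ω = x k ω - γ (k + 1) ω •
      ((fun j i => H i (x j ω)) + fun j i => runNoise Φ H w ξ x (j, i) ω)
        (prev (fun j => w j ω) (k + 1) (w (k + 1) ω)) (w (k + 1) ω) := by
  rw [h.iterate_succ]
  have := prev_eq_zero_or (fun j => w j ω) k (w (k + 1) ω)
  simp only [Pi.add_apply, runNoise]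
  rw [if_pos this, add_sub_cancel]

/-! ### Weighted second moments of the noise -/

variable [IsProbabilityMeasure P]

/-- Since ρ depends on the schedule only, its square root can be absorbed into the coefficients.
This serves for weights such as the output probabilities. -/
theorem integral_mul_norm_sum_runNoise_sq_le (h : IsRun P Φ H L Δ σ K w ξ γ x)
    {ρ : Ω → ℝ} {B : ℝ} (hρ : Measurable[scheduleAlg w x] ρ) (hρ0 : ∀ ω, 0 ≤ ρ ω)
    (hρB : ∀ ω, ρ ω ≤ B) {c : ℕ × Fin M → Ω → ℝ} {C D : ℝ}
    (hc : ∀ q, Measurable[scheduleAlg w x] (c q)) (hC : ∀ q ω, |c q ω| ≤ C)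
    {Q : Finset (ℕ × Fin M)} (hD : ∀ ω, ∑ q ∈ Q, c q ω ^ 2 ≤ D) :
    Integrable (fun ω => ρ ω * ‖∑ q ∈ Q, c q ω • runNoise Φ H w ξ x q ω‖ ^ 2) P ∧
      ∫ ω, ρ ω * ‖∑ q ∈ Q, c q ω • runNoise Φ H w ξ x q ω‖ ^ 2 ∂P
        ≤ σ ^ 2 * D * ∫ ω, ρ ω ∂P := by
  have hρ' : Measurable ρ := hρ.mono h.scheduleAlg_le le_rfl
  have hρi : Integrable ρ P := (integrable_const B).mono' hρ'.aestronglyMeasurable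
    (Filter.Eventually.of_forall fun ω => by
      rw [Real.norm_of_nonneg (hρ0 ω)]
      exact hρB ω)
  have hsqrt : ∀ ω, Real.sqrt (ρ ω) ^ 2 = ρ ω := fun ω => Real.sq_sqrt (hρ0 ω)
  obtain ⟨h1, h2⟩ := h.integral_norm_sum_runNoise_sq_le
    (c := fun q ω => Real.sqrt (ρ ω) * c q ω) (C := Real.sqrt B * C)
    (fun q => hρ.sqrt.mul (hc q)) (fun q ω => by
      rw [abs_mul, abs_of_nonneg (Real.sqrt_nonneg _)]
      exact mul_le_mul (Real.sqrt_le_sqrt (hρB ω)) (hC q ω) (abs_nonneg _)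
        (Real.sqrt_nonneg _)) Q
  have heq : ∀ ω, ‖∑ q ∈ Q, (Real.sqrt (ρ ω) * c q ω) • runNoise Φ H w ξ x q ω‖ ^ 2
      = ρ ω * ‖∑ q ∈ Q, c q ω • runNoise Φ H w ξ x q ω‖ ^ 2 := by
    intro ω
    simp only [mul_smul]
    rw [← Finset.smul_sum, norm_smul, mul_pow, Real.norm_of_nonneg (Real.sqrt_nonneg _), hsqrt]
  have hi := h1.integrable_norm_pow two_ne_zero
  simp only [heq] at hi h2
  refine ⟨hi, h2.trans ?_⟩
  rw [mul_assoc, ← integral_const_mul D]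
  refine mul_le_mul_of_nonneg_left ?_ (sq_nonneg σ)
  refine integral_mono_of_nonneg
    (Filter.Eventually.of_forall fun ω => Finset.sum_nonneg fun q _ => sq_nonneg _)
    (hρi.const_mul D) (Filter.Eventually.of_forall fun ω => ?_)
  simp only [mul_pow, hsqrt]
  rw [← Finset.mul_sum, mul_comm]
  exact mul_le_mul_of_nonneg_right (hD ω) (hρ0 ω)

section Weighted

variable {ρ : Ω → ℝ} {B : ℝ}

theorem integral_mul_norm_initNoise_sq_le (h : IsRun P Φ H L Δ σ K w ξ γ x)
    (hρ : Measurable[scheduleAlg w x] ρ) (hρ0 : ∀ ω, 0 ≤ ρ ω) (hρB : ∀ ω, ρ ω ≤ B) :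
    Integrable (fun ω => ρ ω * ‖initNoise (fun j => γ j ω) (fun j => w j ω)
        (fun j i => runNoise Φ H w ξ x (j, i) ω)‖ ^ 2) P ∧
      ∫ ω, ρ ω * ‖initNoise (fun j => γ j ω) (fun j => w j ω)
        (fun j i => runNoise Φ H w ξ x (j, i) ω)‖ ^ 2 ∂P
        ≤ σ ^ 2 * (M * stepCap L Δ σ M K ^ 2) * ∫ ω, ρ ω ∂P := by
  have := h.integral_mul_norm_sum_runNoise_sq_le hρ hρ0 hρB
    (c := fun q ω => pendStep (fun j => γ j ω) (fun j => w j ω) 1 q.2)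
    (fun q => h.measurable_pendStep 0 q.2) (fun q ω => h.abs_pendStep_le 1 q.2 ω)
    (Q := {0} ×ˢ Finset.univ) (D := M * stepCap L Δ σ M K ^ 2) (fun ω => by
      rw [Finset.sum_product, Finset.sum_singleton]
      refine (Finset.sum_le_sum fun i _ => h.sq_pendStep_le 1 i ω).trans ?_
      simp)
  simpa only [initNoise, Finset.sum_product, Finset.sum_singleton] using this

theorem integral_mul_norm_usedNoise_sq_le (h : IsRun P Φ H L Δ σ K w ξ γ x)
    (hρ : Measurable[scheduleAlg w x] ρ) (hρ0 : ∀ ω, 0 ≤ ρ ω) (hρB : ∀ ω, ρ ω ≤ B)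
    (S : Finset ℕ) :
    Integrable (fun ω => ρ ω * ‖∑ l ∈ S, hatStep (fun j => γ j ω) (fun j => w j ω) (l + 1) •
        runNoise Φ H w ξ x (l + 1, w (l + 1) ω) ω‖ ^ 2) P ∧
      ∫ ω, ρ ω * ‖∑ l ∈ S, hatStep (fun j => γ j ω) (fun j => w j ω) (l + 1) •
        runNoise Φ H w ξ x (l + 1, w (l + 1) ω) ω‖ ^ 2 ∂P
        ≤ σ ^ 2 * (S.card * stepCap L Δ σ M K ^ 2) * ∫ ω, ρ ω ∂P := by
  classical
  -- The active worker is random, so the sum is expanded over all workers, with coefficient 0 for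
  -- the inactive ones. The shift q.1 - 1 + 1 avoids `w 0`, which is not assumed measurable; first
  -- indices in Q are positive.
  have := h.integral_mul_norm_sum_runNoise_sq_le hρ hρ0 hρB
    (c := fun q ω => if w (q.1 - 1 + 1) ω = q.2 then
      hatStep (fun j => γ j ω) (fun j => w j ω) (q.1 - 1 + 1) else 0) (C := stepCap L Δ σ M K)
    (fun q => Measurable.ite (measurable_worker_schedule _ (by omega) (measurableSet_singleton q.2))
      (h.measurable_hatStep _) measurable_const)
    (fun q ω => by
      split_ifs
      · exact h.abs_pendStep_le _ _ ω
      · simpa using h.cap_pos.le)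
    (Q := (S.map ⟨Nat.succ, Nat.succ_injective⟩) ×ˢ Finset.univ)
    (D := S.card * stepCap L Δ σ M K ^ 2) (fun ω => by
      rw [Finset.sum_product, Finset.sum_map]
      simp only [ite_pow, ne_eq, OfNat.ofNat_ne_zero, not_false_eq_true, zero_pow,
        Finset.sum_ite_eq, Finset.mem_univ, if_true]
      refine (Finset.sum_le_sum fun l _ => h.sq_pendStep_le _ _ ω).trans ?_
      simp)
  simpa only [Finset.sum_product, Finset.sum_map, Function.Embedding.coeFn_mk, Nat.succ_eq_add_one,
    add_tsub_cancel_right, ite_smul, zero_smul, Finset.sum_ite_eq, Finset.mem_univ, if_true]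
    using this

theorem integral_mul_norm_pendNoise_sq_le (h : IsRun P Φ H L Δ σ K w ξ γ x)
    (hρ : Measurable[scheduleAlg w x] ρ) (hρ0 : ∀ ω, 0 ≤ ρ ω) (hρB : ∀ ω, ρ ω ≤ B) (k : ℕ) :
    Integrable (fun ω => ρ ω * ‖pendNoise (fun j => γ j ω) (fun j => w j ω)
        (fun j i => runNoise Φ H w ξ x (j, i) ω) k‖ ^ 2) P ∧
      ∫ ω, ρ ω * ‖pendNoise (fun j => γ j ω) (fun j => w j ω)
        (fun j i => runNoise Φ H w ξ x (j, i) ω) k‖ ^ 2 ∂P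
        ≤ σ ^ 2 * (M * stepCap L Δ σ M K ^ 2) * ∫ ω, ρ ω ∂P := by
  classical
  have hprev : ∀ i, Measurable[scheduleAlg w x] fun ω => prev (fun j => w j ω) (k + 1) i :=
    fun i => @AsyncSGD.measurable_prev Ω M (scheduleAlg w x) w measurable_worker_schedule k i
  have hmem : ∀ ω i, prev (fun j => w j ω) (k + 1) i ∈ Finset.range (k + 1) := fun ω i =>
    Finset.mem_range.2 (Nat.lt_succ_of_le (prev_le _ _ _))
  -- The random index prev is expanded over all j ≤ k. For each worker at most one coefficient
  -- survives, so the squares sum to at most M times the squared cap.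
  have := h.integral_mul_norm_sum_runNoise_sq_le hρ hρ0 hρB
    (c := fun q ω => if w (k + 1) ω = q.2 then 0 else
      if prev (fun j => w j ω) (k + 1) q.2 = q.1 then
        pendStep (fun j => γ j ω) (fun j => w j ω) (k + 1) q.2 else 0) (C := stepCap L Δ σ M K)
    (fun q => Measurable.ite (measurable_worker_schedule _ (by omega) (measurableSet_singleton q.2))
      measurable_const (Measurable.ite (hprev q.2 (measurableSet_singleton q.1))
        (h.measurable_pendStep k q.2) measurable_const))
    (fun q ω => by
      split_ifs
      · simpa using h.cap_pos.le
      · exact h.abs_pendStep_le _ _ ω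
      · simpa using h.cap_pos.le)
    (Q := Finset.range (k + 1) ×ˢ Finset.univ) (D := M * stepCap L Δ σ M K ^ 2) (fun ω => by
      rw [Finset.sum_product_right]
      calc _ ≤ ∑ _i : Fin M, stepCap L Δ σ M K ^ 2 := Finset.sum_le_sum fun i _ => by
            by_cases hi : w (k + 1) ω = i
            · simp [hi, sq_nonneg]
            · simp only [hi, if_false, ite_pow, ne_eq, OfNat.ofNat_ne_zero, not_false_eq_true,
                zero_pow, Finset.sum_ite_eq, hmem, if_true]
              exact h.sq_pendStep_le _ _ ω
        _ = _ := by simp)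
  have heq : ∀ ω, ∑ q ∈ Finset.range (k + 1) ×ˢ (Finset.univ : Finset (Fin M)),
      (if w (k + 1) ω = q.2 then 0 else
      if prev (fun j => w j ω) (k + 1) q.2 = q.1 then
        pendStep (fun j => γ j ω) (fun j => w j ω) (k + 1) q.2 else 0) •
        runNoise Φ H w ξ x q ω = pendNoise (fun j => γ j ω) (fun j => w j ω)
        (fun j i => runNoise Φ H w ξ x (j, i) ω) k := by
    intro ω
    rw [Finset.sum_product_right, pendNoise,
      ← Finset.add_sum_erase _ _ (Finset.mem_univ (w (k + 1) ω))]
    simp only [if_true, zero_smul, Finset.sum_const_zero, zero_add]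
    refine Finset.sum_congr rfl fun i hi => ?_
    have hne := (Finset.ne_of_mem_erase hi).symm
    simp only [hne, if_false, ite_smul, zero_smul, Finset.sum_ite_eq, hmem, if_true]
  simp only [heq] at this
  exact this

end Weighted

end IsRun

/-! ### Local and global gradients -/

namespace IsSmoothObjective

variable {d M : ℕ} {F : EuclideanSpace ℝ (Fin d) → ℝ}
  {G : EuclideanSpace ℝ (Fin d) → EuclideanSpace ℝ (Fin d)}
  {H : Fin M → EuclideanSpace ℝ (Fin d) → EuclideanSpace ℝ (Fin d)} {L ζ m : ℝ}

theorem measurable_gradient (hO : IsSmoothObjective F G H L ζ m) : Measurable G := by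
  refine (LipschitzWith.of_dist_le_mul (K := L.toNNReal) fun y z => ?_).continuous.measurable
  rw [dist_eq_norm, dist_eq_norm]
  exact (hO.lipschitz y z).trans
    (mul_le_mul_of_nonneg_right (Real.le_coe_toNNReal L) (norm_nonneg _))

theorem norm_local_le (hO : IsSmoothObjective F G H L ζ m) (i : Fin M)
    (y : EuclideanSpace ℝ (Fin d)) : ‖H i y‖ ≤ |ζ| + ‖G y‖ := by
  have h1 : ‖H i y - G y‖ ≤ |ζ| := by
    have := sq_le_sq.1 (hO.dissimilarity i y)
    rwa [abs_norm] at this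
  have h2 := norm_add_le (H i y - G y) (G y)
  rw [sub_add_cancel] at h2
  linarith

theorem norm_sq_gradient_le_local (hO : IsSmoothObjective F G H L ζ m) (i : Fin M)
    (y : EuclideanSpace ℝ (Fin d)) : ‖G y‖ ^ 2 ≤ 2 * ‖H i y‖ ^ 2 + 2 * ζ ^ 2 := by
  have h1 := norm_add_sq_le_two (H i y) (G y - H i y)
  rw [add_sub_cancel, norm_sub_rev (G y)] at h1
  linarith [hO.dissimilarity i y]

end IsSmoothObjective

theorem integral_add_sum_le {Ω : Type*} [MeasurableSpace Ω] {P : Measure Ω} {A B : Ω → ℝ}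
    {C D E : ℕ → Ω → ℝ} {K : ℕ} (hA : Integrable A P) (hB : Integrable B P)
    (hC : ∀ k, Integrable (C k) P) (hD : ∀ k, Integrable (D k) P) (hE : ∀ k, Integrable (E k) P)
    {a c d : ℝ} (ha : ∫ ω, A ω ∂P ≤ a) (hb : ∫ ω, B ω ∂P = 0) (hc : ∀ k, ∫ ω, C k ω ∂P ≤ c)
    (hd : ∀ k, ∫ ω, D k ω ∂P ≤ d) (he : ∀ k, ∫ ω, E k ω ∂P = 0) :
    Integrable (fun ω => A ω + B ω + ∑ k ∈ Finset.range K, (C k ω + D k ω + E k ω)) P ∧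
      ∫ ω, (A ω + B ω + ∑ k ∈ Finset.range K, (C k ω + D k ω + E k ω)) ∂P
        ≤ a + K * (c + d) := by
  have hCD : ∀ k, Integrable (fun ω => C k ω + D k ω) P := fun k => (hC k).add (hD k)
  have hCDE : ∀ k, Integrable (fun ω => C k ω + D k ω + E k ω) P := fun k => (hCD k).add (hE k)
  have hAB : Integrable (fun ω => A ω + B ω) P := hA.add hB
  have hS : Integrable (fun ω => ∑ k ∈ Finset.range K, (C k ω + D k ω + E k ω)) P :=
    integrable_finsetSum _ fun k _ => hCDE k
  refine ⟨hAB.add hS, ?_⟩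
  rw [integral_add hAB hS, integral_add hA hB, hb, add_zero, integral_finsetSum _ fun k _ => hCDE k]
  refine add_le_add ha ((Finset.sum_le_sum (g := fun _ => c + d) fun k _ => ?_).trans_eq (by simp [mul_add]))
  rw [integral_add (hCD k) (hE k), integral_add (hC k) (hD k), he, add_zero]
  exact add_le_add (hc k) (hd k)

namespace IsRun

theorem norm_gradient_le_sum {d M : ℕ} {Ξ Ω : Type*}
    {Φ : Fin M → EuclideanSpace ℝ (Fin d) → Ξ → EuclideanSpace ℝ (Fin d)}
    {H : Fin M → EuclideanSpace ℝ (Fin d) → EuclideanSpace ℝ (Fin d)}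
    {w : ℕ → Ω → Fin M} {ξ : ℕ → Fin M → Ω → Ξ}
    {x : ℕ → Ω → EuclideanSpace ℝ (Fin d)} (i : Fin M) {j k : ℕ} (hj : j ≤ k) (ω : Ω) :
    ‖((fun j i => H i (x j ω)) + fun j i => runNoise Φ H w ξ x (j, i) ω) j i‖
      ≤ ∑ q ∈ Finset.range (k + 1) ×ˢ Finset.univ,
        ‖H q.2 (x q.1 ω) + runNoise Φ H w ξ x q ω‖ :=
  Finset.single_le_sum (f := fun q : ℕ × Fin M => ‖H q.2 (x q.1 ω) + runNoise Φ H w ξ x q ω‖)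
    (fun q _ => norm_nonneg _) (a := (j, i)) (by simp; omega)

variable {d M K : ℕ} {Ξ Ω : Type*} [MeasurableSpace Ξ] {m : MeasurableSpace Ω}
  [mΩ : MeasurableSpace Ω] {P : Measure Ω}
  {Φ : Fin M → EuclideanSpace ℝ (Fin d) → Ξ → EuclideanSpace ℝ (Fin d)}
  {F : EuclideanSpace ℝ (Fin d) → ℝ}
  {G : EuclideanSpace ℝ (Fin d) → EuclideanSpace ℝ (Fin d)}
  {H : Fin M → EuclideanSpace ℝ (Fin d) → EuclideanSpace ℝ (Fin d)} {L Δ σ ζ μ : ℝ}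
  {w : ℕ → Ω → Fin M} {ξ : ℕ → Fin M → Ω → Ξ} {γ : ℕ → Ω → ℝ}
  {x : ℕ → Ω → EuclideanSpace ℝ (Fin d)}

/-! ### Square integrability along a run -/

theorem measurable_pending_gradient_of (h : IsRun P Φ H L Δ σ K w ξ γ x)
    (hm : scheduleAlg w x ≤ m) (k : ℕ) (hx : ∀ j ≤ k, Measurable[m] (x j))
    (hn : ∀ j ≤ k, ∀ i, Measurable[m] (runNoise Φ H w ξ x (j, i))) (i : Fin M) :
    Measurable[m] fun ω => ((fun j i => H i (x j ω)) + fun j i => runNoise Φ H w ξ x (j, i) ω)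
        (prev (fun j => w j ω) (k + 1) i) i := by
  have hprev : Measurable[m] fun ω => prev (fun j => w j ω) (k + 1) i :=
    @AsyncSGD.measurable_prev Ω M m w
      (fun k hk => (measurable_worker_schedule k hk).mono hm le_rfl) k i
  have h1 : ∀ j, Measurable[m] fun ω =>
      H i (x (min j k) ω) + runNoise Φ H w ξ x (min j k, i) ω := fun j =>
    ((h.measurable_grad i).comp (hx _ (min_le_right _ _))).add (hn _ (min_le_right _ _) i)
  have h2 := @measurable_eval_of_countable Ω m ℕ _ _ _ _ _ _
    (fun j ω => H i (x (min j k) ω) + runNoise Φ H w ξ x (min j k, i) ω) hprev h1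
  simpa only [min_eq_left (prev_le _ _ _), Pi.add_apply] using h2

theorem measurable_virt_of (h : IsRun P Φ H L Δ σ K w ξ γ x)
    (hm : scheduleAlg w x ≤ m) (k : ℕ) (hx : ∀ j ≤ k, Measurable[m] (x j))
    (hn : ∀ j ≤ k, ∀ i, Measurable[m] (runNoise Φ H w ξ x (j, i))) :
    Measurable[m] fun ω => virt (fun j => γ j ω) (fun j => w j ω) (fun j => x j ω)
      ((fun j i => H i (x j ω)) + fun j i => runNoise Φ H w ξ x (j, i) ω) k := by
  unfold virt
  exact (hx k le_rfl).sub (Finset.measurable_fun_sum _ fun i _ =>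
    ((h.measurable_pendStep k i).mono hm le_rfl).smul
      (h.measurable_pending_gradient_of hm k hx hn i))

/-- The steps in `virt k` look into the future of the schedule, but its gradients are those at x_0,
…, x_k, which do not involve samples drawn at x_{k+1}. -/
theorem measurable_virt_otherAlg (h : IsRun P Φ H L Δ σ K w ξ γ x) (k : ℕ) (i : Fin M) :
    Measurable[otherAlg w ξ x (k + 1, i)] fun ω =>
      virt (fun j => γ j ω) (fun j => w j ω) (fun j => x j ω)
      ((fun j i => H i (x j ω)) + fun j i => runNoise Φ H w ξ x (j, i) ω) k := by
  refine h.measurable_virt_of (scheduleAlg_le_otherAlg _) k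
    (fun j hj => h.measurable_iterate_otherAlg (q := (k + 1, i)) (by simp; omega))
    fun j hj i' => h.measurable_runNoise_otherAlg ?_ (by simp; omega)
  intro heq
  have := congrArg Prod.fst heq
  simp only at this
  omega

theorem measurable_local_worker_of (h : IsRun P Φ H L Δ σ K w ξ γ x)
    (hm : scheduleAlg w x ≤ m) (k : ℕ) (hx : Measurable[m] (x (k + 1))) :
    Measurable[m] fun ω => H (w (k + 1) ω) (x (k + 1) ω) :=
  @measurable_eval_of_countable Ω m (Fin M) _ _ _ _ _ _ (fun i ω => H i (x (k + 1) ω))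
    ((measurable_worker_schedule (k + 1) (by omega)).mono hm le_rfl)
    fun i => (h.measurable_grad i).comp hx

variable [IsProbabilityMeasure P]

/-- The bound ‖∇F‖² ≤ 2L(F - μ) gives a second moment of the gradient although x_0 itself need not
have one. -/
theorem memLp_gradient_init (h : IsRun P Φ H L Δ σ K w ξ γ x)
    (hO : IsSmoothObjective F G H L ζ μ) (hF : Integrable (fun ω => F (x 0 ω)) P) :
    MemLp (fun ω => G (x 0 ω)) 2 P := by
  have hmeas : Measurable fun ω => G (x 0 ω) := hO.measurable_gradient.comp h.measurable_init
  rw [memLp_two_iff_integrable_sq_norm hmeas.aestronglyMeasurable]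
  refine ((hF.sub (integrable_const μ)).const_mul (2 * L)).mono'
    (hmeas.norm.pow_const 2).aestronglyMeasurable (Filter.Eventually.of_forall fun ω => ?_)
  rw [Real.norm_of_nonneg (sq_nonneg _)]
  exact norm_sq_gradient_le hO.hasGradientAt hO.lipschitz h.L_pos hO.lower_bound (x 0 ω)

theorem memLp_gradient_of (h : IsRun P Φ H L Δ σ K w ξ γ x)
    (hO : IsSmoothObjective F G H L ζ μ) (hF : Integrable (fun ω => F (x 0 ω)) P)
    {z : Ω → EuclideanSpace ℝ (Fin d)} (hz : Measurable z)
    (hzx : MemLp (fun ω => z ω - x 0 ω) 2 P) : MemLp (fun ω => G (z ω)) 2 P := by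
  have h1 : MemLp (fun ω => G (z ω) - G (x 0 ω)) 2 P :=
    hzx.of_le_mul (c := L) ((hO.measurable_gradient.comp hz).sub
      (hO.measurable_gradient.comp h.measurable_init)).aestronglyMeasurable
      (Filter.Eventually.of_forall fun ω => hO.lipschitz _ _)
  have h2 := h1.add (h.memLp_gradient_init hO hF)
  refine h2.congr_norm (hO.measurable_gradient.comp hz).aestronglyMeasurable
    (Filter.Eventually.of_forall fun ω => ?_)
  simp

theorem memLp_local_of (h : IsRun P Φ H L Δ σ K w ξ γ x)
    (hO : IsSmoothObjective F G H L ζ μ) (hF : Integrable (fun ω => F (x 0 ω)) P)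
    {z : Ω → EuclideanSpace ℝ (Fin d)} (hz : Measurable z)
    (hzx : MemLp (fun ω => z ω - x 0 ω) 2 P) (i : Fin M) : MemLp (fun ω => H i (z ω)) 2 P := by
  have h1 : MemLp (fun ω => |ζ| + ‖G (z ω)‖) 2 P :=
    (memLp_const |ζ|).add (h.memLp_gradient_of hO hF hz hzx).norm
  refine h1.of_le_mul (c := 1) ((h.measurable_grad i).comp hz).aestronglyMeasurable
    (Filter.Eventually.of_forall fun ω => ?_)
  rw [one_mul, Real.norm_of_nonneg (by positivity)]
  exact hO.norm_local_le i (z ω)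

/-- Only displacements from x_0 are square integrable in general. Each increment is a bounded step
times a local gradient and noise from an earlier iterate, so strong induction applies. -/
theorem memLp_iterate_sub (h : IsRun P Φ H L Δ σ K w ξ γ x)
    (hO : IsSmoothObjective F G H L ζ μ) (hF : Integrable (fun ω => F (x 0 ω)) P) (k : ℕ) :
    MemLp (fun ω => x k ω - x 0 ω) 2 P := by
  induction k using Nat.strong_induction_on with
  | _ k ih =>
    rcases k with _ | k
    · simp
    · have hg : ∀ q ∈ Finset.range (k + 1) ×ˢ (Finset.univ : Finset (Fin M)),
          MemLp (fun ω => H q.2 (x q.1 ω) + runNoise Φ H w ξ x q ω) 2 P := by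
        intro q hq
        have hq1 : q.1 < k + 1 := Finset.mem_range.1 (Finset.mem_product.1 hq).1
        exact (h.memLp_local_of hO hF (h.measurable_iterate' q.1) (ih q.1 hq1) q.2).add
          (h.runNoise_condExp q).1
      have hinc : MemLp (fun ω => x (k + 1) ω - x k ω) 2 P := by
        refine memLp_of_norm_le_sum (C := stepCap L Δ σ M K)
          ((h.measurable_iterate' _).sub (h.measurable_iterate' _)).aestronglyMeasurable hg
          fun ω => ?_
        rw [h.iterate_succ_eq, sub_sub_cancel_left, norm_neg, norm_smul, h.step_eq,
          Real.norm_of_nonneg (stepsize_nonneg h.L_pos h.Δ_pos h.M_pos h.K_pos _)]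
        exact mul_le_mul (stepsize_le_cap _) (norm_gradient_le_sum _ (prev_le _ _ _) ω)
          (norm_nonneg _) h.cap_pos.le
      have := hinc.add (ih k (by omega))
      refine this.congr_norm
        ((h.measurable_iterate' _).sub (h.measurable_iterate' _)).aestronglyMeasurable
        (Filter.Eventually.of_forall fun ω => ?_)
      simp

theorem memLp_gradient (h : IsRun P Φ H L Δ σ K w ξ γ x)
    (hO : IsSmoothObjective F G H L ζ μ) (hF : Integrable (fun ω => F (x 0 ω)) P) (k : ℕ) :
    MemLp (fun ω => G (x k ω)) 2 P :=
  h.memLp_gradient_of hO hF (h.measurable_iterate' k) (h.memLp_iterate_sub hO hF k)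

theorem memLp_local (h : IsRun P Φ H L Δ σ K w ξ γ x)
    (hO : IsSmoothObjective F G H L ζ μ) (hF : Integrable (fun ω => F (x 0 ω)) P) (k : ℕ)
    (i : Fin M) : MemLp (fun ω => H i (x k ω)) 2 P :=
  h.memLp_local_of hO hF (h.measurable_iterate' k) (h.memLp_iterate_sub hO hF k) i

theorem memLp_gradient_virt (h : IsRun P Φ H L Δ σ K w ξ γ x)
    (hO : IsSmoothObjective F G H L ζ μ) (hF : Integrable (fun ω => F (x 0 ω)) P) (k : ℕ) :
    MemLp (fun ω => G (virt (fun j => γ j ω) (fun j => w j ω) (fun j => x j ω)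
      ((fun j i => H i (x j ω)) + fun j i => runNoise Φ H w ξ x (j, i) ω) k)) 2 P := by
  have hmeas := h.measurable_virt_of h.scheduleAlg_le k (fun j _ => h.measurable_iterate' j)
    fun j _ i => h.measurable_runNoise (j, i)
  refine h.memLp_gradient_of hO hF hmeas ?_
  have hterm : ∀ i ∈ (Finset.univ : Finset (Fin M)), MemLp (fun ω =>
      pendStep (fun j => γ j ω) (fun j => w j ω) (k + 1) i •
      ((fun j i => H i (x j ω)) + fun j i => runNoise Φ H w ξ x (j, i) ω)
        (prev (fun j => w j ω) (k + 1) i) i) 2 P := by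
    intro i _
    refine memLp_of_norm_le_sum (C := stepCap L Δ σ M K)
      (((h.measurable_pendStep k i).mono h.scheduleAlg_le le_rfl).smul
        (h.measurable_pending_gradient_of h.scheduleAlg_le k (fun j _ => h.measurable_iterate' j)
          (fun j _ i => h.measurable_runNoise (j, i)) i)).aestronglyMeasurable
      (fun q _ => (h.memLp_local hO hF q.1 q.2).add (h.runNoise_condExp q).1)
      (Q := Finset.range (k + 1) ×ˢ Finset.univ) fun ω => ?_
    rw [norm_smul, Real.norm_eq_abs]
    exact mul_le_mul (h.abs_pendStep_le _ _ ω) (norm_gradient_le_sum _ (prev_le _ _ _) ω)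
      (norm_nonneg _) h.cap_pos.le
  refine ((h.memLp_iterate_sub hO hF k).sub (memLp_finsetSum _ hterm)).congr_norm
    (hmeas.sub h.measurable_init).aestronglyMeasurable (Filter.Eventually.of_forall fun ω => ?_)
  simp only [virt, Pi.sub_apply]
  congr 1
  abel

/-! ### The expectation of the noise -/

theorem inner_runNoise (h : IsRun P Φ H L Δ σ K w ξ γ x) (q : ℕ × Fin M)
    {U : Ω → EuclideanSpace ℝ (Fin d)} (hU : Measurable[otherAlg w ξ x q] U)
    (hU2 : MemLp U 2 P) :
    Integrable (fun ω => ⟪runNoise Φ H w ξ x q ω, U ω⟫) P ∧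
      ∫ ω, ⟪runNoise Φ H w ξ x q ω, U ω⟫ ∂P = 0 :=
  ⟨integrable_inner_of_memLp (h.runNoise_condExp q).1 hU2,
    integral_inner_eq_zero (h.otherAlg_le q) (h.runNoise_condExp q).1 hU2 hU.stronglyMeasurable
      (h.runNoise_condExp q).2.1⟩

theorem inner_initNoise (h : IsRun P Φ H L Δ σ K w ξ γ x)
    {U : Ω → EuclideanSpace ℝ (Fin d)} (hUm : Measurable[scheduleAlg w x] U)
    (hU2 : MemLp U 2 P) :
    Integrable (fun ω => ⟪initNoise (fun j => γ j ω) (fun j => w j ω)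
        (fun j i => runNoise Φ H w ξ x (j, i) ω), U ω⟫) P ∧
      ∫ ω, ⟪initNoise (fun j => γ j ω) (fun j => w j ω)
        (fun j i => runNoise Φ H w ξ x (j, i) ω), U ω⟫ ∂P = 0 := by
  have key : ∀ i : Fin M, _ := fun i => h.inner_runNoise (0, i)
    (U := fun ω => pendStep (fun j => γ j ω) (fun j => w j ω) 1 i • U ω)
    (((h.measurable_pendStep 0 i).smul hUm).mono (scheduleAlg_le_otherAlg _) le_rfl)
    (MemLp.smul_of_bounded hU2
      ((h.measurable_pendStep 0 i).mono h.scheduleAlg_le le_rfl).aestronglyMeasurable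
      (h.abs_pendStep_le 1 i))
  have heq : ∀ ω, ⟪initNoise (fun j => γ j ω) (fun j => w j ω)
        (fun j i => runNoise Φ H w ξ x (j, i) ω), U ω⟫ = ∑ i,
        ⟪runNoise Φ H w ξ x (0, i) ω,
          pendStep (fun j => γ j ω) (fun j => w j ω) 1 i • U ω⟫ := by
    intro ω
    simp only [initNoise, sum_inner, real_inner_smul_left, real_inner_smul_right]
  simp only [heq]
  refine ⟨integrable_finsetSum _ fun i _ => (key i).1, ?_⟩
  rw [integral_finsetSum _ fun i _ => (key i).1]
  exact Finset.sum_eq_zero fun i _ => (key i).2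

theorem inner_stepNoise (h : IsRun P Φ H L Δ σ K w ξ γ x) (k : ℕ)
    {U : Ω → EuclideanSpace ℝ (Fin d)} (hUm : ∀ i, Measurable[otherAlg w ξ x (k + 1, i)] U)
    (hU2 : MemLp U 2 P) :
    Integrable (fun ω => ⟪runNoise Φ H w ξ x (k + 1, w (k + 1) ω) ω, U ω⟫) P ∧
      ∫ ω, ⟪runNoise Φ H w ξ x (k + 1, w (k + 1) ω) ω, U ω⟫ ∂P = 0 := by
  have key : ∀ i : Fin M, _ := fun i => h.inner_runNoise (k + 1, i) (hUm i) hU2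
  -- The noise of inactive workers is 0 by definition, so the random worker can be replaced by a sum
  -- over all workers, each handled with its own σ-algebra.
  have heq : ∀ ω, ⟪runNoise Φ H w ξ x (k + 1, w (k + 1) ω) ω, U ω⟫ = ∑ i,
        ⟪runNoise Φ H w ξ x (k + 1, i) ω, U ω⟫ := by
    intro ω
    rw [Finset.sum_eq_single (w (k + 1) ω)]
    · intro i _ hi
      simp [runNoise, hi.symm]
    · simp
  simp only [heq]
  refine ⟨integrable_finsetSum _ fun i _ => (key i).1, ?_⟩
  rw [integral_finsetSum _ fun i _ => (key i).1]
  exact Finset.sum_eq_zero fun i _ => (key i).2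

theorem inner_initNoise_gradient (h : IsRun P Φ H L Δ σ K w ξ γ x)
    (hO : IsSmoothObjective F G H L ζ μ) (hF : Integrable (fun ω => F (x 0 ω)) P) :
    Integrable (fun ω => ⟪initNoise (fun j => γ j ω) (fun j => w j ω)
        (fun j i => runNoise Φ H w ξ x (j, i) ω), -G (x 0 ω) + L • ∑ i,
          pendStep (fun j => γ j ω) (fun j => w j ω) 1 i • H i (x 0 ω)⟫) P ∧
      ∫ ω, ⟪initNoise (fun j => γ j ω) (fun j => w j ω)
        (fun j i => runNoise Φ H w ξ x (j, i) ω), -G (x 0 ω) + L • ∑ i,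
          pendStep (fun j => γ j ω) (fun j => w j ω) 1 i • H i (x 0 ω)⟫ ∂P = 0 := by
  have hstep : ∀ i, Measurable fun ω => pendStep (fun j => γ j ω) (fun j => w j ω) 1 i :=
    fun i => (h.measurable_pendStep 0 i).mono h.scheduleAlg_le le_rfl
  refine h.inner_initNoise ?_ ?_
  · have h1 : Measurable[scheduleAlg w x] fun ω => ∑ i,
        pendStep (fun j => γ j ω) (fun j => w j ω) 1 i • H i (x 0 ω) :=
      Finset.measurable_fun_sum _ fun i _ => (h.measurable_pendStep 0 i).smul
        ((h.measurable_grad i).comp measurable_init_schedule)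
    exact (hO.measurable_gradient.comp measurable_init_schedule).neg.add
      ((@measurable_const _ _ _ (scheduleAlg w x) L).smul h1)
  · have h1 : MemLp (fun ω => ∑ i,
        pendStep (fun j => γ j ω) (fun j => w j ω) 1 i • H i (x 0 ω)) 2 P :=
      memLp_finsetSum _ fun i _ => MemLp.smul_of_bounded (h.memLp_local hO hF 0 i)
        (hstep i).aestronglyMeasurable (h.abs_pendStep_le 1 i)
    exact (h.memLp_gradient_init hO hF).neg.add (h1.const_smul L)

theorem inner_stepNoise_gradient (h : IsRun P Φ H L Δ σ K w ξ γ x)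
    (hO : IsSmoothObjective F G H L ζ μ) (hF : Integrable (fun ω => F (x 0 ω)) P) (k : ℕ) :
    Integrable (fun ω => ⟪runNoise Φ H w ξ x (k + 1, w (k + 1) ω) ω,
        -(hatStep (fun j => γ j ω) (fun j => w j ω) (k + 1) •
          G (virt (fun j => γ j ω) (fun j => w j ω) (fun j => x j ω)
            ((fun j i => H i (x j ω)) + fun j i => runNoise Φ H w ξ x (j, i) ω) k))
          + (L * hatStep (fun j => γ j ω) (fun j => w j ω) (k + 1) ^ 2) •
            H (w (k + 1) ω) (x (k + 1) ω)⟫) P ∧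
      ∫ ω, ⟪runNoise Φ H w ξ x (k + 1, w (k + 1) ω) ω,
        -(hatStep (fun j => γ j ω) (fun j => w j ω) (k + 1) •
          G (virt (fun j => γ j ω) (fun j => w j ω) (fun j => x j ω)
            ((fun j i => H i (x j ω)) + fun j i => runNoise Φ H w ξ x (j, i) ω) k))
          + (L * hatStep (fun j => γ j ω) (fun j => w j ω) (k + 1) ^ 2) •
            H (w (k + 1) ω) (x (k + 1) ω)⟫ ∂P = 0 := by
  have hstep : Measurable fun ω => hatStep (fun j => γ j ω) (fun j => w j ω) (k + 1) :=
    (h.measurable_hatStep k).mono h.scheduleAlg_le le_rfl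
  refine h.inner_stepNoise k (fun i => ?_) ?_
  · have hle : scheduleAlg w x ≤ otherAlg w ξ x (k + 1, i) := scheduleAlg_le_otherAlg _
    have hs := (h.measurable_hatStep k).mono hle le_rfl
    exact (hs.smul (hO.measurable_gradient.comp (h.measurable_virt_otherAlg k i))).neg.add
      (((hs.pow_const 2).const_mul L).smul
        (h.measurable_local_worker_of hle k (h.measurable_iterate_otherAlg le_rfl)))
  · have hH2 : MemLp (fun ω => H (w (k + 1) ω) (x (k + 1) ω)) 2 P :=
      memLp_of_norm_le_sum (C := 1) (h.measurable_local_worker_of h.scheduleAlg_le k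
        (h.measurable_iterate' _)).aestronglyMeasurable
        (fun i _ => h.memLp_local hO hF (k + 1) i) (Q := Finset.univ) fun ω => by
          rw [one_mul]
          exact Finset.single_le_sum (f := fun i => ‖H i (x (k + 1) ω)‖)
            (fun i _ => norm_nonneg _) (Finset.mem_univ _)
    refine MemLp.add (MemLp.neg (MemLp.smul_of_bounded (h.memLp_gradient_virt hO hF k)
      hstep.aestronglyMeasurable fun ω => h.abs_pendStep_le (k + 2) (w (k + 1) ω) ω))
      (MemLp.smul_of_bounded hH2 ((hstep.pow_const 2).const_mul L).aestronglyMeasurable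
        (C := L * stepCap L Δ σ M K ^ 2) fun ω => ?_)
    rw [abs_of_nonneg (mul_nonneg h.L_pos.le (sq_nonneg _))]
    exact mul_le_mul_of_nonneg_left (h.sq_pendStep_le _ _ ω) h.L_pos.le

theorem integral_totalNoise_le (h : IsRun P Φ H L Δ σ K w ξ γ x)
    (hO : IsSmoothObjective F G H L ζ μ) (hF : Integrable (fun ω => F (x 0 ω)) P) :
    Integrable (fun ω => totalNoise L G (fun j => γ j ω) (fun j => w j ω) (fun j => x j ω)
        (fun j i => H i (x j ω)) (fun j i => runNoise Φ H w ξ x (j, i) ω) K) P ∧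
      ∫ ω, totalNoise L G (fun j => γ j ω) (fun j => w j ω) (fun j => x j ω)
        (fun j i => H i (x j ω)) (fun j i => runNoise Φ H w ξ x (j, i) ω) K ∂P
        ≤ 3 / 2 * Δ := by
  have hs := h.cap_pos
  have hL := h.L_pos
  have hinit := h.integral_mul_norm_initNoise_sq_le (ρ := fun _ => L / 2) (B := L / 2)
    measurable_const (fun _ => by positivity) fun _ => le_rfl
  have hinner := h.inner_initNoise_gradient hO hF
  have hused : ∀ k, _ := fun k =>
    h.integral_mul_norm_usedNoise_sq_le (ρ := fun _ => L / 2) (B := L / 2)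
      measurable_const (fun _ => by positivity) (fun _ => le_rfl) {k}
  have hpend : ∀ k, _ := fun k => h.integral_mul_norm_pendNoise_sq_le
    (ρ := fun ω => 2 * L ^ 2 * hatStep (fun j => γ j ω) (fun j => w j ω) (k + 1))
    (B := 2 * L ^ 2 * stepCap L Δ σ M K) ((h.measurable_hatStep k).const_mul _)
    (fun ω => mul_nonneg (by positivity) (h.pendStep_nonneg _ _ ω))
    (fun ω => mul_le_mul_of_nonneg_left (h.pendStep_le _ _ ω) (by positivity)) k
  have hstep : ∀ k, _ := fun k => h.inner_stepNoise_gradient hO hF k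
  simp only [Finset.sum_singleton, norm_smul, mul_pow, Real.norm_eq_abs, sq_abs,
    Finset.card_singleton, Nat.cast_one, one_mul, ← mul_assoc] at hused
  have hpi : ∀ k, ∫ ω, 2 * L ^ 2 * hatStep (fun j => γ j ω) (fun j => w j ω) (k + 1) ∂P
      ≤ 2 * L ^ 2 * stepCap L Δ σ M K := fun k => by
    refine (integral_mono_of_nonneg (g := fun _ => 2 * L ^ 2 * stepCap L Δ σ M K)
      (Filter.Eventually.of_forall fun ω => mul_nonneg (by positivity)
        (h.pendStep_nonneg _ _ ω)) (integrable_const _)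
      (Filter.Eventually.of_forall fun ω =>
        mul_le_mul_of_nonneg_left (h.pendStep_le _ _ ω) (by positivity))).trans ?_
    simp
  have hsum := integral_add_sum_le (K := K) hinit.1 hinner.1 (fun k => (hused k).1)
    (fun k => (hpend k).1) (fun k => (hstep k).1)
    (a := σ ^ 2 * (M * stepCap L Δ σ M K ^ 2) * (L / 2)) (hinit.2.trans_eq (by simp)) hinner.2
    (c := σ ^ 2 * stepCap L Δ σ M K ^ 2 * (L / 2)) (fun k => (hused k).2.trans_eq (by simp))
    (d := σ ^ 2 * (M * stepCap L Δ σ M K ^ 2) * (2 * L ^ 2 * stepCap L Δ σ M K))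
    (fun k => (hpend k).2.trans (mul_le_mul_of_nonneg_left (hpi k) (by positivity)))
    (fun k => (hstep k).2)
  refine ⟨hsum.1, ?_⟩
  · refine hsum.2.trans ?_
    -- With s the cap, the initial and fresh noise contribute Lσ²s²(M + K)/2 ≤ Δ, and the pending
    -- noise 2ML²σ²s³K ≤ Δ/2 because 4MLs ≤ 1.
    have h1 := mul_stepCap_le (Δ := Δ) (σ := σ) (K := K) hL h.M_pos
    have h2 := mul_sq_stepCap_le (σ := σ) hL h.Δ_pos h.M_pos h.K_pos
    have h3 : (M : ℝ) ≤ K := by exact_mod_cast h.M_le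
    have h4 : 0 ≤ L * σ ^ 2 * stepCap L Δ σ M K ^ 2 := by positivity
    have h5 := mul_le_mul_of_nonneg_right h3 h4
    have h6 := mul_le_mul_of_nonneg_left h1 (mul_nonneg (Nat.cast_nonneg K) h4)
    nlinarith

end IsRun

/-- The probability with which the output is `x_{k + 1}`. -/
def outputWeight {M : ℕ} {Ω : Type*} (K : ℕ) (γ : ℕ → Ω → ℝ) (w : ℕ → Ω → Fin M) (k : ℕ) (ω : Ω) : ℝ :=
  hatStep (fun j => γ j ω) (fun j => w j ω) (k + 1)
    / ∑ l ∈ Finset.range K, hatStep (fun j => γ j ω) (fun j => w j ω) (l + 1)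

/-- Only an inequality: if all γ̂_k vanish, the quotients are 0. -/
theorem sum_outputWeight_le {M : ℕ} {Ω : Type*} (K : ℕ) (γ : ℕ → Ω → ℝ) (w : ℕ → Ω → Fin M) (ω : Ω) :
    ∑ k ∈ Finset.range K, outputWeight K γ w k ω ≤ 1 := by
  unfold outputWeight
  rw [← Finset.sum_div]
  exact div_self_le_one _

namespace IsRun

variable {d M K : ℕ} {Ξ Ω : Type*} [MeasurableSpace Ξ] [mΩ : MeasurableSpace Ω] {P : Measure Ω}
  {Φ : Fin M → EuclideanSpace ℝ (Fin d) → Ξ → EuclideanSpace ℝ (Fin d)}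
  {F : EuclideanSpace ℝ (Fin d) → ℝ}
  {G : EuclideanSpace ℝ (Fin d) → EuclideanSpace ℝ (Fin d)}
  {H : Fin M → EuclideanSpace ℝ (Fin d) → EuclideanSpace ℝ (Fin d)} {L Δ σ ζ μ : ℝ}
  {w : ℕ → Ω → Fin M} {ξ : ℕ → Fin M → Ω → Ξ} {γ : ℕ → Ω → ℝ}
  {x : ℕ → Ω → EuclideanSpace ℝ (Fin d)}

theorem sum_hatStep_nonneg (h : IsRun P Φ H L Δ σ K w ξ γ x) (ω : Ω) :
    0 ≤ ∑ l ∈ Finset.range K, hatStep (fun j => γ j ω) (fun j => w j ω) (l + 1) :=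
  Finset.sum_nonneg fun _ _ => h.pendStep_nonneg _ _ ω

theorem outputWeight_nonneg (h : IsRun P Φ H L Δ σ K w ξ γ x) (k : ℕ) (ω : Ω) :
    0 ≤ outputWeight K γ w k ω :=
  div_nonneg (h.pendStep_nonneg _ _ ω) (h.sum_hatStep_nonneg ω)

theorem outputWeight_le_one (h : IsRun P Φ H L Δ σ K w ξ γ x) {k : ℕ} (hk : k < K) (ω : Ω) :
    outputWeight K γ w k ω ≤ 1 :=
  (Finset.single_le_sum (f := fun k => outputWeight K γ w k ω)
    (fun k _ => h.outputWeight_nonneg k ω) (Finset.mem_range.2 hk)).trans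
    (sum_outputWeight_le K γ w ω)

theorem measurable_outputWeight (h : IsRun P Φ H L Δ σ K w ξ γ x) (k : ℕ) :
    Measurable[scheduleAlg w x] (outputWeight K γ w k) :=
  (h.measurable_hatStep k).div (Finset.measurable_fun_sum _ fun l _ => h.measurable_hatStep l)

variable [IsProbabilityMeasure P]

/-! ### Convergence of the weighted average of the squared gradient norms -/

theorem integral_gradMass_le (h : IsRun P Φ H L Δ σ K w ξ γ x)
    (hO : IsSmoothObjective F G H L ζ μ) (hF : Integrable (fun ω => F (x 0 ω)) P)
    (hΔ : ∫ ω, F (x 0 ω) ∂P - μ ≤ Δ) :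
    Integrable (fun ω => gradMass (fun j => γ j ω) (fun j => w j ω)
        (fun j i => H i (x j ω)) K) P ∧
      ∫ ω, gradMass (fun j => γ j ω) (fun j => w j ω) (fun j i => H i (x j ω)) K ∂P
        ≤ 14 * Δ + 11 * K * stepCap L Δ σ M K * ζ ^ 2 := by
  obtain ⟨hN, hN'⟩ := h.integral_totalNoise_le hO hF
  have hmeas : Measurable fun ω => gradMass (fun j => γ j ω) (fun j => w j ω)
      (fun j i => H i (x j ω)) K := by
    unfold gradMass
    refine (Finset.measurable_fun_sum _ fun i _ => ?_).add
      (Finset.measurable_fun_sum _ fun k _ => ?_)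
    · exact ((h.measurable_pendStep 0 i).mono h.scheduleAlg_le le_rfl).mul
        (((h.measurable_grad i).comp h.measurable_init).norm.pow_const 2)
    · exact ((h.measurable_hatStep k).mono h.scheduleAlg_le le_rfl).mul
        ((h.measurable_local_worker_of h.scheduleAlg_le k
          (h.measurable_iterate' _)).norm.pow_const 2)
  -- The factor 16/3 undoes 3/16; then (16/3)(1 + 3/2) and 32/3 are rounded up to 14 and 11.
  have hle : ∀ ω, gradMass (fun j => γ j ω) (fun j => w j ω) (fun j i => H i (x j ω)) K
      ≤ 16 / 3 * ((F (x 0 ω) - μ) + 2 * K * stepCap L Δ σ M K * ζ ^ 2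
        + totalNoise L G (fun j => γ j ω) (fun j => w j ω) (fun j => x j ω)
          (fun j i => H i (x j ω)) (fun j i => runNoise Φ H w ξ x (j, i) ω) K) := fun ω => by
    have := gradMass_le h.L_pos h.Δ_pos h.M_pos h.M_le (fun k => h.step_eq k ω)
      hO.hasGradientAt hO.lipschitz (h.iterate_succ_eq ω) (fun j i => hO.dissimilarity i (x j ω))
      hO.lower_bound
    linarith
  have h0 : ∀ ω, 0 ≤ gradMass (fun j => γ j ω) (fun j => w j ω) (fun j i => H i (x j ω)) K :=
    fun ω => gradMass_nonneg h.L_pos h.Δ_pos h.M_pos h.K_pos (fun k => h.step_eq k ω) K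
  have hFμ : Integrable (fun ω => F (x 0 ω) - μ) P := hF.sub (integrable_const μ)
  have hFc : Integrable (fun ω => (F (x 0 ω) - μ) + 2 * K * stepCap L Δ σ M K * ζ ^ 2) P :=
    hFμ.add (integrable_const _)
  have hR := (hFc.add hN).const_mul (16 / 3)
  refine ⟨hR.mono' hmeas.aestronglyMeasurable (Filter.Eventually.of_forall fun ω => ?_), ?_⟩
  · rw [Real.norm_of_nonneg (h0 ω)]
    exact hle ω
  · refine (integral_mono_of_nonneg (Filter.Eventually.of_forall h0) hR
      (Filter.Eventually.of_forall hle)).trans ?_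
    simp only [Pi.add_apply]
    rw [integral_const_mul, integral_add hFc hN, integral_add hFμ (integrable_const _),
      integral_sub hF (integrable_const μ)]
    simp only [integral_const, probReal_univ, smul_eq_mul, one_mul]
    have h1 : 0 ≤ K * stepCap L Δ σ M K * ζ ^ 2 := by
      have := h.cap_pos
      positivity
    have h2 := h.Δ_pos
    linarith

theorem integrable_outputWeight (h : IsRun P Φ H L Δ σ K w ξ γ x) {k : ℕ} (hk : k < K) :
    Integrable (outputWeight K γ w k) P :=
  (integrable_const (1 : ℝ)).mono'
    ((h.measurable_outputWeight k).mono h.scheduleAlg_le le_rfl).aestronglyMeasurable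
    (Filter.Eventually.of_forall fun ω => by
      rw [Real.norm_of_nonneg (h.outputWeight_nonneg k ω)]
      exact h.outputWeight_le_one hk ω)

/-- The normalisation is at least Ks/32 on every path, with s the cap, so it can be replaced by a
constant before integrating. Passing from local to global gradients costs a factor 2, hence 64, and
the additional 2ζ². -/
theorem integral_weighted_le_of_two_mul_le (h : IsRun P Φ H L Δ σ K w ξ γ x)
    (hO : IsSmoothObjective F G H L ζ μ) (hF : Integrable (fun ω => F (x 0 ω)) P)
    (hΔ : ∫ ω, F (x 0 ω) ∂P - μ ≤ Δ) (hK : 2 * M ≤ K) :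
    ∫ ω, ∑ k ∈ Finset.range K, outputWeight K γ w k ω * ‖G (x (k + 1) ω)‖ ^ 2 ∂P
      ≤ 896 * (Δ / (K * stepCap L Δ σ M K)) + 706 * ζ ^ 2 := by
  obtain ⟨hX, hX'⟩ := h.integral_gradMass_le hO hF hΔ
  have hs := h.cap_pos
  have hK0 : (0 : ℝ) < K := by exact_mod_cast h.K_pos
  have hR := (hX.const_mul (64 / (K * stepCap L Δ σ M K))).add (integrable_const (2 * ζ ^ 2))
  refine (integral_mono_of_nonneg (Filter.Eventually.of_forall fun ω =>
    Finset.sum_nonneg fun k _ => mul_nonneg (h.outputWeight_nonneg k ω) (sq_nonneg _)) hR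
    (Filter.Eventually.of_forall fun ω => ?_)).trans ?_
  · have hΓ := le_sum_hatStep h.L_pos h.Δ_pos h.M_pos hK (fun k => h.step_eq k ω)
    have hX0 : 0 ≤ gradMass (fun j => γ j ω) (fun j => w j ω) (fun j i => H i (x j ω)) K :=
      gradMass_nonneg h.L_pos h.Δ_pos h.M_pos h.K_pos (fun k => h.step_eq k ω) K
    simp only [Pi.add_apply, outputWeight, div_mul_eq_mul_div]
    rw [← Finset.sum_div]
    set Γ := ∑ l ∈ Finset.range K, hatStep (fun j => γ j ω) (fun j => w j ω) (l + 1)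
    have hΓ0 : 0 < Γ := lt_of_lt_of_le (by positivity) hΓ
    have h1 : ∑ k ∈ Finset.range K, hatStep (fun j => γ j ω) (fun j => w j ω) (k + 1) *
        ‖G (x (k + 1) ω)‖ ^ 2
        ≤ 2 * gradMass (fun j => γ j ω) (fun j => w j ω) (fun j i => H i (x j ω)) K
          + 2 * ζ ^ 2 * Γ := by
      have h2 : ∑ k ∈ Finset.range K, hatStep (fun j => γ j ω) (fun j => w j ω) (k + 1) *
          ‖G (x (k + 1) ω)‖ ^ 2
          ≤ ∑ k ∈ Finset.range K, (2 * (hatStep (fun j => γ j ω) (fun j => w j ω) (k + 1) *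
            ‖H (w (k + 1) ω) (x (k + 1) ω)‖ ^ 2)
            + 2 * ζ ^ 2 * hatStep (fun j => γ j ω) (fun j => w j ω) (k + 1)) := by
        refine Finset.sum_le_sum fun k _ => ?_
        have := mul_le_mul_of_nonneg_left
          (hO.norm_sq_gradient_le_local (w (k + 1) ω) (x (k + 1) ω))
          (h.pendStep_nonneg (k + 2) (w (k + 1) ω) ω)
        rw [hatStep_eq_pendStep]
        linarith
      rw [Finset.sum_add_distrib, ← Finset.mul_sum, ← Finset.mul_sum] at h2
      have h3 : 0 ≤ ∑ i, pendStep (fun j => γ j ω) (fun j => w j ω) 1 i * ‖H i (x 0 ω)‖ ^ 2 :=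
        Finset.sum_nonneg fun i _ => mul_nonneg (h.pendStep_nonneg _ _ ω) (sq_nonneg _)
      unfold gradMass
      linarith
    rw [div_le_iff₀ hΓ0]
    refine h1.trans ?_
    have h4 : 2 ≤ 64 / (K * stepCap L Δ σ M K) * Γ := by
      rw [div_mul_eq_mul_div, le_div_iff₀ (by positivity)]
      linarith
    have h5 := mul_le_mul_of_nonneg_right h4 hX0
    rw [add_mul, mul_div_right_comm, mul_right_comm (64 / _)]
    linarith
  · simp only [Pi.add_apply]
    rw [integral_add (hX.const_mul _) (integrable_const _), integral_const_mul]
    simp only [integral_const, probReal_univ, smul_eq_mul, one_mul]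
    have h6 := mul_le_mul_of_nonneg_left hX'
      (by positivity : 0 ≤ 64 / (K * stepCap L Δ σ M K))
    have h7 : 64 / (K * stepCap L Δ σ M K) * (14 * Δ + 11 * K * stepCap L Δ σ M K * ζ ^ 2)
        = 896 * (Δ / (K * stepCap L Δ σ M K)) + 704 * ζ ^ 2 := by
      field_simp
      ring
    linarith

/-- Only nonnegativity, total mass at most 1 and schedule-measurability of the weights are used:
each gradient is compared with that at x_0, and the noise is estimated with the weight inside the
expectation. -/
theorem integral_weighted_le_of_lt_two_mul (h : IsRun P Φ H L Δ σ K w ξ γ x)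
    (hO : IsSmoothObjective F G H L ζ μ) (hF : Integrable (fun ω => F (x 0 ω)) P)
    (hΔ : ∫ ω, F (x 0 ω) ∂P - μ ≤ Δ) (hK : K < 2 * M) :
    ∫ ω, ∑ k ∈ Finset.range K, outputWeight K γ w k ω * ‖G (x (k + 1) ω)‖ ^ 2 ∂P
      ≤ 68 * (L * Δ) + 11 * ζ ^ 2 := by
  obtain ⟨hX, hX'⟩ := h.integral_gradMass_le hO hF hΔ
  have hs := h.cap_pos
  have hL := h.L_pos
  have hK0 : (0 : ℝ) < K := by exact_mod_cast h.K_pos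
  have hMK : (M : ℝ) ≤ K := by exact_mod_cast h.M_le
  have hρ := fun k => h.measurable_outputWeight k
  have hρ0 := fun k => h.outputWeight_nonneg k
  have hN1 : ∀ k ∈ Finset.range K, _ := fun k hk =>
    h.integral_mul_norm_initNoise_sq_le (hρ k) (hρ0 k)
      (h.outputWeight_le_one (Finset.mem_range.1 hk))
  have hN2 : ∀ k ∈ Finset.range K, _ := fun k hk =>
    h.integral_mul_norm_usedNoise_sq_le (hρ k) (hρ0 k)
      (h.outputWeight_le_one (Finset.mem_range.1 hk)) (Finset.range k)
  have hN3 : ∀ k ∈ Finset.range K, _ := fun k hk =>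
    h.integral_mul_norm_pendNoise_sq_le (hρ k) (hρ0 k)
      (h.outputWeight_le_one (Finset.mem_range.1 hk)) k
  let N : ℕ → Ω → ℝ := fun k ω => outputWeight K γ w k ω *
      (‖initNoise (fun j => γ j ω) (fun j => w j ω)
        (fun j i => runNoise Φ H w ξ x (j, i) ω)‖ ^ 2
      + ‖∑ l ∈ Finset.range k, hatStep (fun j => γ j ω) (fun j => w j ω) (l + 1) •
        runNoise Φ H w ξ x (l + 1, w (l + 1) ω) ω‖ ^ 2
      + ‖pendNoise (fun j => γ j ω) (fun j => w j ω)
        (fun j i => runNoise Φ H w ξ x (j, i) ω) k‖ ^ 2)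
  have hN : ∀ k ∈ Finset.range K, Integrable (N k) P ∧ ∫ ω, N k ω ∂P
      ≤ 3 * K * σ ^ 2 * stepCap L Δ σ M K ^ 2 * ∫ ω, outputWeight K γ w k ω ∂P := by
    intro k hk
    have h1 := (hN1 k hk).1.add (hN2 k hk).1
    have h2 := h1.add (hN3 k hk).1
    simp only [N, mul_add]
    refine ⟨h2, ?_⟩
    have e := integral_add h1 (hN3 k hk).1
    have e' := integral_add (hN1 k hk).1 (hN2 k hk).1
    simp only [Pi.add_apply] at e e'
    rw [e, e']
    have hp : 0 ≤ ∫ ω, outputWeight K γ w k ω ∂P := integral_nonneg (hρ0 k)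
    have b1 := (hN1 k hk).2
    have b2 := (hN2 k hk).2
    have b3 := (hN3 k hk).2
    have hkK : (k : ℝ) ≤ K := by exact_mod_cast (Finset.mem_range.1 hk).le
    have hc : 0 ≤ σ ^ 2 * stepCap L Δ σ M K ^ 2 * ∫ ω, outputWeight K γ w k ω ∂P := by
      positivity
    rw [Finset.card_range] at b2
    have c1 := mul_le_mul_of_nonneg_right hMK hc
    have c2 := mul_le_mul_of_nonneg_right hkK hc
    linarith
  have hG2 : Integrable (fun ω => F (x 0 ω) - μ) P := hF.sub (integrable_const μ)
  have hNsum : Integrable (fun ω => ∑ k ∈ Finset.range K, N k ω) P :=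
    integrable_finsetSum _ fun k hk => (hN k hk).1
  have hA : Integrable (fun ω => 4 * L * (F (x 0 ω) - μ) + 4 * L ^ 2 * (K * stepCap L Δ σ M K) *
      gradMass (fun j => γ j ω) (fun j => w j ω) (fun j i => H i (x j ω)) K) P :=
    (hG2.const_mul (4 * L)).add (hX.const_mul (4 * L ^ 2 * (K * stepCap L Δ σ M K)))
  have hR : Integrable (fun ω => (4 * L * (F (x 0 ω) - μ) + 4 * L ^ 2 * (K * stepCap L Δ σ M K) *
      gradMass (fun j => γ j ω) (fun j => w j ω) (fun j i => H i (x j ω)) K)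
      + 12 * L ^ 2 * ∑ k ∈ Finset.range K, N k ω) P :=
    hA.add (hNsum.const_mul (12 * L ^ 2))
  refine (integral_mono_of_nonneg (Filter.Eventually.of_forall fun ω =>
    Finset.sum_nonneg fun k _ => mul_nonneg (h.outputWeight_nonneg k ω) (sq_nonneg _)) hR
    (Filter.Eventually.of_forall fun ω => ?_)).trans ?_
  · set X := gradMass (fun j => γ j ω) (fun j => w j ω) (fun j i => H i (x j ω)) K
    have hX0 : 0 ≤ X :=
      gradMass_nonneg h.L_pos h.Δ_pos h.M_pos h.K_pos (fun k => h.step_eq k ω) K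
    have hgrad := norm_sq_gradient_le hO.hasGradientAt hO.lipschitz hL hO.lower_bound (x 0 ω)
    have hA0 : 0 ≤ 4 * L * (F (x 0 ω) - μ) + 4 * L ^ 2 * (K * stepCap L Δ σ M K) * X := by
      have := sq_nonneg ‖G (x 0 ω)‖
      have : 0 ≤ 4 * L ^ 2 * (K * stepCap L Δ σ M K) * X := by positivity
      linarith
    calc ∑ k ∈ Finset.range K, outputWeight K γ w k ω * ‖G (x (k + 1) ω)‖ ^ 2
        ≤ ∑ k ∈ Finset.range K, (outputWeight K γ w k ω *
          (4 * L * (F (x 0 ω) - μ) + 4 * L ^ 2 * (K * stepCap L Δ σ M K) * X)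
          + 12 * L ^ 2 * N k ω) := by
          refine Finset.sum_le_sum fun k hk => ?_
          have h1 := norm_gradient_sq_le (x := fun j => x j ω) (v := fun j i => H i (x j ω))
            (n := fun j i => runNoise Φ H w ξ x (j, i) ω) hL h.Δ_pos h.M_pos h.K_pos (fun k => h.step_eq k ω)
            hO.lipschitz (h.iterate_succ_eq ω) (Finset.mem_range.1 hk)
          have h2 := mul_le_mul_of_nonneg_left h1 (hρ0 k ω)
          have h3 := mul_le_mul_of_nonneg_left hgrad (hρ0 k ω)
          simp only [N]
          linarith
      _ ≤ _ := by
          rw [Finset.sum_add_distrib, ← Finset.sum_mul, ← Finset.mul_sum]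
          have := mul_le_mul_of_nonneg_right (sum_outputWeight_le K γ w ω) hA0
          linarith
  · rw [integral_add hA (hNsum.const_mul _),
      integral_add (hG2.const_mul _) (hX.const_mul _), integral_const_mul, integral_const_mul,
      integral_const_mul, integral_sub hF (integrable_const μ),
      integral_finsetSum _ fun k hk => (hN k hk).1]
    simp only [integral_const, probReal_univ, smul_eq_mul, one_mul]
    have hp : ∑ k ∈ Finset.range K, ∫ ω, outputWeight K γ w k ω ∂P ≤ 1 := by
      rw [← integral_finsetSum _ fun k hk => h.integrable_outputWeight (Finset.mem_range.1 hk)]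
      refine (integral_mono_of_nonneg (g := fun _ => (1 : ℝ)) (Filter.Eventually.of_forall fun ω =>
        Finset.sum_nonneg fun k _ => hρ0 k ω) (integrable_const _)
        (Filter.Eventually.of_forall (sum_outputWeight_le K γ w))).trans ?_
      simp
    have hNle : ∑ k ∈ Finset.range K, ∫ ω, N k ω ∂P
        ≤ 3 * K * σ ^ 2 * stepCap L Δ σ M K ^ 2 := by
      refine (Finset.sum_le_sum fun k hk => (hN k hk).2).trans ?_
      rw [← Finset.mul_sum]
      exact mul_le_of_le_one_right (by positivity) hp
    have hcap2 := mul_sq_stepCap_le (σ := σ) hL h.Δ_pos h.M_pos h.K_pos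
    -- Here K < 2M enters: the steps sum to at most 1/(2L), so the displacement from x_0 is
    -- harmless. The constant is 68 = 4 + 28 + 36, from the gradient at x_0, the mass and the noise.
    have hcap : 2 * L * (K * stepCap L Δ σ M K) ≤ 1 := by
      have h1 := mul_stepCap_le (Δ := Δ) (σ := σ) (K := K) hL h.M_pos
      have h2 : (K : ℝ) ≤ 2 * M := by exact_mod_cast hK.le
      have h3 := mul_le_mul_of_nonneg_right h2 (by positivity : 0 ≤ 2 * L * stepCap L Δ σ M K)
      linarith
    set s := K * stepCap L Δ σ M K with hsdef
    have hs0 : 0 ≤ s := by positivity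
    have b1 : 4 * L * (∫ ω, F (x 0 ω) ∂P - μ) ≤ 4 * L * Δ :=
      mul_le_mul_of_nonneg_left hΔ (by positivity)
    have b2 : 4 * L ^ 2 * s * ∫ ω, gradMass (fun j => γ j ω) (fun j => w j ω)
        (fun j i => H i (x j ω)) K ∂P ≤ 28 * (L * Δ) + 11 * ζ ^ 2 := by
      have c1 : 4 * L ^ 2 * s * (14 * Δ) ≤ 28 * (L * Δ) := by
        have := mul_le_mul_of_nonneg_right hcap (mul_nonneg hL.le h.Δ_pos.le)
        linarith
      have c2 : 4 * L ^ 2 * s * (11 * s * ζ ^ 2) ≤ 11 * ζ ^ 2 := by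
        have c3 : (2 * L * s) ^ 2 ≤ 1 := pow_le_one₀ (by positivity) hcap
        have := mul_le_mul_of_nonneg_right c3 (sq_nonneg ζ)
        linarith
      have c4 := mul_le_mul_of_nonneg_left hX' (by positivity : 0 ≤ 4 * L ^ 2 * s)
      have c5 : 11 * K * stepCap L Δ σ M K * ζ ^ 2 = 11 * s * ζ ^ 2 := by
        rw [hsdef]
        ring
      rw [c5] at c4
      linarith
    have b3 : 12 * L ^ 2 * ∑ k ∈ Finset.range K, ∫ ω, N k ω ∂P ≤ 36 * (L * Δ) := by
      have c1 := mul_le_mul_of_nonneg_left hNle (by positivity : 0 ≤ 12 * L ^ 2)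
      have c2 := mul_le_mul_of_nonneg_left hcap2 (by positivity : 0 ≤ 36 * L)
      linarith
    linarith

/-- The constant is 896 · 4, from the case K ≥ 2M and `div_stepCap_le`. -/
theorem integral_weighted_le (h : IsRun P Φ H L Δ σ K w ξ γ x)
    (hO : IsSmoothObjective F G H L ζ μ) (hF : Integrable (fun ω => F (x 0 ω)) P)
    (hΔ : ∫ ω, F (x 0 ω) ∂P - μ ≤ Δ) :
    ∫ ω, ∑ k ∈ Finset.range K, outputWeight K γ w k ω * ‖G (x (k + 1) ω)‖ ^ 2 ∂P
      ≤ 3584 * (M * L * Δ / K + Real.sqrt (L * Δ * σ ^ 2 / K) + ζ ^ 2) := by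
  have hL := h.L_pos
  have hΔ0 := h.Δ_pos
  have hK0 : (0 : ℝ) < K := by exact_mod_cast h.K_pos
  have hsqrt := Real.sqrt_nonneg (L * Δ * σ ^ 2 / K)
  have hζ := sq_nonneg ζ
  rcases le_or_gt (2 * M) K with hK | hK
  · have h1 := h.integral_weighted_le_of_two_mul_le hO hF hΔ hK
    have h2 := div_stepCap_le (σ := σ) hL hΔ0 h.M_pos h.K_pos
    linarith
  · have h1 := h.integral_weighted_le_of_lt_two_mul hO hF hΔ hK
    have h2 : L * Δ ≤ 2 * (M * L * Δ / K) := by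
      have hK' : (K : ℝ) ≤ 2 * M := by exact_mod_cast hK.le
      rw [← mul_div_assoc, le_div_iff₀ hK0]
      have := mul_le_mul_of_nonneg_left hK' (mul_nonneg hL.le hΔ0.le)
      linarith
    have h3 : 0 ≤ M * L * Δ / K := by positivity
    linarith

/-! ### The random output -/

theorem integral_output_le (h : IsRun P Φ H L Δ σ K w ξ γ x)
    (hO : IsSmoothObjective F G H L ζ μ) (hF : Integrable (fun ω => F (x 0 ω)) P)
    (hΔ : ∫ ω, F (x 0 ω) ∂P - μ ≤ Δ) {κ : Ω → ℕ} (hκ : Measurable κ)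
    (hκK : ∀ ω, κ ω ∈ Finset.Icc 1 K)
    (hκP : ∀ k ∈ Finset.Icc 1 K, P[(κ ⁻¹' {k}).indicator (fun _ => (1 : ℝ)) |
        MeasurableSpace.comap (fun ω => ((x 0 ω, fun j : ℕ => w (j + 1) ω),
          fun p : ℕ × Fin M => ξ p.1 p.2 ω)) inferInstance]
      =ᵐ[P] fun ω => hatStep (fun j => γ j ω) (fun j => w j ω) k
        / ∑ l ∈ Finset.Icc 1 K, hatStep (fun j => γ j ω) (fun j => w j ω) l) :
    Integrable (fun ω => ‖G (x (κ ω) ω)‖ ^ 2) P ∧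
      ∫ ω, ‖G (x (κ ω) ω)‖ ^ 2 ∂P
        ≤ 3584 * (M * L * Δ / K + Real.sqrt (L * Δ * σ ^ 2 / K) + ζ ^ 2) := by
  set R : Ω → (EuclideanSpace ℝ (Fin d) × (ℕ → Fin M)) × (ℕ × Fin M → Ξ) := fun ω =>
    ((x 0 ω, fun j : ℕ => w (j + 1) ω), fun p : ℕ × Fin M => ξ p.1 p.2 ω)
  have hR : Measurable R :=
    h.measurable_schedule.prodMk (measurable_pi_lambda _ fun p => h.measurable_sample p.1 p.2)
  have hRm : Measurable[MeasurableSpace.comap R inferInstance] R := comap_measurable R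
  have hIcc : Finset.Icc 1 K = (Finset.range K).map ⟨Nat.succ, Nat.succ_injective⟩ := by
    ext k
    simp only [Finset.mem_Icc, Finset.mem_map, Finset.mem_range, Function.Embedding.coeFn_mk]
    constructor
    · rintro ⟨h1, h2⟩
      exact ⟨k - 1, by omega, by omega⟩
    · rintro ⟨l, h1, rfl⟩
      omega
  have hxm : ∀ k, StronglyMeasurable[MeasurableSpace.comap R inferInstance]
      fun ω => ‖G (x k ω)‖ ^ 2 := by
    intro k
    have hx : Measurable[MeasurableSpace.comap R inferInstance] (x k) := by
      refine h.measurable_iterate_of ?_ k fun j _ i => ?_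
      · exact (measurable_fst.comp hRm).comap_le
      · exact (measurable_pi_apply (j, i)).comp (measurable_snd.comp hRm)
    exact ((hO.measurable_gradient.norm.pow_const 2).comp hx).stronglyMeasurable
  have hxi : ∀ k, Integrable (fun ω => ‖G (x k ω)‖ ^ 2) P := fun k =>
    (h.memLp_gradient hO hF k).integrable_norm_pow two_ne_zero
  have hind : ∀ k, MeasurableSet (κ ⁻¹' {k}) := fun k => hκ (measurableSet_singleton k)
  have hprod : ∀ k, Integrable ((κ ⁻¹' {k}).indicator (fun _ => (1 : ℝ)) *
      fun ω => ‖G (x k ω)‖ ^ 2) P := by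
    intro k
    refine ((hxi k).indicator (hind k)).congr (Filter.EventuallyEq.of_eq ?_)
    ext ω
    by_cases hω : ω ∈ κ ⁻¹' {k} <;> simp [hω]
  have hsplit : ∀ ω, ‖G (x (κ ω) ω)‖ ^ 2 = ∑ k ∈ Finset.Icc 1 K,
      ((κ ⁻¹' {k}).indicator (fun _ => (1 : ℝ)) * fun ω => ‖G (x k ω)‖ ^ 2) ω := by
    intro ω
    rw [Finset.sum_eq_single_of_mem (κ ω) (hκK ω)]
    · simp
    · intro k _ hk
      have : ω ∉ κ ⁻¹' {k} := fun h' => hk (by simpa using h'.symm)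
      simp [this]
  -- Given the run, x_k is known, so conditioning replaces the indicator of κ = k by its conditional
  -- probability.
  have hcond : ∀ k ∈ Finset.Icc 1 K,
      (fun ω => hatStep (fun j => γ j ω) (fun j => w j ω) k
        / (∑ l ∈ Finset.Icc 1 K, hatStep (fun j => γ j ω) (fun j => w j ω) l)
          * ‖G (x k ω)‖ ^ 2) =ᵐ[P]
        P[(κ ⁻¹' {k}).indicator (fun _ => (1 : ℝ)) * fun ω => ‖G (x k ω)‖ ^ 2 |
          MeasurableSpace.comap R inferInstance] := by
    intro k hk
    have h1 := condExp_mul_of_stronglyMeasurable_right (hxm k) (hprod k)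
      ((integrable_const (1 : ℝ)).indicator (hind k))
    filter_upwards [h1, hκP k hk] with ω e1 e2
    rw [e1, Pi.mul_apply, e2]
  simp only [hsplit]
  refine ⟨integrable_finsetSum _ fun k _ => hprod k, ?_⟩
  rw [integral_finsetSum _ fun k _ => hprod k]
  refine le_of_eq_of_le ?_ (h.integral_weighted_le hO hF hΔ)
  have hw : ∀ k ∈ Finset.Icc 1 K, ∫ ω, ((κ ⁻¹' {k}).indicator (fun _ => (1 : ℝ)) *
      fun ω => ‖G (x k ω)‖ ^ 2) ω ∂P
      = ∫ ω, hatStep (fun j => γ j ω) (fun j => w j ω) k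
        / (∑ l ∈ Finset.Icc 1 K, hatStep (fun j => γ j ω) (fun j => w j ω) l)
          * ‖G (x k ω)‖ ^ 2 ∂P := fun k hk => by
    rw [integral_congr_ae (hcond k hk), integral_condExp hR.comap_le]
  have hwi : ∀ k ∈ Finset.Icc 1 K, Integrable
      (fun ω => hatStep (fun j => γ j ω) (fun j => w j ω) k
        / (∑ l ∈ Finset.Icc 1 K, hatStep (fun j => γ j ω) (fun j => w j ω) l)
          * ‖G (x k ω)‖ ^ 2) P := fun k hk =>
    integrable_condExp.congr (hcond k hk).symm
  rw [Finset.sum_congr rfl hw, ← integral_finsetSum _ hwi]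
  simp only [hIcc, Finset.sum_map, Function.Embedding.coeFn_mk, Nat.succ_eq_add_one, outputWeight]

end IsRun

/-! ### Conclusion -/

theorem measurable_gradient_of_complete {d : ℕ} (F : EuclideanSpace ℝ (Fin d) → ℝ) :
    Measurable (gradient F) :=
  (InnerProductSpace.toDual ℝ (EuclideanSpace ℝ (Fin d))).symm.continuous.measurable.comp
    (measurable_fderiv ℝ F)

end AsyncSGD

end

theorem theorem4 :
    ∃ c : ℝ, 0 < c ∧
      ∀ (d M K : ℕ) (L Δ σ ζ : ℝ)
        {Ξ : Type*} [MeasurableSpace Ξ]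
        {Ω : Type*} [MeasurableSpace Ω] (P : Measure Ω) [IsProbabilityMeasure P]
        -- losses and local data distributions
        (f : Fin M → EuclideanSpace ℝ (Fin d) → Ξ → ℝ) (D : Fin M → Measure Ξ)
        -- initial point, active workers, samples
        (x₀ : Ω → EuclideanSpace ℝ (Fin d)) (w : ℕ → Ω → Fin M) (ξ : ℕ → Fin M → Ω → Ξ)
        -- stepsizes, iterates, index of the output
        (γ : ℕ → Ω → ℝ) (x : ℕ → Ω → EuclideanSpace ℝ (Fin d)) (κ : Ω → ℕ),
        M ≤ K → 0 < L → 0 < Δ → 0 ≤ σ → 0 ≤ ζ →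
        -- the local objectives and the stochastic gradients are well defined
        (∀ i y, Integrable (f i y) (D i)) →
        (∀ i y, ∀ᵐ s ∂(D i), DifferentiableAt ℝ (fun z => f i z s) y) →
        (∀ i, Measurable (fun p : EuclideanSpace ℝ (Fin d) × Ξ =>
          AsyncSGD.stochGrad f i p.1 p.2)) →
        (∀ i, Differentiable ℝ (AsyncSGD.localObj f D i)) →
        -- the global objective is `L`-smooth and bounded below
        AsyncSGD.LSmooth L (AsyncSGD.globalObj f D) →
        BddBelow (Set.range (AsyncSGD.globalObj f D)) →
        -- bounded gradient dissimilarity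
        (∀ i y, ‖gradient (AsyncSGD.localObj f D i) y
          - gradient (AsyncSGD.globalObj f D) y‖ ^ 2 ≤ ζ ^ 2) →
        -- initial suboptimality
        Measurable x₀ →
        Integrable (fun ω => AsyncSGD.globalObj f D (x₀ ω)) P →
        ∫ ω, AsyncSGD.globalObj f D (x₀ ω) ∂P - ⨅ y, AsyncSGD.globalObj f D y ≤ Δ →
        -- independent samples, those of worker `i` being drawn from `D i`
        (∀ k i, Measurable (ξ k i)) →
        (∀ k i, P.map (ξ k i) = D i) →
        iIndepFun (fun (p : ℕ × Fin M) ω => ξ p.1 p.2 ω) P →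
        -- the samples are independent of the initial point and the sequence of active workers
        (∀ k, 1 ≤ k → Measurable (w k)) →
        IndepFun (fun ω => (x₀ ω, fun k : ℕ => w (k + 1) ω))
          (fun ω (p : ℕ × Fin M) => ξ p.1 p.2 ω) P →
        -- the stepsizes and the iterates of Asynchronous SGD
        (∀ k ω, γ k ω = AsyncSGD.stepsize L Δ σ M K (AsyncSGD.delay (fun j => w j ω) k)) →
        (∀ k ω, x k ω = AsyncSGD.iterate f (fun j => γ j ω) (fun j => w j ω)
          (fun j i => ξ j i ω) (x₀ ω) k) →
        -- conditional mean and variance of the gradients computed at `x_k`, `k ≥ 1`, ...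
        (∀ k, 1 ≤ k → AsyncSGD.CondUnbiasedBoundedVariance P
          (MeasurableSpace.comap (fun ω => (x k ω, w k ω)) inferInstance)
          (fun ω => AsyncSGD.stochGrad f (w k ω) (x k ω) (ξ k (w k ω) ω))
          (fun ω => gradient (AsyncSGD.localObj f D (w k ω)) (x k ω)) σ) →
        -- ... and of the gradients which all workers compute at `x_0`
        (∀ i, AsyncSGD.CondUnbiasedBoundedVariance P
          (MeasurableSpace.comap (x 0) inferInstance)
          (fun ω => AsyncSGD.stochGrad f i (x 0 ω) (ξ 0 i ω))
          (fun ω => gradient (AsyncSGD.localObj f D i) (x 0 ω)) σ) →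
        -- the output is `x_κ`, where, given the run, `κ = k` with probability `∝ γ̂_k`
        Measurable κ →
        (∀ ω, κ ω ∈ Finset.Icc 1 K) →
        (∀ k ∈ Finset.Icc 1 K,
          P[(κ ⁻¹' {k}).indicator (fun _ => (1 : ℝ)) |
            MeasurableSpace.comap (fun ω => ((x₀ ω, fun j : ℕ => w (j + 1) ω),
              fun p : ℕ × Fin M => ξ p.1 p.2 ω)) inferInstance]
          =ᵐ[P] fun ω =>
            AsyncSGD.hatStep (fun j => γ j ω) (fun j => w j ω) k
              / ∑ l ∈ Finset.Icc 1 K,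
                  AsyncSGD.hatStep (fun j => γ j ω) (fun j => w j ω) l) →
        Integrable (fun ω => ‖gradient (AsyncSGD.globalObj f D) (x (κ ω) ω)‖ ^ 2) P ∧
        ∫ ω, ‖gradient (AsyncSGD.globalObj f D) (x (κ ω) ω)‖ ^ 2 ∂P
          ≤ c * (M * L * Δ / K + Real.sqrt (L * Δ * σ ^ 2 / K) + ζ ^ 2) := by
  refine ⟨3584, by norm_num, ?_⟩
  intro d M K L Δ σ ζ Ξ _ Ω _ P _ f D x₀ w ξ γ x κ hMK hL hΔ hσ hζ hfint hfdiff hgm hFi hF hbdd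
    hdis hx₀ hFint hFΔ hξ hξD hξind hw hindep hγ hx hnoise hnoise₀ hκ hκK hκP
  obtain ⟨ω₀⟩ : Nonempty Ω := nonempty_of_isProbabilityMeasure P
  -- M ≥ 1 is implicit: workers take values in `Fin M`, and a probability space is nonempty.
  have hM : 0 < M := (w 0 ω₀).pos
  have hx0 : x 0 = x₀ := by
    ext1 ω
    rw [hx, AsyncSGD.iterate]
  subst hx0
  have hrun : AsyncSGD.IsRun P (AsyncSGD.stochGrad f)
      (fun i => gradient (AsyncSGD.localObj f D i)) L Δ σ K w ξ γ x :=
    { L_pos := hL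
      Δ_pos := hΔ
      M_pos := hM
      M_le := hMK
      measurable_stoch := hgm
      measurable_grad := fun i => AsyncSGD.measurable_gradient_of_complete _
      measurable_init := hx₀
      measurable_worker := hw
      measurable_sample := hξ
      iIndepFun_sample := hξind
      indepFun_sample := hindep
      step_eq := hγ
      iterate_succ := fun k ω => by
        rw [hx (k + 1), AsyncSGD.iterate]
        simp only [← hx]
      noise := hnoise
      noise_init := hnoise₀ }
  have hobj : AsyncSGD.IsSmoothObjective (AsyncSGD.globalObj f D)
      (gradient (AsyncSGD.globalObj f D)) (fun i => gradient (AsyncSGD.localObj f D i)) L ζ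
      (⨅ y, AsyncSGD.globalObj f D y) :=
    { hasGradientAt := fun y => (hF.1 y).hasGradientAt
      lipschitz := hF.2
      dissimilarity := hdis
      lower_bound := fun y => ciInf_le hbdd y }
  exact hrun.integral_output_le hobj hFint hFΔ hκ hκK hκP
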